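/- Let $d,N\ge 1$ be integers and $s>0$ real, let $Q=[0,1]^d$, and identify $(\mathbb{R}^d)^N$ with $\mathbb{R}^{dN}$, with points $(\mathbf{x}_1,\dots,\mathbf{x}_N)$. Write $s=m+\sigma$ with $m\in\mathbb{N}_0$ and $0\le\sigma<1$. For $n\ge1$ and $\Omega\subset\mathbb{R}^n$ put $$\|u\|_{\dot H^s(\Omega)}^2:=\begin{cases}\displaystyle\sum_{|\alpha|=m}\frac{m!}{\alpha!}\int_\Omega|D^\alpha u|^2 & \text{if } \sigma=0,\\[2mm] \displaystyle c_{n,\sigma}\sum_{|\alpha|=m}\frac{m!}{\alpha!}\iint_{\Omega\times\Omega}\frac{|D^\alpha u(x)-D^\alpha u(y)|^2}{|x-y|^{n+2\sigma}}\,dx\,dy & \text{if } 0<\sigma<1,\end{cases}\qquad c_{n,\sigma}:=\frac{2^{2\sigma-1}}{\pi^{n/2}}\frac{\Gamma((n+2\sigma)/2)}{|\Gamma(-\sigma)|},$$ with weak derivatives on the interior of $\Omega$ (the value is $+\infty$ if one of them does not exist in $L^1_{\mathrm{loc}}$), and $\|u\|_{H^s(\Omega)}^2:=\|u\|_{L^2(\Omega)}^2+\|u\|_{\dot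 H^s(\Omega)}^2$. For $\Omega\subset\mathbb{R}^d$ and $u:\Omega^N\to\mathbb{C}$ define the many-body seminorm by $$\|u\|_{\dot H^{s,N}(\Omega)}^2:=\sum_{j=1}^N\int_{\Omega^{N-1}}\|u\|_{\dot H^s_{\mathbf{x}_j}(\Omega)}^2\prod_{\ell\ne j}d\mathbf{x}_\ell,$$ where $\|u\|_{\dot H^s_{\mathbf{x}_j}(\Omega)}$ is the above seminorm in the variable $\mathbf{x}_j\in\Omega$ only, formed with the weak derivatives $D^\alpha_{\mathbf{x}_j}u$, $\alpha\in\mathbb{N}_0^d$, $|\alpha|=m$, of $u$ on the interior of $\Omega^N$ (again $+\infty$ if one of them does not exist in $L^1_{\mathrm{loc}}$). (i) There are constants $c,C>0$ depending only on $d,s,N$ such that for every $u\in L^2(Q^N)$, as an inequality in $[0,\infty]$, $$c\bigl(\|u\|_{L^2(Q^N)}+\|u\|_{\dot H^{s,N}(Q)}\bigr)\le\|u\|_{H^s(Q^N)}\le C\bigl(\|u\|_{L^2(Q^N)}+\|u\|_{\dot H^{s,N}(Q)}\bigr).$$ (ii) There is a constant $C>0$ depending only on $d,s,N$ such that every $u\in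 L^2(Q^N)$ with $\|u\|_{\dot H^{s,N}(Q)}<\infty$ has an extension $\tilde u\in L^2(\mathbb{R}^{dN})$ with compact support, $\tilde u|_{Q^N}=u$ almost everywhere, and $$\|\tilde u\|_{L^2(\mathbb{R}^{dN})}+\|\tilde u\|_{\dot H^{s,N}(\mathbb{R}^d)}\le C\bigl(\|u\|_{L^2(Q^N)}+\|u\|_{\dot H^{s,N}(Q)}\bigr).$$ -/

import Mathlib

open MeasureTheory Set
open scoped ENNReal NNReal ContDiff

noncomputable section

/-- The partial derivative of `φ` in the `i`-th coordinate direction. -/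
def partialD {ι : Type} [Fintype ι] [DecidableEq ι] (i : ι)
    (φ : EuclideanSpace ℝ ι → ℝ) : EuclideanSpace ℝ ι → ℝ :=
  fun x => fderiv ℝ φ x (EuclideanSpace.single i 1)

/-- The classical derivative `D^α φ` for a multi-index `α`: the composition, over all coordinates
`i`, of the `α i`-fold partial derivatives in direction `i`. It is only applied to smooth
functions, for which the order of the coordinates is irrelevant. -/
def multiD {ι : Type} [Fintype ι] [DecidableEq ι] (α : ι → ℕ)
    (φ : EuclideanSpace ℝ ι → ℝ) : EuclideanSpace ℝ ι → ℝ :=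
  (Finset.univ : Finset ι).toList.foldr (fun i f => (partialD i)^[α i] f) φ

/-- `v` is the weak derivative `D^α u` on the open set `U`. -/
structure IsWeakDeriv {ι : Type} [Fintype ι] [DecidableEq ι] (U : Set (EuclideanSpace ℝ ι))
    (α : ι → ℕ) (u v : EuclideanSpace ℝ ι → ℂ) : Prop where
  locallyIntegrable_left : LocallyIntegrableOn u U volume
  locallyIntegrable_right : LocallyIntegrableOn v U volume
  integral_eq : ∀ φ : EuclideanSpace ℝ ι → ℝ, ContDiff ℝ ∞ φ → HasCompactSupport φ →
    tsupport φ ⊆ U →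
      ∫ x in U, multiD α φ x • u x = (-1 : ℝ) ^ (∑ i, α i) • ∫ x in U, φ x • v x

/-- The constant `c_{d,σ} = 2^{2σ-1} π^{-d/2} Γ((d+2σ)/2) / |Γ(-σ)|`. -/
def fracConst (d : ℕ) (σ : ℝ) : ℝ :=
  2 ^ (2 * σ - 1) / Real.pi ^ ((d : ℝ) / 2) *
    (Real.Gamma ((d + 2 * σ) / 2) / |Real.Gamma (-σ)|)

/-- The square of the homogeneous Sobolev seminorm `‖u‖_{Ḣ^s(Ω)}`, `Ω ⊆ ℝ^ι`, `s > 0`, with values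
in `[0, ∞]`. With `m = ⌊s⌋` and `σ = s - m` it is
`∑_{|α|=m} m!/α! ∫_Ω |D^α u|²` if `s = m`, and
`c_{d,σ} ∑_{|α|=m} m!/α! ∬_{Ω×Ω} |D^α u(x) - D^α u(y)|² / |x-y|^{d+2σ} dx dy` otherwise, where
`d = |ι|`. Derivatives are weak derivatives on the interior of `Ω`. They are unique up to null
sets, so each infimum is the value at `D^α u`; it is `∞` if `D^α u` does not exist in
`L^1_loc`. -/
def homSobolevSq {ι : Type} [Fintype ι] [DecidableEq ι] (s : ℝ) (Ω : Set (EuclideanSpace ℝ ι))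
    (u : EuclideanSpace ℝ ι → ℂ) : ℝ≥0∞ :=
  if s = ⌊s⌋₊ then
    ∑ α ∈ Finset.piAntidiag (Finset.univ : Finset ι) ⌊s⌋₊,
      (Nat.multinomial Finset.univ α : ℝ≥0∞) *
        ⨅ (v : EuclideanSpace ℝ ι → ℂ) (_ : IsWeakDeriv (interior Ω) α u v),
          ∫⁻ x in Ω, ‖v x‖ₑ ^ 2
  else
    ENNReal.ofReal (fracConst (Fintype.card ι) (s - ⌊s⌋₊)) *
    ∑ α ∈ Finset.piAntidiag (Finset.univ : Finset ι) ⌊s⌋₊,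
      (Nat.multinomial Finset.univ α : ℝ≥0∞) *
        ⨅ (v : EuclideanSpace ℝ ι → ℂ) (_ : IsWeakDeriv (interior Ω) α u v),
          ∫⁻ x in Ω, ∫⁻ y in Ω,
            ‖v x - v y‖ₑ ^ 2 / ‖x - y‖ₑ ^ ((Fintype.card ι : ℝ) + 2 * (s - ⌊s⌋₊))

/-- The norm `‖u‖_{H^s(Ω)} = (‖u‖²_{L²(Ω)} + ‖u‖²_{Ḣ^s(Ω)})^{1/2}`, with values in `[0, ∞]`. -/
def sobolevNorm {ι : Type} [Fintype ι] [DecidableEq ι] (s : ℝ) (Ω : Set (EuclideanSpace ℝ ι))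
    (u : EuclideanSpace ℝ ι → ℂ) : ℝ≥0∞ :=
  (eLpNorm u 2 (volume.restrict Ω) ^ 2 + homSobolevSq s Ω u) ^ (1 / 2 : ℝ)

/-- The position `x_j ∈ ℝ^d` of the `j`-th particle in `x = (x_1, …, x_N) ∈ (ℝ^d)^N = ℝ^{dN}`. -/
def particle {d N : ℕ} (j : Fin N) (x : EuclideanSpace ℝ (Fin N × Fin d)) :
    EuclideanSpace ℝ (Fin d) :=
  WithLp.toLp 2 fun i => x (j, i)

/-- `(x_1, …, x_N)` with the `j`-th position replaced by `y ∈ ℝ^d`. -/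
def replaceParticle {d N : ℕ} (j : Fin N) (x : EuclideanSpace ℝ (Fin N × Fin d))
    (y : EuclideanSpace ℝ (Fin d)) : EuclideanSpace ℝ (Fin N × Fin d) :=
  WithLp.toLp 2 fun p => if p.1 = j then y p.2 else x p

/-- The multi-index on `ℝ^{dN}` that acts as `α` on the `j`-th particle, so that `D^α_{x_j}` is the
derivative of this multi-index. -/
def particleIndex {d N : ℕ} (j : Fin N) (α : Fin d → ℕ) : Fin N × Fin d → ℕ :=
  fun p => if p.1 = j then α p.2 else 0

/-- The set `Ω^N ⊆ ℝ^{dN}`, for `Ω ⊆ ℝ^d`. -/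
def powSet {d : ℕ} (N : ℕ) (Ω : Set (EuclideanSpace ℝ (Fin d))) :
    Set (EuclideanSpace ℝ (Fin N × Fin d)) :=
  {x | ∀ j, particle j x ∈ Ω}

/-- The square of the many-body seminorm
`‖u‖²_{Ḣ^{s,N}(Ω)} = ∑_j ∫_{Ω^{N-1}} ‖u‖²_{Ḣ^s_{x_j}(Ω)} ∏_{ℓ ≠ j} dx_ℓ`, with values in `[0, ∞]`.
With `m = ⌊s⌋` and `σ = s - m` it is `∑_j ∑_{|α|=m} m!/α! ∫_{Ω^N} |D^α_{x_j} u|²` if `s = m`, and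
`∑_j c_{d,σ} ∑_{|α|=m} m!/α! ∫_{Ω^{N-1}} ∬_{Ω×Ω} |D^α_{x_j} u(x_j; x') - D^α_{x_j} u(y; x')|²
/ |x_j-y|^{d+2σ} dx_j dy dx'` otherwise (below, `x = (x_j; x')` runs through `Ω^N`). Derivatives
are weak derivatives on the interior of `Ω^N`; a term is `∞` if its derivative does not exist in
`L^1_loc`. -/
def manyBodySq {d N : ℕ} (s : ℝ) (Ω : Set (EuclideanSpace ℝ (Fin d)))
    (u : EuclideanSpace ℝ (Fin N × Fin d) → ℂ) : ℝ≥0∞ :=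
  if s = ⌊s⌋₊ then
    ∑ j : Fin N, ∑ α ∈ Finset.piAntidiag (Finset.univ : Finset (Fin d)) ⌊s⌋₊,
      (Nat.multinomial Finset.univ α : ℝ≥0∞) *
        ⨅ (v : EuclideanSpace ℝ (Fin N × Fin d) → ℂ)
          (_ : IsWeakDeriv (interior (powSet N Ω)) (particleIndex j α) u v),
          ∫⁻ x in powSet N Ω, ‖v x‖ₑ ^ 2
  else
    ∑ j : Fin N, ENNReal.ofReal (fracConst d (s - ⌊s⌋₊)) *
    ∑ α ∈ Finset.piAntidiag (Finset.univ : Finset (Fin d)) ⌊s⌋₊,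
      (Nat.multinomial Finset.univ α : ℝ≥0∞) *
        ⨅ (v : EuclideanSpace ℝ (Fin N × Fin d) → ℂ)
          (_ : IsWeakDeriv (interior (powSet N Ω)) (particleIndex j α) u v),
          ∫⁻ x in powSet N Ω, ∫⁻ y in Ω,
            ‖v x - v (replaceParticle j x y)‖ₑ ^ 2 /
              ‖particle j x - y‖ₑ ^ ((d : ℝ) + 2 * (s - ⌊s⌋₊))

/-- The many-body seminorm `‖u‖_{Ḣ^{s,N}(Ω)}`. -/
def manyBodySeminorm {d N : ℕ} (s : ℝ) (Ω : Set (EuclideanSpace ℝ (Fin d)))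
    (u : EuclideanSpace ℝ (Fin N × Fin d) → ℂ) : ℝ≥0∞ :=
  manyBodySq s Ω u ^ (1 / 2 : ℝ)

/-- The unit cube `Q = [0,1]^d`. -/
def unitCube (d : ℕ) : Set (EuclideanSpace ℝ (Fin d)) :=
  {x | ∀ i, x i ∈ Icc (0 : ℝ) 1}

end

/-! Everything is reduced to regularity in one real coordinate at a time, which can be extended by
reflections and read off from the Fourier transform. Let `n = dN` be the number of real coordinates.

The Gagliardo seminorm in a block of coordinates is comparable, on the unit cube, with the sum of
the Gagliardo seminorms in its single coordinates. A single coordinate is bounded by the block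
through an intermediate point, averaged over a box whose side is the distance of the two given
points (`exists_dirGag_le_blockGag`). The block is bounded by the single coordinates by changing one
coordinate after the other and integrating the kernel in the remaining ones
(`exists_blockGag_le_sum_dirGag`). The case `σ = 0` is an `L²` norm throughout. The lower bound in
(i) follows at once: `D^α_{x_j}` is one of the derivatives of order `m` on `ℝ^{dN}`, and the block
of the `j`-th particle is compared with the block of all coordinates (`exists_weakVal_le`).

For the upper bound and for (ii), a finite many-body norm provides in each coordinate the pure
derivative of order `m` and its seminorm of order `σ` in that coordinate. The extension of `u` is a
cutoff times a higher-order reflection across all faces, with weights satisfying `∑ a_k (-r_k)^p =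
1` for `p ≤ m`. For smooth `f` this reflection is `m` times differentiable along each coordinate
(`hasDerivAt_reflOp`), and it is bounded for the directional seminorms because the folding maps are
contractions (`exists_dirVal_reflOp_le`). Intermediate derivatives are controlled by Poincaré's
inequality on the unit interval. Plancherel then bounds `∫ |ξ_i|^{2(m+σ)} |ŵ|²` for each `i`
(`exists_lintegral_weight_fourierL2_reflOp_le`). A general `u` is contracted towards the centre of
the cube and mollified. The approximations converge in `L²` with bounded directional seminorms,
which suffices for the weighted bound, since truncated weights pass to the limit
(`exists_extension_fourierL2`).

On the Fourier side mixed derivatives cost nothing: `|ξ_k|^{2σ} |ξ^β|²` with `|β| = m` is at most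
the sum of the `|ξ_i|^{2(m+σ)}`. Hence the extension has all weak derivatives of order `m`, with
directional seminorms on the whole space. Reassembling coordinates into the particle blocks gives
(ii). Restricting to the cube and reassembling all coordinates into one block gives the upper bound
in (i). -/

set_option linter.unusedSectionVars false

/-! ### Exchange of coordinates and coordinatewise maps in product measures -/

section CoordinateSwap

variable {ι κ : Type} [Fintype ι] [Fintype κ] [DecidableEq ι] [DecidableEq κ]

/-- Exchanging one coordinate between two points preserves the product measure. -/
theorem measurePreserving_exchange (μ : Measure ℝ) [SigmaFinite μ] (i : ι) (k : κ) :
    MeasurePreserving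
      (fun p : (ι → ℝ) × (κ → ℝ) =>
        (Function.update p.1 i (p.2 k), Function.update p.2 k (p.1 i)))
      ((Measure.pi fun _ : ι => μ).prod (Measure.pi fun _ : κ => μ))
      ((Measure.pi fun _ : ι => μ).prod (Measure.pi fun _ : κ => μ)) := by
  -- The two factors form one product over `ι ⊕ κ`, in which the exchange is the transposition of
  -- the indices `inl i` and `inr k`; permuting the coordinates of a power of `μ` preserves it.
  have h1 := measurePreserving_sumPiEquivProdPi (X := fun _ : ι ⊕ κ => ℝ) (fun _ => μ)
  have h2 := measurePreserving_arrowCongr' (fun _ : ι ⊕ κ => μ) (fun _ => μ)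
    (Equiv.swap (Sum.inl i) (Sum.inr k)) (MeasurableEquiv.refl ℝ)
    (fun _ => MeasurePreserving.id μ)
  have h3 := measurePreserving_sumPiEquivProdPi_symm (X := fun _ : ι ⊕ κ => ℝ) (fun _ => μ)
  have h := h1.comp (h2.comp h3)
  convert! h using 1
  funext p
  refine Prod.ext ?_ ?_
  · funext j
    by_cases hj : j = i
    · subst hj
      simp [MeasurableEquiv.coe_sumPiEquivProdPi, MeasurableEquiv.coe_sumPiEquivProdPi_symm,
        MeasurableEquiv.arrowCongr', Equiv.arrowCongr', Equiv.sumPiEquivProdPi]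
    · have : Equiv.swap (Sum.inl i) (Sum.inr k) (Sum.inl j : ι ⊕ κ) = Sum.inl j :=
        Equiv.swap_apply_of_ne_of_ne (by simpa using hj) (by simp)
      simp [MeasurableEquiv.coe_sumPiEquivProdPi, MeasurableEquiv.coe_sumPiEquivProdPi_symm,
        MeasurableEquiv.arrowCongr', Equiv.arrowCongr', Equiv.sumPiEquivProdPi, hj, this]
  · funext j
    by_cases hj : j = k
    · subst hj
      simp [MeasurableEquiv.coe_sumPiEquivProdPi, MeasurableEquiv.coe_sumPiEquivProdPi_symm,
        MeasurableEquiv.arrowCongr', Equiv.arrowCongr', Equiv.sumPiEquivProdPi]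
    · have : Equiv.swap (Sum.inl i) (Sum.inr k) (Sum.inr j : ι ⊕ κ) = Sum.inr j :=
        Equiv.swap_apply_of_ne_of_ne (by simp) (by simpa using hj)
      simp [MeasurableEquiv.coe_sumPiEquivProdPi, MeasurableEquiv.coe_sumPiEquivProdPi_symm,
        MeasurableEquiv.arrowCongr', Equiv.arrowCongr', Equiv.sumPiEquivProdPi, hj, this]

theorem lintegral_exchange (μ : Measure ℝ) [SigmaFinite μ] (i : ι) (k : κ)
    {F : (ι → ℝ) → (κ → ℝ) → ℝ≥0∞} (hF : Measurable (Function.uncurry F)) :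
    ∫⁻ x, ∫⁻ y, F (Function.update x i (y k)) (Function.update y k (x i))
        ∂(Measure.pi fun _ : κ => μ) ∂(Measure.pi fun _ : ι => μ)
      = ∫⁻ x, ∫⁻ y, F x y ∂(Measure.pi fun _ : κ => μ) ∂(Measure.pi fun _ : ι => μ) := by
  have h := (measurePreserving_exchange μ i k).lintegral_comp hF
  have h' := lintegral_prod (μ := Measure.pi fun _ : ι => μ) (ν := Measure.pi fun _ : κ => μ) _
    (hF.comp (measurePreserving_exchange μ i k).measurable).aemeasurable
  rw [lintegral_prod _ hF.aemeasurable] at h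
  exact h'.symm.trans h

/-- The case `κ = Unit`. It is the symmetry of one-coordinate Gagliardo integrals under interchange
of the two points that are compared. -/
theorem lintegral_exchange_real (μ : Measure ℝ) [SigmaFinite μ] (i : ι)
    {F : (ι → ℝ) → ℝ → ℝ≥0∞} (hF : Measurable (Function.uncurry F)) :
    ∫⁻ x, ∫⁻ t, F (Function.update x i t) (x i) ∂μ ∂(Measure.pi fun _ : ι => μ)
      = ∫⁻ x, ∫⁻ t, F x t ∂μ ∂(Measure.pi fun _ : ι => μ) := by
  have hu := measurePreserving_funUnique μ Unit
  have h := lintegral_exchange (κ := Unit) μ i () (F := fun x y => F x (y ()))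
    (hF.comp (measurable_fst.prodMk ((measurable_pi_apply ()).comp measurable_snd)))
  have key : ∀ G : ℝ → ℝ≥0∞,
      ∫⁻ y, G (y ()) ∂(Measure.pi fun _ : Unit => μ) = ∫⁻ t, G t ∂μ := fun G =>
    hu.lintegral_comp_emb (MeasurableEquiv.funUnique Unit ℝ).measurableEmbedding G
  simp only [Function.update_self] at h
  calc _ = ∫⁻ x, ∫⁻ y : Unit → ℝ, F (Function.update x i (y ())) (x i)
        ∂(Measure.pi fun _ : Unit => μ) ∂(Measure.pi fun _ : ι => μ) :=
        lintegral_congr fun x => (key fun t => F (Function.update x i t) (x i)).symm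
    _ = _ := h
    _ = _ := lintegral_congr fun x => key fun t => F x t

theorem lintegral_update (μ : Measure ℝ) [SigmaFinite μ] (i : ι)
    {F : (ι → ℝ) → ℝ≥0∞} (hF : Measurable F) :
    ∫⁻ x, ∫⁻ t, F (Function.update x i t) ∂μ ∂(Measure.pi fun _ : ι => μ)
      = μ univ * ∫⁻ x, F x ∂(Measure.pi fun _ : ι => μ) := by
  rw [lintegral_exchange_real (F := fun x _ => F x) μ i (hF.comp measurable_fst)]
  simp only [lintegral_const]
  rw [lintegral_mul_const _ hF, mul_comm]

/-- The image of a product measure under a coordinatewise map. -/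
theorem map_pi_le {μ ν : Measure ℝ} [SigmaFinite μ] [SigmaFinite ν] {θ : ι → ℝ → ℝ}
    (hθ : ∀ i, Measurable (θ i)) {c : ℝ≥0} (h : ∀ i, μ.map (θ i) ≤ c • ν) :
    (Measure.pi fun _ : ι => μ).map (fun x i => θ i (x i))
      ≤ c ^ Fintype.card ι • (Measure.pi fun _ : ι => ν) := by
  have hs : ∀ i, SigmaFinite (μ.map (θ i)) := fun i => Measure.sigmaFinite_of_le (c • ν) (h i)
  rw [Measure.pi_map_pi fun i => (hθ i).aemeasurable]
  have h1 : Measure.pi (fun i => μ.map (θ i)) ≤ Measure.pi fun _ : ι => c • ν := by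
    -- The product outer measure is the largest one bounded on boxes by the products of the side
    -- measures, so a comparison on boxes extends to all sets.
    have h2 : (Measure.pi (fun i => μ.map (θ i))).toOuterMeasure
        ≤ OuterMeasure.pi fun _ : ι => (c • ν).toOuterMeasure := by
      rw [OuterMeasure.le_pi]
      intro s _
      calc _ = ∏ i, μ.map (θ i) (s i) := Measure.pi_pi _ _
        _ ≤ _ := Finset.prod_le_prod' fun i _ => h i (s i)
    refine Measure.le_iff.2 fun s hs => ?_
    conv_rhs => rw [Measure.pi, toMeasure_apply _ _ hs]
    exact h2 s
  refine h1.trans (le_of_eq (Measure.pi_eq fun s _ => ?_))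
  have h3 : ∀ (a : ℝ≥0) (x : ℝ≥0∞), a • x = (a : ℝ≥0∞) * x := fun a x => rfl
  simp only [Measure.smul_apply, Measure.pi_pi, h3, Finset.prod_mul_distrib, Finset.prod_const,
    Finset.card_univ, ENNReal.coe_pow]

theorem lintegral_comp_pi_le {μ ν : Measure ℝ} [SigmaFinite μ] [SigmaFinite ν] {θ : ι → ℝ → ℝ}
    (hθ : ∀ i, Measurable (θ i)) {c : ℝ≥0} (h : ∀ i, μ.map (θ i) ≤ c • ν)
    {F : (ι → ℝ) → ℝ≥0∞} (hF : Measurable F) :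
    ∫⁻ x, F (fun i => θ i (x i)) ∂(Measure.pi fun _ : ι => μ)
      ≤ c ^ Fintype.card ι * ∫⁻ x, F x ∂(Measure.pi fun _ : ι => ν) := by
  have hm : Measurable fun (x : ι → ℝ) i => θ i (x i) :=
    measurable_pi_lambda _ fun i => (hθ i).comp (measurable_pi_apply i)
  rw [← lintegral_map (μ := Measure.pi fun _ : ι => μ) hF hm]
  refine (lintegral_mono' (map_pi_le hθ h) le_rfl).trans ?_
  rw [lintegral_smul_measure]
  simp [ENNReal.smul_def]

theorem lintegral_comp_pi_real_le {μ ν : Measure ℝ} [SigmaFinite μ] [SigmaFinite ν]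
    {θ : ι → ℝ → ℝ} (hθ : ∀ i, Measurable (θ i)) {c : ℝ≥0} (h : ∀ i, μ.map (θ i) ≤ c • ν) (i : ι)
    {F : (ι → ℝ) → ℝ → ℝ≥0∞} (hF : Measurable (Function.uncurry F)) :
    ∫⁻ x, ∫⁻ t, F (fun j => θ j (x j)) (θ i t) ∂μ ∂(Measure.pi fun _ : ι => μ)
      ≤ c ^ (Fintype.card ι + 1) * ∫⁻ x, ∫⁻ t, F x t ∂ν ∂(Measure.pi fun _ : ι => ν) := by
  have h1 : ∀ x, ∫⁻ t, F x (θ i t) ∂μ ≤ c * ∫⁻ t, F x t ∂ν := fun x => by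
    rw [← lintegral_map (f := F x) (hF.comp measurable_prodMk_left) (hθ i)]
    refine (lintegral_mono' (h i) le_rfl).trans ?_
    rw [lintegral_smul_measure]
    simp [ENNReal.smul_def]
  have hm : Measurable fun x => ∫⁻ t, F x t ∂ν := hF.lintegral_prod_right
  calc _ ≤ ∫⁻ x, c * ∫⁻ t, F (fun j => θ j (x j)) t ∂ν ∂(Measure.pi fun _ : ι => μ) :=
        lintegral_mono fun x => h1 _
    _ = c * ∫⁻ x, ∫⁻ t, F (fun j => θ j (x j)) t ∂ν ∂(Measure.pi fun _ : ι => μ) :=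
        lintegral_const_mul' _ _ ENNReal.coe_ne_top
    _ ≤ c * (c ^ Fintype.card ι * ∫⁻ x, ∫⁻ t, F x t ∂ν ∂(Measure.pi fun _ : ι => ν)) := by
        gcongr
        exact lintegral_comp_pi_le hθ h hm
    _ = _ := by rw [pow_succ]; ring

end CoordinateSwap

/-! ### Kernels and near-diagonal sets for Gagliardo seminorms -/

section Gagliardo

/-- The one-dimensional kernel integral behind the comparison of Gagliardo seminorms. -/
theorem exists_lintegral_kernel_le {ε : ℝ} (hε : 0 < ε) :
    ∃ C : ℝ≥0, ∀ (a : ℝ) (r : ℝ≥0), r ≠ 0 →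
      ∫⁻ s, ((r : ℝ≥0∞) + ‖a - s‖ₑ) ^ (-(1 + ε)) ≤ C * (r : ℝ≥0∞) ^ (-ε) := by
  have h0 : ∫⁻ s : ℝ, (1 + ‖s‖ₑ) ^ (-(1 + ε)) < ⊤ := by
    have := finite_integral_one_add_norm (E := ℝ) (μ := volume) (r := 1 + ε) (by simpa using hε)
    refine lt_of_eq_of_lt (lintegral_congr fun s => ?_) this
    rw [← ENNReal.ofReal_rpow_of_pos (by positivity),
      ENNReal.ofReal_add zero_le_one (norm_nonneg _), ofReal_norm, ENNReal.ofReal_one]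
  -- The constant is the integral for `a = 0` and `r = 1`; translation and dilation reduce every
  -- other case to it.
  refine ⟨(∫⁻ s : ℝ, (1 + ‖s‖ₑ) ^ (-(1 + ε))).toNNReal, fun a r hr => ?_⟩
  rw [ENNReal.coe_toNNReal h0.ne]
  have hr0 : (r : ℝ≥0∞) ≠ 0 := by simpa using hr
  have h1 : ∫⁻ s, ((r : ℝ≥0∞) + ‖a - s‖ₑ) ^ (-(1 + ε))
      = ∫⁻ s : ℝ, ((r : ℝ≥0∞) + ‖s‖ₑ) ^ (-(1 + ε)) := 
    lintegral_sub_left_eq_self (μ := volume) (fun s : ℝ => ((r : ℝ≥0∞) + ‖s‖ₑ) ^ (-(1 + ε))) a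
  have hrr : (r : ℝ) ≠ 0 := by simpa using hr
  have h2 : ∫⁻ s, ((r : ℝ≥0∞) + ‖(r : ℝ) * s‖ₑ) ^ (-(1 + ε))
      = (r : ℝ≥0∞)⁻¹ * ∫⁻ s : ℝ, ((r : ℝ≥0∞) + ‖s‖ₑ) ^ (-(1 + ε)) := by
    rw [← lintegral_map (f := fun s : ℝ => ((r : ℝ≥0∞) + ‖s‖ₑ) ^ (-(1 + ε)))
      (g := fun s => (r : ℝ) * s) (by fun_prop) (by fun_prop), Real.map_volume_mul_left hrr,
      lintegral_smul_measure, abs_of_nonneg (by positivity), ENNReal.ofReal_inv_of_pos (by positivity)]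
    simp
  have h3 : ∫⁻ s, ((r : ℝ≥0∞) + ‖(r : ℝ) * s‖ₑ) ^ (-(1 + ε))
      = (r : ℝ≥0∞) ^ (-(1 + ε)) * ∫⁻ s : ℝ, (1 + ‖s‖ₑ) ^ (-(1 + ε)) := by
    rw [← lintegral_const_mul _ (by fun_prop)]
    refine lintegral_congr fun s => ?_
    rw [← ENNReal.mul_rpow_of_ne_top (by simp) (by simp), enorm_mul, mul_add, mul_one]
    simp
  rw [h1]
  have h4 : ∫⁻ s : ℝ, ((r : ℝ≥0∞) + ‖s‖ₑ) ^ (-(1 + ε)) = r * ((r : ℝ≥0∞)⁻¹ *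
      ∫⁻ s : ℝ, ((r : ℝ≥0∞) + ‖s‖ₑ) ^ (-(1 + ε))) := by
    rw [← mul_assoc, ENNReal.mul_inv_cancel hr0 (by simp), one_mul]
  rw [h4, ← h2, h3, ← mul_assoc, mul_comm]
  refine mul_le_mul_right (le_of_eq ?_) _
  conv_lhs => rw [← ENNReal.rpow_one (r : ℝ≥0∞)]
  rw [← ENNReal.rpow_mul, ← ENNReal.rpow_add _ _ hr0 (by simp)]
  congr 1; ring

variable {ι κ : Type} [Fintype ι] [Fintype κ] [DecidableEq ι] [DecidableEq κ]

/-- The square of the Gagliardo seminorm in the `i`-th coordinate. -/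
noncomputable def dirGag (μ : Measure ℝ) (σ : ℝ) (i : ι) (v : (ι → ℝ) → ℂ) : ℝ≥0∞ :=
  ∫⁻ x, ∫⁻ t, ‖v x - v (Function.update x i t)‖ₑ ^ 2 / ‖x i - t‖ₑ ^ (1 + 2 * σ) ∂μ
    ∂(Measure.pi fun _ => μ)

/-- The square of the Gagliardo seminorm in the block of coordinates selected by `e`. -/
noncomputable def blockGag (e : κ → ι) (μ : Measure ℝ) (σ : ℝ) (v : (ι → ℝ) → ℂ) : ℝ≥0∞ :=
  ∫⁻ x, ∫⁻ y, ‖v x - v (Function.extend e y x)‖ₑ ^ 2 /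
      ‖WithLp.toLp 2 (fun k => x (e k)) - WithLp.toLp 2 y‖ₑ ^ ((Fintype.card κ : ℝ) + 2 * σ)
      ∂(Measure.pi fun _ => μ) ∂(Measure.pi fun _ => μ)

theorem measurable_extend (e : κ → ι) :
    Measurable fun p : (ι → ℝ) × (κ → ℝ) => Function.extend e p.2 p.1 := by
  classical
  refine measurable_pi_lambda _ fun j => ?_
  by_cases h : ∃ k, e k = j
  · simp only [Function.extend_def, dif_pos h]
    exact (measurable_pi_apply _).comp measurable_snd
  · simp only [Function.extend_def, dif_neg h]
    exact (measurable_pi_apply _).comp measurable_fst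

theorem enorm_sub_sq_le (a b c : ℂ) : ‖a - c‖ₑ ^ 2 ≤ 2 * (‖a - b‖ₑ ^ 2 + ‖b - c‖ₑ ^ 2) := by
  have h1 : ‖a - c‖ₑ ≤ ‖a - b‖ₑ + ‖b - c‖ₑ := by
    simpa using enorm_add_le (a - b) (b - c)
  have h2 := ENNReal.rpow_add_le_mul_rpow_add_rpow (‖a - b‖ₑ) (‖b - c‖ₑ) (p := 2) one_le_two
  norm_num at h2
  exact (pow_le_pow_left' h1 2).trans h2

/-- The intermediate point does not see the coordinate `e k` of `x`. It therefore serves both `x`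
and its modification in that coordinate, and differs from either only inside the block. -/
theorem extend_update_of_mem {e : κ → ι} (he : e.Injective) (k : κ) (x : ι → ℝ) (y : κ → ℝ)
    (t : ℝ) : Function.extend e y (Function.update x (e k) t) = Function.extend e y x := by
  funext j
  by_cases h : ∃ l, e l = j
  · obtain ⟨l, rfl⟩ := h
    simp [he.extend_apply]
  · rw [Function.extend_apply' _ _ _ h, Function.extend_apply' _ _ _ h,
      Function.update_of_ne fun hj => h ⟨k, hj.symm⟩]

/-- The near-diagonal neighbourhood of both `x` and its modification in the coordinate `e k`. -/
def nearSet (e : κ → ι) (k : κ) : Set (((ι → ℝ) × ℝ) × (κ → ℝ)) :=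
  {p | (∀ l, |p.1.1 (e l) - p.2 l| ≤ |p.1.1 (e k) - p.1.2|) ∧
    |p.1.2 - p.2 k| ≤ |p.1.1 (e k) - p.1.2|}

theorem measurableSet_nearSet (e : κ → ι) (k : κ) : MeasurableSet (nearSet e k) := by
  have h : nearSet e k = (⋂ l, {p : ((ι → ℝ) × ℝ) × (κ → ℝ) |
      |p.1.1 (e l) - p.2 l| ≤ |p.1.1 (e k) - p.1.2|}) ∩
      {p | |p.1.2 - p.2 k| ≤ |p.1.1 (e k) - p.1.2|} := by
    ext p; simp [nearSet]
  rw [h]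
  refine (MeasurableSet.iInter fun l => measurableSet_le ?_ ?_).inter (measurableSet_le ?_ ?_)
  all_goals fun_prop

/-- Interchanging `x (e k)` and `t` interchanges the two conditions on `y k`. For this symmetry the
set asks `y k` to be close to both. -/
theorem nearSet_update {e : κ → ι} (he : e.Injective) (k : κ) (x : ι → ℝ) (t : ℝ) (y : κ → ℝ) :
    ((Function.update x (e k) t, x (e k)), y) ∈ nearSet e k ↔ ((x, t), y) ∈ nearSet e k := by
  simp only [nearSet, mem_ofPred_eq, Function.update_self, abs_sub_comm t (x (e k))]
  constructor
  · rintro ⟨h1, h2⟩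
    refine ⟨fun l => ?_, by simpa using h1 k⟩
    by_cases hl : l = k
    · exact hl ▸ h2
    · simpa [he.ne hl] using h1 l
  · rintro ⟨h1, h2⟩
    refine ⟨fun l => ?_, h1 k⟩
    by_cases hl : l = k
    · subst hl; simpa using h2
    · simpa [he.ne hl] using h1 l

/-- The set contains a box of side `h = |x (e k) - t|` inside the unit cube. Its `k`-th side is the
interval between `x (e k)` and `t`. Any other side starts at `x (e l)`, or is `[1 - h, 1]` when
there is no room to the right, in which case `x (e l)` lies in it. -/
theorem pow_le_measure_nearSet (e : κ → ι) (k : κ) {x : ι → ℝ} (hx : ∀ i, x i ∈ Icc (0 : ℝ) 1)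
    {t : ℝ} (ht : t ∈ Icc (0 : ℝ) 1) :
    ‖x (e k) - t‖ₑ ^ Fintype.card κ ≤
      (Measure.pi fun _ : κ => volume.restrict (Icc (0 : ℝ) 1))
        {y | ((x, t), y) ∈ nearSet e k} := by
  set h := |x (e k) - t| with hh
  have hh1 : h ≤ 1 := abs_le.2 ⟨by linarith [(hx (e k)).1, ht.2], by linarith [(hx (e k)).2, ht.1]⟩
  have hh0 : 0 ≤ h := abs_nonneg _
  -- an interval of length `h` in each coordinate
  have key : ∀ l, ∃ a, Icc a (a + h) ⊆ Icc (0 : ℝ) 1 ∧ ∀ s ∈ Icc a (a + h), |x (e l) - s| ≤ h ∧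
      (l = k → |t - s| ≤ h) := by
    intro l
    by_cases hl : l = k
    · subst hl
      refine ⟨min (x (e l)) t, ?_, ?_⟩
      · rcases le_total (x (e l)) t with hle | hle
        · have : h = t - x (e l) := by rw [hh, abs_sub_comm, abs_of_nonneg (by linarith)]
          rw [min_eq_left hle, this]
          exact Icc_subset_Icc (hx _).1 (by linarith [ht.2])
        · have : h = x (e l) - t := by rw [hh, abs_of_nonneg (by linarith)]
          rw [min_eq_right hle, this]
          exact Icc_subset_Icc ht.1 (by linarith [(hx (e l)).2])
      · intro s hs
        rcases le_total (x (e l)) t with hle | hle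
        · have : h = t - x (e l) := by rw [hh, abs_sub_comm, abs_of_nonneg (by linarith)]
          rw [min_eq_left hle, this] at hs
          rw [this]
          exact ⟨abs_le.2 ⟨by linarith [hs.2], by linarith [hs.1]⟩,
            fun _ => abs_le.2 ⟨by linarith [hs.2], by linarith [hs.1]⟩⟩
        · have : h = x (e l) - t := by rw [hh, abs_of_nonneg (by linarith)]
          rw [min_eq_right hle, this] at hs
          rw [this]
          exact ⟨abs_le.2 ⟨by linarith [hs.2], by linarith [hs.1]⟩,
            fun _ => abs_le.2 ⟨by linarith [hs.2], by linarith [hs.1]⟩⟩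
    · have hxl := hx (e l)
      by_cases hc : x (e l) + h ≤ 1
      · exact ⟨x (e l), Icc_subset_Icc hxl.1 hc, fun s hs =>
          ⟨abs_le.2 ⟨by linarith [hs.2], by linarith [hs.1]⟩, fun h => absurd h hl⟩⟩
      · exact ⟨1 - h, Icc_subset_Icc (by linarith) (by linarith), fun s hs =>
          ⟨abs_le.2 ⟨by linarith [hs.2, hxl.1], by linarith [hs.1, hxl.2]⟩, fun h => absurd h hl⟩⟩
  choose a ha1 ha2 using key
  calc ‖x (e k) - t‖ₑ ^ Fintype.card κ
      = ∏ l : κ, (volume.restrict (Icc (0 : ℝ) 1)) (Icc (a l) (a l + h)) := by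
        have : ∀ l, (volume.restrict (Icc (0 : ℝ) 1)) (Icc (a l) (a l + h)) = ‖x (e k) - t‖ₑ := by
          intro l
          rw [Measure.restrict_apply measurableSet_Icc, inter_eq_left.2 (ha1 l), Real.volume_Icc,
            add_sub_cancel_left, hh, ← Real.norm_eq_abs, ofReal_norm]
        simp [this]
    _ = (Measure.pi fun _ : κ => volume.restrict (Icc (0 : ℝ) 1))
          (univ.pi fun l => Icc (a l) (a l + h)) := (Measure.pi_pi _ _).symm
    _ ≤ _ := measure_mono fun y hy => show _ ∧ _ from
        ⟨fun l => (ha2 l (y l) (hy l (mem_univ l))).1, (ha2 k (y k) (hy k (mem_univ k))).2 rfl⟩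

end Gagliardo

/-! ### A single coordinate is controlled by a block -/

section Gagliardo

variable {ι κ : Type} [Fintype ι] [Fintype κ] [DecidableEq ι] [DecidableEq κ]

theorem ae_pi_mem {I : Set ℝ} (hI : MeasurableSet I) :
    ∀ᵐ x ∂(Measure.pi fun _ : ι => volume.restrict I), ∀ i, x i ∈ I := by
  rw [ae_all_iff]
  intro i
  exact (Measure.quasiMeasurePreserving_eval (fun _ : ι => volume.restrict I) i).tendsto_ae
    (ae_restrict_mem hI)

theorem enorm_toLp_sub_le (x y : κ → ℝ) {h : ℝ} (H : ∀ l, |x l - y l| ≤ h) :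
    ‖WithLp.toLp 2 x - WithLp.toLp 2 y‖ₑ ≤ (Fintype.card κ : ℝ≥0∞) * ENNReal.ofReal h := by
  rcases isEmpty_or_nonempty κ with hκ | ⟨⟨k⟩⟩
  · have : WithLp.toLp 2 x - WithLp.toLp 2 y = 0 := Subsingleton.elim _ _
    simp [this]
  have hh : 0 ≤ h := (abs_nonneg _).trans (H k)
  have h1 : ‖WithLp.toLp 2 x - WithLp.toLp 2 y‖ ≤ Fintype.card κ * h := by
    rw [EuclideanSpace.norm_eq]
    refine Real.sqrt_le_iff.2 ⟨by positivity, ?_⟩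
    calc ∑ i, ‖(WithLp.toLp 2 x - WithLp.toLp 2 y) i‖ ^ 2 ≤ ∑ _i : κ, h ^ 2 :=
          Finset.sum_le_sum fun i _ => pow_le_pow_left₀ (norm_nonneg _)
            (by simpa [Real.norm_eq_abs] using H i) 2
      _ = Fintype.card κ * h ^ 2 := by simp
      _ ≤ (Fintype.card κ * h) ^ 2 := by
          have : (1 : ℝ) ≤ Fintype.card κ := by
            exact_mod_cast Fintype.card_pos_iff.2 ⟨k⟩
          nlinarith [mul_nonneg (sub_nonneg.2 this) (sq_nonneg h),
            mul_nonneg (mul_nonneg (sub_nonneg.2 this) (sq_nonneg h)) (by linarith : (0:ℝ) ≤ Fintype.card κ)]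
  rw [← ofReal_norm, ← ENNReal.ofReal_natCast, ← ENNReal.ofReal_mul (by positivity)]
  exact ENNReal.ofReal_le_ofReal h1

theorem abs_sub_le_norm_toLp_sub (x y : κ → ℝ) (l : κ) :
    ‖x l - y l‖ₑ ≤ ‖WithLp.toLp 2 x - WithLp.toLp 2 y‖ₑ := by
  rw [← ofReal_norm, ← ofReal_norm]
  exact ENNReal.ofReal_le_ofReal
    (by simpa using PiLp.norm_apply_le (WithLp.toLp 2 x - WithLp.toLp 2 y) l)

/-- The exchange of `x i` and `t` preserves the measure, so both terms on the right have the same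
integral and the constants add to `2 + 2`. -/
theorem lintegral_le_four_mul_of_exchange {μ : Measure ℝ} [SigmaFinite μ] (i : ι)
    {f G : (ι → ℝ) → ℝ → ℝ≥0∞} (hG : Measurable (Function.uncurry G))
    (h : ∀ᵐ x ∂(Measure.pi fun _ : ι => μ), ∀ᵐ t ∂μ,
      f x t ≤ 2 * G x t + 2 * G (Function.update x i t) (x i)) :
    ∫⁻ x, ∫⁻ t, f x t ∂μ ∂(Measure.pi fun _ => μ)
      ≤ 4 * ∫⁻ x, ∫⁻ t, G x t ∂μ ∂(Measure.pi fun _ => μ) := by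
  have hG' : Measurable fun q : (ι → ℝ) × ℝ => G (Function.update q.1 i q.2) (q.1 i) :=
    hG.comp (g := Function.uncurry G)
      (f := fun q : (ι → ℝ) × ℝ => (Function.update q.1 i q.2, q.1 i)) (by fun_prop)
  have m1 : ∀ x, Measurable fun t => G x t := fun x => hG.of_uncurry_left
  have m2 : ∀ x, Measurable fun t => G (Function.update x i t) (x i) := fun x =>
    hG'.comp (measurable_prodMk_left (x := x))
  have m3 : Measurable fun x => ∫⁻ t, G x t ∂μ := hG.lintegral_prod_right
  have m4 : Measurable fun x => ∫⁻ t, G (Function.update x i t) (x i) ∂μ :=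
    hG'.lintegral_prod_right
  calc ∫⁻ x, ∫⁻ t, f x t ∂μ ∂(Measure.pi fun _ => μ)
      ≤ ∫⁻ x, ∫⁻ t, (2 * G x t + 2 * G (Function.update x i t) (x i)) ∂μ
          ∂(Measure.pi fun _ => μ) :=
        lintegral_mono_ae (h.mono fun x hx => lintegral_mono_ae hx)
    _ = ∫⁻ x, (2 * ∫⁻ t, G x t ∂μ + 2 * ∫⁻ t, G (Function.update x i t) (x i) ∂μ)
          ∂(Measure.pi fun _ => μ) := by
        refine lintegral_congr fun x => ?_
        rw [lintegral_add_left ((m1 x).const_mul 2), lintegral_const_mul _ (m1 x),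
          lintegral_const_mul _ (m2 x)]
    _ = _ := by
        rw [lintegral_add_left (m3.const_mul 2), lintegral_const_mul _ m3,
          lintegral_const_mul _ m4, lintegral_exchange_real μ i hG, ← add_mul]
        norm_num

/-- The kernel `|x_{e k} - t| ^ (-(1 + p))`, restricted to the near-diagonal set. -/
noncomputable def nearKernel (e : κ → ι) (k : κ) (p : ℝ) (x : ι → ℝ) (t : ℝ) (y : κ → ℝ) :
    ℝ≥0∞ :=
  (nearSet e k).indicator (fun q => ‖q.1.1 (e k) - q.1.2‖ₑ ^ (-(1 + p))) ((x, t), y)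

theorem measurable_nearKernel (e : κ → ι) (k : κ) (p : ℝ) :
    Measurable fun q : ((ι → ℝ) × ℝ) × (κ → ℝ) => nearKernel e k p q.1.1 q.1.2 q.2 :=
  Measurable.indicator (by fun_prop) (measurableSet_nearSet e k)

theorem nearKernel_update {e : κ → ι} (he : e.Injective) (k : κ) (p : ℝ) (x : ι → ℝ) (t : ℝ)
    (y : κ → ℝ) :
    nearKernel e k p (Function.update x (e k) t) (x (e k)) y = nearKernel e k p x t y := by
  by_cases h : ((x, t), y) ∈ nearSet e k
  · rw [nearKernel, nearKernel, indicator_of_mem h,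
      indicator_of_mem ((nearSet_update he k x t y).2 h)]
    simp only [Function.update_self, enorm_sub_rev t]
  · rw [nearKernel, nearKernel, indicator_of_notMem h,
      indicator_of_notMem fun h' => h ((nearSet_update he k x t y).1 h')]

/-- On the near set the block distance is at most `card κ` times `|x (e k) - t|`. The singular
kernel is therefore at most a constant times a kernel regularized at the scale `r` of the block
distance, whose integral is of order `r ^ (-p)`. -/
theorem exists_lintegral_nearKernel_le {e : κ → ι} {p : ℝ} (hp : 0 < p) :
    ∃ C : ℝ≥0, ∀ (k : κ) (x : ι → ℝ) (y : κ → ℝ), (fun k => x (e k)) ≠ y →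
      ∫⁻ t, nearKernel e k p x t y
        ≤ C * ‖WithLp.toLp 2 (fun k => x (e k)) - WithLp.toLp 2 y‖ₑ ^ (-p) := by
  set n := Fintype.card κ with hn
  obtain ⟨C, hC⟩ := exists_lintegral_kernel_le hp
  refine ⟨2 ^ (1 + p) * (C * (n : ℝ≥0) ^ p), fun k x y hxy => ?_⟩
  have hn1 : n ≠ 0 := by rw [hn]; have : Nonempty κ := ⟨k⟩; exact Fintype.card_ne_zero
  set q := ‖WithLp.toLp 2 (fun k => x (e k)) - WithLp.toLp 2 y‖ₑ with hq
  have hq0 : q ≠ 0 := by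
    rw [hq, Ne, enorm_eq_zero, sub_eq_zero]
    exact fun h => hxy (WithLp.toLp_injective 2 h)
  set r : ℝ≥0 := ‖WithLp.toLp 2 (fun k => x (e k)) - WithLp.toLp 2 y‖₊ / n with hr
  have hrq : (r : ℝ≥0∞) = q / n := by
    rw [hr, ENNReal.coe_div (by exact_mod_cast hn1), hq]
    simp [enorm]
  have hn1' : (n : ℝ≥0∞) ≠ 0 := by exact_mod_cast hn1
  have hr0 : r ≠ 0 := by
    have : (r : ℝ≥0∞) ≠ 0 := by
      rw [hrq]; exact ENNReal.div_ne_zero.2 ⟨hq0, by simp⟩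
    simpa using this
  have h3 : ∀ t, nearKernel e k p x t y
      ≤ 2 ^ (1 + p) * ((r : ℝ≥0∞) + ‖x (e k) - t‖ₑ) ^ (-(1 + p)) := by
    intro t
    by_cases hy : ((x, t), y) ∈ nearSet e k
    · have hle : (r : ℝ≥0∞) ≤ ‖x (e k) - t‖ₑ := by
        rw [hrq]
        refine ENNReal.div_le_of_le_mul' ?_
        rw [← ofReal_norm (x (e k) - t), Real.norm_eq_abs]
        exact enorm_toLp_sub_le (fun k => x (e k)) y hy.1
      rw [nearKernel, indicator_of_mem hy]
      have h4 : (2 : ℝ≥0∞) ^ (1 + p) = (1 / 2 : ℝ≥0∞) ^ (-(1 + p)) := by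
        rw [ENNReal.rpow_neg, ← ENNReal.inv_rpow]; simp
      have hle2 : (1 / 2 : ℝ≥0∞) * ((r : ℝ≥0∞) + ‖x (e k) - t‖ₑ) ≤ ‖x (e k) - t‖ₑ := by
        calc (1 / 2 : ℝ≥0∞) * ((r : ℝ≥0∞) + ‖x (e k) - t‖ₑ)
            ≤ (1 / 2 : ℝ≥0∞) * (‖x (e k) - t‖ₑ + ‖x (e k) - t‖ₑ) := by gcongr
          _ = ‖x (e k) - t‖ₑ := by
              rw [← two_mul, ← mul_assoc, one_div, ENNReal.inv_mul_cancel (by simp) (by simp),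
                one_mul]
      rw [h4, ← ENNReal.mul_rpow_of_ne_top (by simp) (by simp)]
      rw [ENNReal.rpow_neg, ENNReal.rpow_neg]
      exact ENNReal.inv_le_inv.2 (ENNReal.rpow_le_rpow hle2 (by linarith))
    · rw [nearKernel, indicator_of_notMem hy]; exact zero_le
  calc ∫⁻ t, nearKernel e k p x t y
      ≤ ∫⁻ t, 2 ^ (1 + p) * ((r : ℝ≥0∞) + ‖x (e k) - t‖ₑ) ^ (-(1 + p)) := lintegral_mono h3
    _ = 2 ^ (1 + p) * ∫⁻ t, ((r : ℝ≥0∞) + ‖x (e k) - t‖ₑ) ^ (-(1 + p)) :=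
        lintegral_const_mul _ (by fun_prop)
    _ ≤ 2 ^ (1 + p) * (C * (r : ℝ≥0∞) ^ (-p)) := by gcongr; exact hC _ _ hr0
    _ = _ := by
        rw [hrq, div_eq_mul_inv, ENNReal.mul_rpow_of_ne_top enorm_ne_top (by simp [hn1']),
          ENNReal.inv_rpow, ENNReal.rpow_neg (n : ℝ≥0∞), inv_inv, ENNReal.coe_mul,
          ENNReal.coe_mul, ENNReal.coe_rpow_of_nonneg _ hp.le,
          ENNReal.coe_rpow_of_nonneg _ (by linarith : (0:ℝ) ≤ 1 + p)]
        simp only [ENNReal.coe_natCast, ENNReal.coe_ofNat]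
        ring

/-- With `h = |x (e k) - t|` and `p = card κ + 2σ` one has `h ^ (-(1 + 2σ)) = h ^ (-(1 + p)) * h ^
card κ`. The last factor is at most the measure of the near set, so the left side is at most an
average over intermediate points `y`, each of which splits the difference by the triangle
inequality. -/
theorem enorm_sub_sq_div_le_lintegral_nearKernel {e : κ → ι} (he : e.Injective) (k : κ) (σ : ℝ)
    {v : (ι → ℝ) → ℂ} (hv : Measurable v)
    {x : ι → ℝ} (hx : ∀ i, x i ∈ Icc (0 : ℝ) 1) {t : ℝ} (ht : t ∈ Icc (0 : ℝ) 1)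
    (G : (ι → ℝ) → ℝ → ℝ≥0∞)
    (hG : G = fun x t => ∫⁻ y, nearKernel e k (Fintype.card κ + 2 * σ) x t y *
      ‖v x - v (Function.extend e y x)‖ₑ ^ 2
        ∂(Measure.pi fun _ => volume.restrict (Icc (0 : ℝ) 1))) :
    ‖v x - v (Function.update x (e k) t)‖ₑ ^ 2 / ‖x (e k) - t‖ₑ ^ (1 + 2 * σ)
      ≤ 2 * G x t + 2 * G (Function.update x (e k) t) (x (e k)) := by
  set p := Fintype.card κ + 2 * σ with hp
  set I : Measure ℝ := volume.restrict (Icc 0 1) with hI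
  rcases eq_or_ne t (x (e k)) with rfl | hne
  · simp
  set h := ‖x (e k) - t‖ₑ with hh
  have h0 : h ≠ 0 := by simpa [hh, sub_eq_zero] using hne.symm
  have htop : h ≠ ⊤ := enorm_ne_top
  have hms : MeasurableSet {y | ((x, t), y) ∈ nearSet e k} :=
    measurable_prodMk_left (measurableSet_nearSet e k)
  have hKm : Measurable fun y => nearKernel e k p x t y :=
    (measurable_nearKernel e k p).comp (measurable_prodMk_left (x := (x, t)))
  have hvm : ∀ x, Measurable fun y => ‖v x - v (Function.extend e y x)‖ₑ ^ 2 := fun x =>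
    (((hv.comp (measurable_extend e)).comp (measurable_prodMk_left (x := x))).const_sub
      (v x)).enorm.pow_const 2
  set D := ‖v x - v (Function.update x (e k) t)‖ₑ ^ 2 with hD
  have hG2 : G (Function.update x (e k) t) (x (e k)) = ∫⁻ y, nearKernel e k p x t y *
      ‖v (Function.update x (e k) t) - v (Function.extend e y x)‖ₑ ^ 2 ∂(Measure.pi fun _ => I) := by
    rw [hG]
    simp only [nearKernel_update he, extend_update_of_mem he]
  have hvm2 : Measurable fun y =>
      ‖v (Function.update x (e k) t) - v (Function.extend e y x)‖ₑ ^ 2 := by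
    simpa only [extend_update_of_mem he] using hvm (Function.update x (e k) t)
  calc D / h ^ (1 + 2 * σ) = D * h ^ (-(1 + p)) * h ^ Fintype.card κ := by
        rw [div_eq_mul_inv, ← ENNReal.rpow_neg, mul_assoc, ← ENNReal.rpow_natCast,
          ← ENNReal.rpow_add _ _ h0 htop]
        congr 2; rw [hp]; ring
    _ ≤ D * h ^ (-(1 + p)) * (Measure.pi fun _ : κ => I) {y | ((x, t), y) ∈ nearSet e k} := by
        gcongr
        exact pow_le_measure_nearSet e k hx ht
    _ = ∫⁻ y, D * nearKernel e k p x t y ∂(Measure.pi fun _ => I) := by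
        rw [← setLIntegral_const, ← lintegral_indicator hms]
        refine lintegral_congr fun y => ?_
        by_cases hy : ((x, t), y) ∈ nearSet e k
        · rw [nearKernel, indicator_of_mem hy, indicator_of_mem (by exact hy)]
        · rw [nearKernel, indicator_of_notMem hy, indicator_of_notMem (by exact hy), mul_zero]
    _ ≤ ∫⁻ y, (2 * (nearKernel e k p x t y * ‖v x - v (Function.extend e y x)‖ₑ ^ 2) +
          2 * (nearKernel e k p x t y *
            ‖v (Function.update x (e k) t) - v (Function.extend e y x)‖ₑ ^ 2))
          ∂(Measure.pi fun _ => I) := by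
        refine lintegral_mono fun y => ?_
        have := enorm_sub_sq_le (v x) (v (Function.extend e y x)) (v (Function.update x (e k) t))
        rw [enorm_sub_rev (v (Function.extend e y x))] at this
        calc D * nearKernel e k p x t y ≤ _ * nearKernel e k p x t y := mul_le_mul_left this _
          _ = _ := by ring
    _ = _ := by
        have hm1 : Measurable fun y => nearKernel e k p x t y *
          ‖v x - v (Function.extend e y x)‖ₑ ^ 2 := hKm.mul (hvm x)
        have hm2 : Measurable fun y => nearKernel e k p x t y *
          ‖v (Function.update x (e k) t) - v (Function.extend e y x)‖ₑ ^ 2 := hKm.mul hvm2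
        rw [lintegral_add_left (hm1.const_mul 2), lintegral_const_mul _ hm1,
          lintegral_const_mul _ hm2, hG2, hG]

/-- On the unit cube, a Gagliardo seminorm in a single coordinate is controlled by the Gagliardo
seminorm in any block of coordinates that contains it. -/
theorem exists_dirGag_le_blockGag {e : κ → ι} (he : e.Injective) {σ : ℝ} (hσ : 0 < σ) :
    ∃ C : ℝ≥0, ∀ (k : κ) (v : (ι → ℝ) → ℂ), Measurable v →
      dirGag (volume.restrict (Icc 0 1)) σ (e k) v
        ≤ C * blockGag e (volume.restrict (Icc 0 1)) σ v := by
  set p : ℝ := Fintype.card κ + 2 * σ with hp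
  obtain ⟨C, hC⟩ := exists_lintegral_nearKernel_le (e := e) (p := p) (by positivity)
  refine ⟨4 * C, fun k v hv => ?_⟩
  set I : Measure ℝ := volume.restrict (Icc 0 1) with hI
  have hA : Measurable fun q : (ι → ℝ) × (κ → ℝ) =>
      ‖v q.1 - v (Function.extend e q.2 q.1)‖ₑ ^ 2 :=
    ((hv.comp measurable_fst).sub (hv.comp (measurable_extend e))).enorm.pow_const 2
  have hK := measurable_nearKernel e k p
  set G : (ι → ℝ) → ℝ → ℝ≥0∞ := fun x t => ∫⁻ y, nearKernel e k p x t y *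
      ‖v x - v (Function.extend e y x)‖ₑ ^ 2 ∂(Measure.pi fun _ => I) with hG
  have hGm : Measurable (Function.uncurry G) := by
    have hA' : Measurable fun q : ((ι → ℝ) × ℝ) × (κ → ℝ) =>
        ‖v q.1.1 - v (Function.extend e q.2 q.1.1)‖ₑ ^ 2 :=
      hA.comp (f := fun q : ((ι → ℝ) × ℝ) × (κ → ℝ) => (q.1.1, q.2)) (by fun_prop)
    have h0 := hK.fun_mul hA'
    have h1 := Measurable.lintegral_prod_right' (ν := Measure.pi fun _ : κ => I) h0
    exact h1
  refine (lintegral_le_four_mul_of_exchange (e k) hGm ((ae_pi_mem measurableSet_Icc).mono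
    fun x hx => (ae_restrict_mem measurableSet_Icc).mono fun t ht =>
      enorm_sub_sq_div_le_lintegral_nearKernel he k σ hv hx ht G hG)).trans ?_
  rw [ENNReal.coe_mul, mul_assoc, blockGag]
  have hc : (C : ℝ≥0∞) ≠ ⊤ := ENNReal.coe_ne_top
  simp only [← lintegral_const_mul' _ _ hc]
  refine mul_le_mul_right (lintegral_mono fun x => ?_) _
  have hx : Measurable fun q : ℝ × (κ → ℝ) => nearKernel e k p x q.1 q.2 *
      ‖v x - v (Function.extend e q.2 x)‖ₑ ^ 2 :=
    (hK.comp (f := fun q : ℝ × (κ → ℝ) => ((x, q.1), q.2)) (by fun_prop)).fun_mul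
      (hA.comp (f := fun q : ℝ × (κ → ℝ) => (x, q.2)) (by fun_prop))
  simp only [hG]
  -- Integrating first in `t` turns the near kernel into the kernel of the block seminorm.
  rw [lintegral_lintegral_swap hx.aemeasurable]
  refine lintegral_mono fun y => ?_
  dsimp only
  have hm : Measurable fun t => nearKernel e k p x t y :=
    hK.comp (f := fun t : ℝ => ((x, t), y)) (by fun_prop)
  rw [lintegral_mul_const _ hm]
  -- On the diagonal the kernel bound is not available, but there the difference of the values of
  -- `v` vanishes.
  by_cases hxy : (fun k => x (e k)) = y
  · have : Function.extend e y x = x := by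
      funext j
      by_cases hj : ∃ l, e l = j
      · obtain ⟨l, rfl⟩ := hj
        rw [he.extend_apply, ← hxy]
      · rw [Function.extend_apply' _ _ _ hj]
    simp [this]
  calc _ ≤ (C * ‖WithLp.toLp 2 (fun k => x (e k)) - WithLp.toLp 2 y‖ₑ ^ (-p)) *
        ‖v x - v (Function.extend e y x)‖ₑ ^ 2 := by
        gcongr
        exact (lintegral_mono' Measure.restrict_le_self le_rfl).trans (hC k x y hxy)
    _ = _ := by rw [ENNReal.rpow_neg, div_eq_mul_inv]; ring

end Gagliardo

/-! ### A block is controlled by its single coordinates -/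

section Gagliardo

variable {ι κ : Type} [Fintype ι] [Fintype κ] [DecidableEq ι] [DecidableEq κ]

/-- The coordinates in `s` are integrated out one by one: `F` does not depend on them, and each of
them enters a single factor, together with the coordinate `k ∉ s` that stays fixed. -/
theorem lmarginal_mul_prod {μ : Measure ℝ} [SigmaFinite μ] (k : κ) {g : κ → ℝ → ℝ → ℝ≥0∞}
    (hg : ∀ l, Measurable (Function.uncurry (g l))) (s : Finset κ) (hk : k ∉ s)
    {F : (κ → ℝ) → ℝ≥0∞} (hF : Measurable F) (hFs : ∀ l ∈ s, ∀ y t, F (Function.update y l t) = F y) :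
    (∫⋯∫⁻_s, (fun y => F y * ∏ l ∈ s, g l (y k) (y l)) ∂fun _ => μ)
      = fun y => F y * ∏ l ∈ s, ∫⁻ t, g l (y k) t ∂μ := by
  induction s using Finset.induction_on generalizing F with
  | empty => simp
  | insert l s hl ih =>
    have hkl : k ≠ l := fun h => hk (h ▸ Finset.mem_insert_self _ _)
    have hks : k ∉ s := fun h => hk (Finset.mem_insert_of_mem h)
    have hgm : ∀ l, Measurable fun y : κ → ℝ => g l (y k) (y l) := fun l =>
      (hg l).comp (f := fun y : κ → ℝ => (y k, y l)) (by fun_prop)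
    have hgi : Measurable fun y : κ → ℝ => ∫⁻ t, g l (y k) t ∂μ :=
      (hg l).lintegral_prod_right.comp (measurable_pi_apply k)
    rw [lmarginal_insert' _ (hF.fun_mul (Finset.measurable_fun_prod _ fun l _ => hgm l)) hl]
    have h1 : (fun y : κ → ℝ => ∫⁻ t, F (Function.update y l t) * ∏ l' ∈ insert l s,
        g l' (Function.update y l t k) (Function.update y l t l') ∂μ)
        = fun y => (F y * ∫⁻ t, g l (y k) t ∂μ) * ∏ l' ∈ s, g l' (y k) (y l') := by
      funext y
      have h2 : ∀ t, F (Function.update y l t) * ∏ l' ∈ insert l s,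
          g l' (Function.update y l t k) (Function.update y l t l')
          = (F y * ∏ l' ∈ s, g l' (y k) (y l')) * g l (y k) t := fun t => by
        rw [Finset.prod_insert hl, hFs l (Finset.mem_insert_self _ _), Function.update_self,
          Function.update_of_ne hkl]
        have : ∏ l' ∈ s, g l' (y k) (Function.update y l t l') = ∏ l' ∈ s, g l' (y k) (y l') :=
          Finset.prod_congr rfl fun l' hl' => by
            rw [Function.update_of_ne]; rintro rfl; exact hl hl'
        rw [this]; ring
      simp only [h2]
      rw [lintegral_const_mul _ (hg l).of_uncurry_left]
      ring
    rw [h1, ih hks (hF.fun_mul hgi)]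
    · funext y
      rw [Finset.prod_insert hl, mul_assoc]
    · intro l' hl' y t
      rw [hFs l' (Finset.mem_insert_of_mem hl'), Function.update_of_ne]
      rintro rfl; exact hks hl'

theorem lintegral_pi_mul_prod {μ : Measure ℝ} [SigmaFinite μ] (k : κ) {g : κ → ℝ → ℝ → ℝ≥0∞}
    (hg : ∀ l, Measurable (Function.uncurry (g l))) {F : ℝ → ℝ≥0∞} (hF : Measurable F) :
    ∫⁻ y, F (y k) * ∏ l ∈ Finset.univ.erase k, g l (y k) (y l) ∂(Measure.pi fun _ : κ => μ)
      = ∫⁻ t, F t * ∏ l ∈ Finset.univ.erase k, ∫⁻ s, g l t s ∂μ ∂μ := by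
  have hgm : ∀ l, Measurable fun y : κ → ℝ => g l (y k) (y l) := fun l =>
    (hg l).comp (f := fun y : κ → ℝ => (y k, y l)) (by fun_prop)
  have hm : Measurable fun y : κ → ℝ =>
      F (y k) * ∏ l ∈ Finset.univ.erase k, g l (y k) (y l) :=
    (hF.comp (measurable_pi_apply k)).mul (Finset.measurable_fun_prod _ fun l _ => hgm l)
  rw [lintegral_eq_lmarginal_univ (fun _ => (0 : ℝ)),
    lmarginal_erase _ hm (Finset.mem_univ k), lmarginal_mul_prod (F := fun y => F (y k)) k hg _
      (Finset.notMem_erase _ _) (hF.comp (measurable_pi_apply k))]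
  · simp
  · intro l hl y t
    rw [Function.update_of_ne (Finset.ne_of_mem_erase hl).symm]

/-- Integrating the `|κ|`-dimensional kernel in all coordinates but one. -/
theorem exists_lintegral_block_kernel_le {σ : ℝ} (hσ : 0 < σ) :
    ∃ C : ℝ≥0, ∀ (μ : Measure ℝ) [SigmaFinite μ], μ ≤ volume → ∀ (k : κ) (x : κ → ℝ)
      (F : ℝ → ℝ≥0∞), Measurable F → F (x k) = 0 →
      ∫⁻ y, F (y k) / ‖WithLp.toLp 2 x - WithLp.toLp 2 y‖ₑ ^ ((Fintype.card κ : ℝ) + 2 * σ)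
          ∂(Measure.pi fun _ => μ)
        ≤ C * ∫⁻ t, F t / ‖x k - t‖ₑ ^ (1 + 2 * σ) ∂μ := by
  set n := Fintype.card κ with hn
  rcases isEmpty_or_nonempty κ with hκ | hκ
  · exact ⟨0, fun μ _ _ k => isEmptyElim k⟩
  have hn1 : 1 ≤ n := Fintype.card_pos
  -- The exponent `n + 2σ` is split as `q + (n - 1)(1 + ε)`. Each coordinate other than `k` receives
  -- the integrable exponent `1 + ε` and leaves a factor `|x k - t| ^ (-ε)` after integration; these
  -- recombine with `q` to `1 + 2σ`. With `ε = σ / n` the remainder `q` is nonnegative, so the norm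
  -- may be replaced by `|x k - y k|` in that factor.
  set ε : ℝ := σ / n with hε
  have hn0 : (0 : ℝ) < n := by exact_mod_cast hn1
  have hε0 : 0 < ε := by positivity
  obtain ⟨C, hC⟩ := exists_lintegral_kernel_le hε0
  have hq : 0 ≤ 1 + 2 * σ - (n - 1) * ε := by
    have : (n : ℝ) * ε = σ := by rw [hε]; field_simp
    nlinarith
  refine ⟨(2 ^ (1 + ε) * C) ^ (n - 1), fun μ _ hμ k x F hF hFk => ?_⟩
  set g : κ → ℝ → ℝ → ℝ≥0∞ := fun l t s =>
    2 ^ (1 + ε) * (‖x k - t‖ₑ + ‖x l - s‖ₑ) ^ (-(1 + ε)) with hg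
  have hgm : ∀ l, Measurable (Function.uncurry (g l)) := fun l => by
    simp only [hg, Function.uncurry_def]; fun_prop
  set q := 1 + 2 * σ - (n - 1) * ε with hqd
  have hF1 : Measurable fun t => F t * ‖x k - t‖ₑ ^ (-q) := by fun_prop
  have hcard : (Finset.univ.erase k).card = n - 1 := by
    rw [Finset.card_erase_of_mem (Finset.mem_univ k), Finset.card_univ]
  have hcardR : ((n - 1 : ℕ) : ℝ) = n - 1 := by push_cast [hn1]; ring
  -- pointwise product bound for the kernel
  have h1 : ∀ y : κ → ℝ,
      F (y k) / ‖WithLp.toLp 2 x - WithLp.toLp 2 y‖ₑ ^ ((n : ℝ) + 2 * σ)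
        ≤ (F (y k) * ‖x k - y k‖ₑ ^ (-q)) * ∏ l ∈ Finset.univ.erase k, g l (y k) (y l) := by
    intro y
    rcases eq_or_ne (y k) (x k) with hyk | hyk
    · rw [hyk, hFk]; simp
    set N := ‖WithLp.toLp 2 x - WithLp.toLp 2 y‖ₑ with hN
    have hk : ‖x k - y k‖ₑ ≤ N := abs_sub_le_norm_toLp_sub x y k
    have hk0 : ‖x k - y k‖ₑ ≠ 0 := by simpa [sub_eq_zero] using hyk.symm
    have hN0 : N ≠ 0 := fun h => hk0 (by simpa [h] using hk)
    have hNt : N ≠ ⊤ := enorm_ne_top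
    have h2 : N ^ (-((n : ℝ) + 2 * σ)) = N ^ (-q) * ∏ _l ∈ Finset.univ.erase k, N ^ (-(1 + ε)) := by
      rw [Finset.prod_const, hcard, ← ENNReal.rpow_natCast, ← ENNReal.rpow_mul,
        ← ENNReal.rpow_add _ _ hN0 hNt, hcardR]
      congr 1; rw [hqd]; ring
    rw [div_eq_mul_inv, ← ENNReal.rpow_neg, h2, mul_assoc]
    refine mul_le_mul_right (mul_le_mul' ?_ (Finset.prod_le_prod' fun l _ => ?_)) _
    · rw [ENNReal.rpow_neg, ENNReal.rpow_neg]
      exact ENNReal.inv_le_inv.2 (ENNReal.rpow_le_rpow hk hq)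
    · simp only [hg]
      have h4 : (2 : ℝ≥0∞) ^ (1 + ε) = (1 / 2 : ℝ≥0∞) ^ (-(1 + ε)) := by
        rw [ENNReal.rpow_neg, ← ENNReal.inv_rpow]; simp
      have hle2 : (1 / 2 : ℝ≥0∞) * (‖x k - y k‖ₑ + ‖x l - y l‖ₑ) ≤ N := by
        calc (1 / 2 : ℝ≥0∞) * (‖x k - y k‖ₑ + ‖x l - y l‖ₑ) ≤ (1 / 2 : ℝ≥0∞) * (N + N) := by
              gcongr; exact abs_sub_le_norm_toLp_sub x y l
          _ = N := by
              rw [← two_mul, ← mul_assoc, one_div, ENNReal.inv_mul_cancel (by simp) (by simp),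
                one_mul]
      rw [h4, ← ENNReal.mul_rpow_of_ne_top (by simp) (by simp), ENNReal.rpow_neg, ENNReal.rpow_neg]
      exact ENNReal.inv_le_inv.2 (ENNReal.rpow_le_rpow hle2 (by linarith))
  refine (lintegral_mono h1).trans ?_
  have hc : (((2 ^ (1 + ε) * C) ^ (n - 1) : ℝ≥0) : ℝ≥0∞) ≠ ⊤ := ENNReal.coe_ne_top
  rw [lintegral_pi_mul_prod k hgm hF1, ← lintegral_const_mul' _ _ hc]
  refine lintegral_mono fun t => ?_
  dsimp only
  rcases eq_or_ne t (x k) with rfl | ht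
  · rw [hFk]; simp
  have hk0 : ‖x k - t‖ₑ ≠ 0 := by simpa [sub_eq_zero] using ht.symm
  have h3 : ∀ l ∈ Finset.univ.erase k, ∫⁻ s, g l t s ∂μ
      ≤ 2 ^ (1 + ε) * (C * ‖x k - t‖ₑ ^ (-ε)) := fun l _ => by
    calc ∫⁻ s, g l t s ∂μ ≤ ∫⁻ s, g l t s := lintegral_mono' hμ le_rfl
      _ = 2 ^ (1 + ε) * ∫⁻ s, (‖x k - t‖ₑ + ‖x l - s‖ₑ) ^ (-(1 + ε)) :=
          lintegral_const_mul _ (by fun_prop)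
      _ ≤ _ := by
          gcongr
          exact hC (x l) ‖x k - t‖₊ (by simpa using hk0)
  calc F t * ‖x k - t‖ₑ ^ (-q) * ∏ l ∈ Finset.univ.erase k, ∫⁻ s, g l t s ∂μ
      ≤ F t * ‖x k - t‖ₑ ^ (-q) *
          ∏ _l ∈ Finset.univ.erase k, 2 ^ (1 + ε) * (C * ‖x k - t‖ₑ ^ (-ε)) := by
        gcongr with l hl
        exact h3 l hl
    _ = _ := by
        have h5 : ‖x k - t‖ₑ ^ (-(1 + 2 * σ))
            = ‖x k - t‖ₑ ^ (-q) * (‖x k - t‖ₑ ^ (-ε)) ^ (n - 1) := by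
          rw [← ENNReal.rpow_natCast, ← ENNReal.rpow_mul, ← ENNReal.rpow_add _ _ hk0 enorm_ne_top,
            hcardR]
          congr 1; rw [hqd]; ring
        rw [Finset.prod_const, hcard, div_eq_mul_inv, ← ENNReal.rpow_neg, h5, ENNReal.coe_pow,
          ENNReal.coe_mul, ENNReal.coe_rpow_of_nonneg _ (by linarith : (0:ℝ) ≤ 1 + ε)]
        simp only [ENNReal.coe_ofNat]
        rw [← mul_assoc, mul_pow, mul_pow]
        ring

/-- The point `x` with the coordinates `e k`, `k ∈ s`, replaced by those of `y`. -/
noncomputable def mix (e : κ → ι) (s : Finset κ) (x : ι → ℝ) (y : κ → ℝ) : ι → ℝ :=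
  Function.extend e (s.piecewise y fun k => x (e k)) x

theorem mix_empty {e : κ → ι} (he : e.Injective) (x : ι → ℝ) (y : κ → ℝ) : mix e ∅ x y = x := by
  funext j
  by_cases h : ∃ l, e l = j
  · obtain ⟨l, rfl⟩ := h
    simp [mix, he.extend_apply]
  · simp [mix, Function.extend_apply' _ _ _ h]

theorem mix_univ (e : κ → ι) (x : ι → ℝ) (y : κ → ℝ) :
    mix e Finset.univ x y = Function.extend e y x := by
  simp [mix]

/-- Once the coordinate `k` of `x` has been changed to that of `y`, changing the coordinates in `s`
as well is the same as changing those in `insert k s`. Up to a measure-preserving exchange, adding a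
coordinate thus reproduces the previous expression. -/
theorem mix_exchange {e : κ → ι} (he : e.Injective) {s : Finset κ} {k : κ} (hk : k ∉ s)
    (x : ι → ℝ) (y : κ → ℝ) :
    mix e s (Function.update x (e k) (y k)) (Function.update y k (x (e k)))
      = mix e (insert k s) x y := by
  funext j
  by_cases h : ∃ l, e l = j
  · obtain ⟨l, rfl⟩ := h
    simp only [mix, he.extend_apply]
    by_cases hl : l ∈ s
    · have : l ≠ k := fun h => hk (h ▸ hl)
      simp [Finset.piecewise, hl, this]
    · by_cases hlk : l = k
      · subst hlk; simp [Finset.piecewise, hl]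
      · simp [Finset.piecewise, hl, hlk, he.ne hlk]
  · rw [mix, mix, Function.extend_apply' _ _ _ h, Function.extend_apply' _ _ _ h,
      Function.update_of_ne fun hj => h ⟨k, hj.symm⟩]

theorem measurable_mix (e : κ → ι) (s : Finset κ) :
    Measurable fun p : (ι → ℝ) × (κ → ℝ) => mix e s p.1 p.2 := by
  refine (measurable_extend e).comp (f := fun p : (ι → ℝ) × (κ → ℝ) =>
    (p.1, s.piecewise p.2 fun k => p.1 (e k))) (measurable_fst.prodMk ?_)
  refine measurable_pi_lambda _ fun k => ?_
  by_cases hk : k ∈ s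
  · simp only [Finset.piecewise, hk, if_true]; fun_prop
  · simp only [Finset.piecewise, hk, if_false]; fun_prop

theorem norm_toLp_exchange {e : κ → ι} (he : e.Injective) (k : κ) (x : ι → ℝ) (y : κ → ℝ) :
    ‖WithLp.toLp 2 (fun l => Function.update x (e k) (y k) (e l)) -
        WithLp.toLp 2 (Function.update y k (x (e k)))‖ₑ
      = ‖WithLp.toLp 2 (fun l => x (e l)) - WithLp.toLp 2 y‖ₑ := by
  rw [← ofReal_norm, ← ofReal_norm, EuclideanSpace.norm_eq, EuclideanSpace.norm_eq]
  congr 2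
  refine Finset.sum_congr rfl fun l _ => ?_
  by_cases hl : l = k
  · subst hl
    simp [abs_sub_comm]
  · simp [hl, he.ne hl]

theorem lintegral_lintegral_two_mul_add_two_mul {α β : Type*} [MeasurableSpace α]
    [MeasurableSpace β] {μ : Measure α} {ν : Measure β} [SFinite ν] {f g : α → β → ℝ≥0∞}
    (hf : Measurable (Function.uncurry f)) (hg : Measurable (Function.uncurry g)) :
    ∫⁻ x, ∫⁻ y, (2 * f x y + 2 * g x y) ∂ν ∂μ
      = 2 * ∫⁻ x, ∫⁻ y, f x y ∂ν ∂μ + 2 * ∫⁻ x, ∫⁻ y, g x y ∂ν ∂μ := by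
  rw [← lintegral_const_mul _ hf.lintegral_prod_right,
    ← lintegral_const_mul _ hg.lintegral_prod_right,
    ← lintegral_add_left (hf.lintegral_prod_right.const_mul 2)]
  refine lintegral_congr fun x => ?_
  rw [lintegral_add_left (hf.of_uncurry_left.const_mul 2), lintegral_const_mul _ hf.of_uncurry_left,
    lintegral_const_mul _ hg.of_uncurry_left]

/-- A Gagliardo seminorm in a block of coordinates is controlled by those in the single
coordinates. -/
theorem exists_blockGag_le_sum_dirGag {e : κ → ι} (he : e.Injective) {σ : ℝ} (hσ : 0 < σ) :
    ∃ C : ℝ≥0, ∀ (μ : Measure ℝ) [SigmaFinite μ], μ ≤ volume → ∀ v : (ι → ℝ) → ℂ, Measurable v →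
      blockGag e μ σ v ≤ C * ∑ k, dirGag μ σ (e k) v := by
  obtain ⟨C, hC⟩ := exists_lintegral_block_kernel_le (κ := κ) hσ
  refine ⟨2 ^ Fintype.card κ * C, fun μ _ hμ v hv => ?_⟩
  set p : ℝ := Fintype.card κ + 2 * σ with hp
  set N : (ι → ℝ) → (κ → ℝ) → ℝ≥0∞ := fun x y =>
    ‖WithLp.toLp 2 (fun l => x (e l)) - WithLp.toLp 2 y‖ₑ ^ p with hN
  have hNm : Measurable (Function.uncurry N) := by
    simp only [hN, Function.uncurry_def]
    have h1 : Measurable fun q : (ι → ℝ) × (κ → ℝ) =>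
        (WithLp.toLp 2 (fun l => q.1 (e l)) : EuclideanSpace ℝ κ) - WithLp.toLp 2 q.2 := by
      fun_prop
    exact h1.enorm.pow_const p
  set J : κ → ℝ≥0∞ := fun k => ∫⁻ x, ∫⁻ y, ‖v x - v (Function.update x (e k) (y k))‖ₑ ^ 2 / N x y
    ∂(Measure.pi fun _ => μ) ∂(Measure.pi fun _ => μ) with hJ
  have hIm : ∀ s : Finset κ, Measurable (Function.uncurry fun x y =>
      ‖v x - v (mix e s x y)‖ₑ ^ 2 / N x y) := fun s =>
    (((hv.comp measurable_fst).sub (hv.comp (measurable_mix e s))).enorm.pow_const 2).div hNm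
  -- The intermediate point is `x` with only the coordinate `k` changed. The first difference gives
  -- `J k`. The second is the expression for `s` after exchanging the coordinate `k` between `x` and
  -- `y`, which changes neither the distance `N` nor the measure. No geometry of the domain enters,
  -- so this also works on the whole space.
  have step : ∀ s : Finset κ, ∫⁻ x, ∫⁻ y, ‖v x - v (mix e s x y)‖ₑ ^ 2 / N x y
      ∂(Measure.pi fun _ => μ) ∂(Measure.pi fun _ => μ) ≤ 2 ^ s.card * ∑ k ∈ s, J k := by
    intro s
    induction s using Finset.induction_on with
    | empty => simp [mix_empty he]
    | insert k s hk ih =>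
      have hJm : Measurable (Function.uncurry fun x y =>
          ‖v x - v (Function.update x (e k) (y k))‖ₑ ^ 2 / N x y) := by
        have : Measurable fun q : (ι → ℝ) × (κ → ℝ) => v (Function.update q.1 (e k) (q.2 k)) :=
          hv.comp (f := fun q : (ι → ℝ) × (κ → ℝ) => Function.update q.1 (e k) (q.2 k))
            (by fun_prop)
        exact (((hv.comp measurable_fst).sub this).enorm.pow_const 2).div hNm
      set I' : (ι → ℝ) → (κ → ℝ) → ℝ≥0∞ := fun x y => ‖v x - v (mix e s x y)‖ₑ ^ 2 / N x y with hI'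
      have hIe := lintegral_exchange μ (e k) k (F := I') (hIm s)
      have hIm' : Measurable (Function.uncurry fun x y =>
          I' (Function.update x (e k) (y k)) (Function.update y k (x (e k)))) :=
        (hIm s).comp (f := fun q : (ι → ℝ) × (κ → ℝ) =>
          (Function.update q.1 (e k) (q.2 k), Function.update q.2 k (q.1 (e k)))) (by fun_prop)
      calc _ ≤ ∫⁻ x, ∫⁻ y, (2 * (‖v x - v (Function.update x (e k) (y k))‖ₑ ^ 2 / N x y) +
            2 * I' (Function.update x (e k) (y k)) (Function.update y k (x (e k))))
            ∂(Measure.pi fun _ => μ) ∂(Measure.pi fun _ => μ) := by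
            refine lintegral_mono fun x => lintegral_mono fun y => ?_
            have h1 : N (Function.update x (e k) (y k)) (Function.update y k (x (e k))) = N x y := by
              simp only [hN, norm_toLp_exchange he]
            simp only [hI', h1, mix_exchange he hk]
            rw [← mul_add, ← ENNReal.add_div, ← mul_div_assoc]
            exact ENNReal.div_le_div_right (enorm_sub_sq_le _ _ _) _
        _ = 2 * J k + 2 * ∫⁻ x, ∫⁻ y, I' x y ∂(Measure.pi fun _ => μ)
              ∂(Measure.pi fun _ => μ) := by
            rw [← hIe]
            exact lintegral_lintegral_two_mul_add_two_mul hJm hIm'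
        _ ≤ 2 * J k + 2 * (2 ^ s.card * ∑ k ∈ s, J k) := by gcongr
        _ ≤ 2 ^ (s.card + 1) * J k + 2 ^ (s.card + 1) * ∑ k ∈ s, J k := by
            rw [← mul_assoc, ← pow_succ']
            gcongr
            exact le_self_pow (by norm_num) (by simp)
        _ = _ := by rw [← mul_add, Finset.card_insert_of_notMem hk, Finset.sum_insert hk]
  -- In `J k` the numerator involves only one coordinate of `y`, so the kernel can be integrated in
  -- the others.
  have hJle : ∀ k, J k ≤ C * dirGag μ σ (e k) v := by
    intro k
    have hc : (C : ℝ≥0∞) ≠ ⊤ := ENNReal.coe_ne_top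
    rw [dirGag, ← lintegral_const_mul' _ _ hc]
    refine lintegral_mono fun x => ?_
    have := hC μ hμ k (fun l => x (e l)) (fun t => ‖v x - v (Function.update x (e k) t)‖ₑ ^ 2)
      (((hv.comp (measurable_update x)).const_sub (v x)).enorm.pow_const 2) (by simp)
    exact this
  calc blockGag e μ σ v = ∫⁻ x, ∫⁻ y, ‖v x - v (mix e Finset.univ x y)‖ₑ ^ 2 / N x y
      ∂(Measure.pi fun _ => μ) ∂(Measure.pi fun _ => μ) := by
        simp only [mix_univ, hN, blockGag, hp]
    _ ≤ 2 ^ Fintype.card κ * ∑ k, J k := step _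
    _ ≤ 2 ^ Fintype.card κ * ∑ k, C * dirGag μ σ (e k) v := by
        gcongr with k; exact hJle k
    _ = _ := by rw [← Finset.mul_sum, ENNReal.coe_mul]; push_cast; ring

end Gagliardo

/-! ### The Fourier transform on `L²`, weak derivatives and translations -/

section FourierLTwo

open FourierTransform SchwartzMap LineDeriv
open scoped ComplexConjugate

variable {ι : Type} [Fintype ι] [DecidableEq ι]

/-- A function representing the Fourier transform of a square-integrable function. -/
noncomputable def fourierL2 {w : EuclideanSpace ℝ ι → ℂ} (hw : MemLp w 2 volume) :
    EuclideanSpace ℝ ι → ℂ :=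
  (𝓕 (hw.toLp w) : Lp ℂ 2 (volume : Measure (EuclideanSpace ℝ ι)))

theorem memLp_fourierL2 {w : EuclideanSpace ℝ ι → ℂ} (hw : MemLp w 2 volume) :
    MemLp (fourierL2 hw) 2 volume := Lp.memLp _

theorem lintegral_fourierL2_sq {w : EuclideanSpace ℝ ι → ℂ} (hw : MemLp w 2 volume) :
    ∫⁻ ξ, ‖fourierL2 hw ξ‖ₑ ^ 2 = ∫⁻ x, ‖w x‖ₑ ^ 2 := by
  have h1 : eLpNorm (fourierL2 hw) 2 volume = eLpNorm w 2 volume := by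
    rw [fourierL2, ← Lp.enorm_def, ← Lp.enorm_toLp hw, ← ofReal_norm, ← ofReal_norm,
      Lp.norm_fourier_eq]
  have h2 := congrArg (· ^ (2 : ℝ)) h1
  simp only [eLpNorm_eq_lintegral_rpow_enorm_toReal two_ne_zero ENNReal.ofNat_ne_top,
    ENNReal.toReal_ofNat, ← ENNReal.rpow_mul] at h2
  norm_num at h2
  exact h2

/-- Parseval's identity against Schwartz functions. The rules for derivatives and translations
follow from it by moving the operation onto `Ψ`. -/
theorem integral_conj_mul_eq_fourierL2 {w : EuclideanSpace ℝ ι → ℂ} (hw : MemLp w 2 volume)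
    (Ψ : 𝓢(EuclideanSpace ℝ ι, ℂ)) :
    ∫ x, conj (Ψ x) * w x = ∫ ξ, conj (𝓕 Ψ ξ) * fourierL2 hw ξ := by
  have h := Lp.inner_fourier_eq (Ψ.toLp 2) (hw.toLp w)
  rw [SchwartzMap.toLp_fourier_eq, L2.inner_def, L2.inner_def] at h
  rw [← integral_congr_ae (f := fun a => inner ℂ ((Ψ.toLp 2 : Lp ℂ 2 volume) a) ((hw.toLp w) a)),
    ← h]
  · refine integral_congr_ae ?_
    filter_upwards [(𝓕 Ψ).coeFn_toLp 2 volume] with ξ hξ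
    rw [hξ, RCLike.inner_apply, mul_comm]; rfl
  · filter_upwards [Ψ.coeFn_toLp 2 volume, hw.coeFn_toLp] with x hx hx'
    rw [hx, hx', RCLike.inner_apply, mul_comm]

/-- The Schwartz function given by a real test function. -/
noncomputable def testSchwartz (φ : EuclideanSpace ℝ ι → ℝ) (h1 : HasCompactSupport φ)
    (h2 : ContDiff ℝ ∞ φ) : 𝓢(EuclideanSpace ℝ ι, ℂ) :=
  HasCompactSupport.toSchwartzMap (f := fun x => (φ x : ℂ))
    (h1.comp_left (g := fun r : ℝ => (r : ℂ)) (by simp)) (Complex.ofRealCLM.contDiff.comp h2)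

theorem testSchwartz_apply (φ : EuclideanSpace ℝ ι → ℝ) (h1 : HasCompactSupport φ)
    (h2 : ContDiff ℝ ∞ φ) (x : EuclideanSpace ℝ ι) : testSchwartz φ h1 h2 x = (φ x : ℂ) := rfl

/-- The Fourier transform maps onto the Schwartz functions, so all smooth compactly supported
functions occur among the `𝓕 Ψ`. -/
theorem ae_eq_of_forall_integral_conj_fourier {g h : EuclideanSpace ℝ ι → ℂ}
    (hg : LocallyIntegrable g volume) (hh : LocallyIntegrable h volume)
    (H : ∀ Ψ : 𝓢(EuclideanSpace ℝ ι, ℂ),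
      ∫ ξ, conj (𝓕 Ψ ξ) * g ξ = ∫ ξ, conj (𝓕 Ψ ξ) * h ξ) : g =ᵐ[volume] h := by
  refine ae_eq_of_integral_contDiff_smul_eq hg hh fun φ h2 h1 => ?_
  have := H (𝓕⁻ (testSchwartz φ h1 h2))
  rw [FourierInvPair.fourier_fourierInv_eq] at this
  simpa [testSchwartz_apply] using this

theorem fourier_lineDeriv_apply (Ψ : 𝓢(EuclideanSpace ℝ ι, ℂ)) (i : ι) (ξ : EuclideanSpace ℝ ι) :
    𝓕 (∂_{EuclideanSpace.single i (1 : ℝ)} Ψ : 𝓢(EuclideanSpace ℝ ι, ℂ)) ξ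
      = (2 * Real.pi * Complex.I * ξ i) * 𝓕 Ψ ξ := by
  rw [fourier_lineDerivOp_eq]
  have : (inner ℝ · (EuclideanSpace.single i (1 : ℝ)) :
      EuclideanSpace ℝ ι → ℝ).HasTemperateGrowth :=
    ((innerSL ℝ).flip (EuclideanSpace.single i (1 : ℝ))).hasTemperateGrowth
  rw [smul_apply, smulLeftCLM_apply_apply this]
  simp [EuclideanSpace.inner_single_right, mul_assoc]

theorem continuous_mul_locallyIntegrable {m g : EuclideanSpace ℝ ι → ℂ} (hm : Continuous m)
    (hg : LocallyIntegrable g volume) : LocallyIntegrable (fun x => m x * g x) volume := by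
  rw [← locallyIntegrableOn_univ] at hg ⊢
  exact hg.continuousOn_mul hm.continuousOn isOpen_univ.isLocallyClosed

/-- The weak identity extends from compactly supported real test functions to Schwartz functions; on
these the Fourier transform turns the derivative into the multiplier `2πiξ_i`. -/
theorem fourierL2_of_weak_partial {k k' : EuclideanSpace ℝ ι → ℂ} (hk : MemLp k 2 volume)
    (hk' : MemLp k' 2 volume) (hc : HasCompactSupport k) (hc' : HasCompactSupport k') (i : ι)
    (H : ∀ φ : EuclideanSpace ℝ ι → ℝ, ContDiff ℝ ∞ φ → HasCompactSupport φ →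
      ∫ x, partialD i φ x • k x = - ∫ x, φ x • k' x) :
    ∀ᵐ ξ, fourierL2 hk' ξ = (2 * Real.pi * Complex.I * ξ i) * fourierL2 hk ξ := by
  have hgl : LocallyIntegrable (fourierL2 hk) volume :=
    (memLp_fourierL2 hk).locallyIntegrable one_le_two
  refine ae_eq_of_forall_integral_conj_fourier ((memLp_fourierL2 hk').locallyIntegrable one_le_two)
    (continuous_mul_locallyIntegrable (by fun_prop) hgl) fun Ψ => ?_
  set e : EuclideanSpace ℝ ι := EuclideanSpace.single i (1 : ℝ) with he
  have key : ∫ x, conj (Ψ x) * k' x = - ∫ x, conj ((∂_{e} Ψ : 𝓢(EuclideanSpace ℝ ι, ℂ)) x) * k x := by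
    obtain ⟨R, hR⟩ := (hc.isCompact.union hc'.isCompact).isBounded.subset_closedBall 0
    have hR0 : ∀ {g : EuclideanSpace ℝ ι → ℂ}, tsupport g ⊆ tsupport k ∪ tsupport k' →
        ∀ x, g x ≠ 0 → x ∈ Metric.ball (0 : EuclideanSpace ℝ ι) (|R| + 1) := fun hg x hx => by
      have := hR (hg (subset_tsupport _ hx))
      rw [mem_closedBall_zero_iff] at this
      rw [mem_ball_zero_iff]
      linarith [le_abs_self R]
    -- Since `k` and `k'` have compact support, `Ψ` may be multiplied by a bump that is `1` near
    -- both supports without changing either integral.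
    let χ : ContDiffBump (0 : EuclideanSpace ℝ ι) :=
      ⟨|R| + 1, |R| + 2, by positivity, by linarith⟩
    have hχ1 : ∀ x ∈ Metric.ball (0 : EuclideanSpace ℝ ι) (|R| + 1), χ x = 1 := fun x hx =>
      χ.one_of_mem_closedBall (Metric.ball_subset_closedBall hx)
    -- Test functions are real, so the real and the imaginary part of `Ψ` are treated separately;
    -- `L` is either projection.
    have main : ∀ L : ℂ →L[ℝ] ℝ,
        ∫ x, (L (Ψ x)) • k' x
          = - ∫ x, (L ((∂_{e} Ψ : 𝓢(EuclideanSpace ℝ ι, ℂ)) x)) • k x := by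
      intro L
      have hφ1 : ContDiff ℝ ∞ fun x => χ x * L (Ψ x) :=
        χ.contDiff.mul (L.contDiff.comp (Ψ.smooth _))
      have hφ2 : HasCompactSupport fun x => χ x * L (Ψ x) := χ.hasCompactSupport.mul_right
      have h := H _ hφ1 hφ2
      have h1 : ∀ x, (χ x * L (Ψ x)) • k' x = (L (Ψ x)) • k' x := fun x => by
        by_cases hx : k' x = 0
        · simp [hx]
        · rw [hχ1 x (hR0 subset_union_right x hx), one_mul]
      have h2 : ∀ x, partialD i (fun x => χ x * L (Ψ x)) x • k x
          = (L ((∂_{e} Ψ : 𝓢(EuclideanSpace ℝ ι, ℂ)) x)) • k x := fun x => by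
        by_cases hx : k x = 0
        · simp [hx]
        · have hxb := hR0 subset_union_left x hx
          have hev : (fun x => χ x * L (Ψ x)) =ᶠ[nhds x] fun x => L (Ψ x) := by
            filter_upwards [Metric.isOpen_ball.mem_nhds hxb] with y hy
            rw [hχ1 y hy, one_mul]
          rw [partialD, hev.fderiv_eq, lineDerivOp_apply_eq_fderiv]
          have : fderiv ℝ (fun x => L (Ψ x)) x = L ∘L fderiv ℝ Ψ x :=
            (L.hasFDerivAt.comp x (Ψ.hasFDerivAt x)).fderiv
          rw [this]; rfl
      simp only [h1, h2] at h
      rw [h, neg_neg]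
    have hint : ∀ {g : EuclideanSpace ℝ ι → ℂ}, MemLp g 2 volume → ∀ (L : ℂ →L[ℝ] ℝ)
        (Φ : 𝓢(EuclideanSpace ℝ ι, ℂ)), Integrable (fun x => (L (Φ x)) • g x) volume :=
      fun hg L Φ => by
        have h1 : MemLp (fun x => L (Φ x)) 2 volume := L.comp_memLp' (Φ.memLp 2)
        have h2 : Integrable (fun x => ((L (Φ x) : ℝ) : ℂ) * _) volume :=
          (h1.ofReal (K := ℂ)).integrable_mul hg
        simpa only [Complex.real_smul] using h2
    have hsplit : ∀ {g : EuclideanSpace ℝ ι → ℂ}, MemLp g 2 volume →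
        ∀ (Φ : 𝓢(EuclideanSpace ℝ ι, ℂ)), ∫ x, conj (Φ x) * g x
          = (∫ x, (Complex.reCLM (Φ x)) • g x) - Complex.I * ∫ x, (Complex.imCLM (Φ x)) • g x :=
      fun {g} hg Φ => by
        rw [← integral_const_mul, ← integral_sub (hint hg _ _) ((hint hg _ _).const_mul _)]
        refine integral_congr_ae (Filter.Eventually.of_forall fun x => ?_)
        simp only [Complex.reCLM_apply, Complex.imCLM_apply, Complex.real_smul]
        have : conj (Φ x) = (Φ x).re - (Φ x).im * Complex.I := by
          apply Complex.ext <;> simp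
        rw [this]; ring
    rw [hsplit hk', hsplit hk, main, main]
    ring
  rw [← integral_conj_mul_eq_fourierL2, key, integral_conj_mul_eq_fourierL2 hk, ← integral_neg]
  refine integral_congr_ae (Filter.Eventually.of_forall fun ξ => ?_)
  simp only [he, fourier_lineDeriv_apply]
  simp only [map_mul, Complex.conj_ofReal, Complex.conj_I, Complex.conj_ofNat]
  ring

theorem fourierL2_translate {v : EuclideanSpace ℝ ι → ℂ} (hv : MemLp v 2 volume)
    (a : EuclideanSpace ℝ ι) (hva : MemLp (fun x => v (x + a)) 2 volume) :
    ∀ᵐ ξ, fourierL2 hva ξ = (Real.fourierChar (inner ℝ a ξ) : ℂ) * fourierL2 hv ξ := by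
  refine ae_eq_of_forall_integral_conj_fourier ((memLp_fourierL2 hva).locallyIntegrable one_le_two)
    (continuous_mul_locallyIntegrable (by fun_prop)
      ((memLp_fourierL2 hv).locallyIntegrable one_le_two)) fun Ψ => ?_
  rw [← integral_conj_mul_eq_fourierL2]
  have h1 : ∫ x, conj (Ψ x) * v (x + a) = ∫ x, conj ((Ψ.compSubConstCLM ℂ a) x) * v x := by
    rw [← integral_add_right_eq_self (fun x => conj ((Ψ.compSubConstCLM ℂ a) x) * v x) a]
    simp
  rw [h1, integral_conj_mul_eq_fourierL2 hv]
  refine integral_congr_ae (Filter.Eventually.of_forall fun ξ => ?_)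
  have h2 : 𝓕 (Ψ.compSubConstCLM ℂ a) ξ = (Real.fourierChar (-inner ℝ a ξ) : ℂ) * 𝓕 Ψ ξ := by
    have h3 := congrFun (VectorFourier.fourierIntegral_comp_add_right Real.fourierChar volume
      (innerₗ (EuclideanSpace ℝ ι)) (Ψ : EuclideanSpace ℝ ι → ℂ) (-a)) ξ
    simp only [map_neg, LinearMap.neg_apply, innerₗ_apply_apply, Circle.smul_def, smul_eq_mul] at h3
    rw [SchwartzMap.fourier_coe, SchwartzMap.fourier_coe]
    refine Eq.trans ?_ h3
    rw [Real.fourier_eq]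
    simp only [VectorFourier.fourierIntegral, Function.comp_def, compSubConstCLM_apply,
      sub_eq_add_neg, innerₗ_apply_apply]
  simp only [h2, map_mul]
  have h4 : conj (Real.fourierChar (-inner ℝ a ξ) : ℂ) = (Real.fourierChar (inner ℝ a ξ) : ℂ) := by
    rw [AddChar.map_neg_eq_inv, Circle.coe_inv_eq_conj, Complex.conj_conj]
  rw [h4]; ring

/-- The derivative `D^β` on Schwartz functions. -/
noncomputable def schwartzMultiD (β : ι → ℕ) (Ψ : 𝓢(EuclideanSpace ℝ ι, ℂ)) :
    𝓢(EuclideanSpace ℝ ι, ℂ) :=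
  (Finset.univ : Finset ι).toList.foldr
    (fun i f => (fun g : 𝓢(EuclideanSpace ℝ ι, ℂ) => ∂_{EuclideanSpace.single i (1 : ℝ)} g)^[β i] f)
    Ψ

theorem contDiff_partialD {φ : EuclideanSpace ℝ ι → ℝ} (hφ : ContDiff ℝ ∞ φ) (i : ι) :
    ContDiff ℝ ∞ (partialD i φ) :=
  (hφ.fderiv_right (m := ∞) (by simp)).clm_apply contDiff_const

theorem schwartzMultiD_apply (β : ι → ℕ) {φ : EuclideanSpace ℝ ι → ℝ}
    {Ψ : 𝓢(EuclideanSpace ℝ ι, ℂ)} (hφ : ContDiff ℝ ∞ φ) (h : ∀ x, Ψ x = (φ x : ℂ)) :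
    ∀ x, schwartzMultiD β Ψ x = (multiD β φ x : ℂ) := by
  have h1 : ∀ (i : ι) (φ : EuclideanSpace ℝ ι → ℝ) (Ψ : 𝓢(EuclideanSpace ℝ ι, ℂ)),
      ContDiff ℝ ∞ φ ∧ (∀ x, Ψ x = (φ x : ℂ)) → ContDiff ℝ ∞ (partialD i φ) ∧
        ∀ x, (∂_{EuclideanSpace.single i (1 : ℝ)} Ψ : 𝓢(EuclideanSpace ℝ ι, ℂ)) x
          = (partialD i φ x : ℂ) := by
    rintro i φ Ψ ⟨hφ, h⟩
    refine ⟨contDiff_partialD hφ i, fun x => ?_⟩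
    rw [lineDerivOp_apply_eq_fderiv]
    have h2 : (Ψ : EuclideanSpace ℝ ι → ℂ) = fun x => (φ x : ℂ) := funext h
    have h3 : HasFDerivAt (fun x => (φ x : ℂ)) (Complex.ofRealCLM ∘L fderiv ℝ φ x) x :=
      Complex.ofRealCLM.hasFDerivAt.comp x (hφ.differentiable (by simp) x).hasFDerivAt
    rw [h2, h3.fderiv]; rfl
  have h2 : ∀ (n : ℕ) (i : ι) (φ : EuclideanSpace ℝ ι → ℝ) (Ψ : 𝓢(EuclideanSpace ℝ ι, ℂ)),
      ContDiff ℝ ∞ φ ∧ (∀ x, Ψ x = (φ x : ℂ)) → ContDiff ℝ ∞ ((partialD i)^[n] φ) ∧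
        ∀ x, ((fun g : 𝓢(EuclideanSpace ℝ ι, ℂ) =>
          ∂_{EuclideanSpace.single i (1 : ℝ)} g)^[n] Ψ) x = ((partialD i)^[n] φ x : ℂ) := by
    intro n
    induction n with
    | zero => intro i φ Ψ h; simpa using h
    | succ n ih =>
      intro i φ Ψ h
      simpa only [Function.iterate_succ, Function.comp] using ih i _ _ (h1 i φ Ψ h)
  have h3 : ∀ l : List ι, ContDiff ℝ ∞ (l.foldr (fun i f => (partialD i)^[β i] f) φ) ∧
      ∀ x, (l.foldr (fun i f => (fun g : 𝓢(EuclideanSpace ℝ ι, ℂ) =>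
        ∂_{EuclideanSpace.single i (1 : ℝ)} g)^[β i] f) Ψ) x
        = (l.foldr (fun i f => (partialD i)^[β i] f) φ x : ℂ) := by
    intro l
    induction l with
    | nil => exact ⟨hφ, h⟩
    | cons i l ih => exact h2 (β i) i _ _ ih
  exact (h3 _).2

/-- The Fourier symbol `(2πiξ)^β` of `D^β`. -/
noncomputable def symbol (β : ι → ℕ) (ξ : EuclideanSpace ℝ ι) : ℂ :=
  ∏ i, (2 * Real.pi * Complex.I * ξ i) ^ β i

theorem continuous_symbol (β : ι → ℕ) : Continuous (symbol β) := by
  unfold symbol; fun_prop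

theorem fourier_schwartzMultiD_apply (β : ι → ℕ) (Ψ : 𝓢(EuclideanSpace ℝ ι, ℂ))
    (ξ : EuclideanSpace ℝ ι) : 𝓕 (schwartzMultiD β Ψ) ξ = symbol β ξ * 𝓕 Ψ ξ := by
  have h1 : ∀ (n : ℕ) (i : ι) (Ψ : 𝓢(EuclideanSpace ℝ ι, ℂ)),
      𝓕 ((fun g : 𝓢(EuclideanSpace ℝ ι, ℂ) =>
        ∂_{EuclideanSpace.single i (1 : ℝ)} g)^[n] Ψ) ξ
        = (2 * Real.pi * Complex.I * ξ i) ^ n * 𝓕 Ψ ξ := by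
    intro n
    induction n with
    | zero => intro i Ψ; simp
    | succ n ih =>
      intro i Ψ
      rw [Function.iterate_succ, Function.comp, ih, fourier_lineDeriv_apply, pow_succ]; ring
  have h2 : ∀ l : List ι, 𝓕 (l.foldr (fun i f => (fun g : 𝓢(EuclideanSpace ℝ ι, ℂ) =>
        ∂_{EuclideanSpace.single i (1 : ℝ)} g)^[β i] f) Ψ) ξ
        = (l.map fun i => (2 * Real.pi * Complex.I * ξ i) ^ β i).prod * 𝓕 Ψ ξ := by
    intro l
    induction l with
    | nil => simp
    | cons i l ih => rw [List.foldr_cons, h1, ih, List.map_cons, List.prod_cons]; ring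
  rw [schwartzMultiD, h2, Finset.prod_map_toList, symbol]

/-- The derivative is the inverse Fourier transform of `symbol β * ŵ`. Each factor `2πiξ_i` is
purely imaginary, so conjugating the symbol yields exactly the sign `(-1)^|β|` of integration by
parts. -/
theorem exists_weakDeriv_of_fourierL2 {w : EuclideanSpace ℝ ι → ℂ} (hw : MemLp w 2 volume)
    (β : ι → ℕ) (hβ : MemLp (fun ξ => symbol β ξ * fourierL2 hw ξ) 2 volume) :
    ∃ (g : EuclideanSpace ℝ ι → ℂ) (hg : MemLp g 2 volume), StronglyMeasurable g ∧
      IsWeakDeriv univ β w g ∧ ∀ᵐ ξ, fourierL2 hg ξ = symbol β ξ * fourierL2 hw ξ := by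
  set G : Lp ℂ 2 (volume : Measure (EuclideanSpace ℝ ι)) := 𝓕⁻ (hβ.toLp _) with hG
  have hg : MemLp G 2 volume := Lp.memLp G
  have hF : ∀ᵐ ξ, fourierL2 hg ξ = symbol β ξ * fourierL2 hw ξ := by
    have : 𝓕 (hg.toLp G) = hβ.toLp _ := by
      rw [Lp.toLp_coeFn, hG, FourierInvPair.fourier_fourierInv_eq]
    rw [fourierL2, this]
    exact hβ.coeFn_toLp
  refine ⟨G, hg, Lp.stronglyMeasurable G, ⟨?_, ?_, fun φ h2 h1 _ => ?_⟩, hF⟩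
  · exact (hw.locallyIntegrable one_le_two).locallyIntegrableOn _
  · exact (hg.locallyIntegrable one_le_two).locallyIntegrableOn _
  simp only [Measure.restrict_univ]
  set Φ := testSchwartz φ h1 h2 with hΦ
  have e1 : ∫ x, φ x • (G : EuclideanSpace ℝ ι → ℂ) x = ∫ x, conj (Φ x) * G x := by
    simp [hΦ, testSchwartz_apply]
  have e2 : ∫ x, multiD β φ x • w x = ∫ x, conj (schwartzMultiD β Φ x) * w x := by
    simp [schwartzMultiD_apply β h2 (testSchwartz_apply φ h1 h2), hΦ]
  rw [e1, e2, integral_conj_mul_eq_fourierL2 hw, integral_conj_mul_eq_fourierL2 hg,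
    ← integral_smul]
  refine integral_congr_ae ?_
  filter_upwards [hF] with ξ hξ
  have h3 : conj (symbol β ξ) = (-1) ^ (∑ i, β i) * symbol β ξ := by
    rw [symbol, map_prod, ← Finset.prod_pow_eq_pow_sum, ← Finset.prod_mul_distrib]
    refine Finset.prod_congr rfl fun i _ => ?_
    rw [map_pow, ← mul_pow]
    congr 1
    simp only [map_mul, Complex.conj_ofReal, Complex.conj_I, Complex.conj_ofNat]
    ring
  rw [fourier_schwartzMultiD_apply, hξ, map_mul, h3, Complex.real_smul]
  push_cast
  ring

end FourierLTwo

/-! ### The one-coordinate Gagliardo seminorm as a Fourier weight -/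

section FourierGagliardo

variable {ι : Type} [Fintype ι] [DecidableEq ι]

/-- The constant relating the Gagliardo seminorm in one coordinate to the Fourier transform. -/
noncomputable def gagConst (σ : ℝ) : ℝ≥0∞ :=
  ∫⁻ h : ℝ, ‖(Real.fourierChar h : ℂ) - 1‖ₑ ^ 2 / ‖h‖ₑ ^ (1 + 2 * σ)

theorem measurable_gag_integrand (σ a : ℝ) :
    Measurable fun h : ℝ => ‖(Real.fourierChar (h * a) : ℂ) - 1‖ₑ ^ 2 / ‖h‖ₑ ^ (1 + 2 * σ) := by
  have : Continuous fun h : ℝ => (Real.fourierChar (h * a) : ℂ) := by fun_prop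
  exact ((this.measurable.sub_const 1).enorm.pow_const 2).div (by fun_prop)

/-- The integrand is nonzero on the open set where the character differs from `1`, which contains
`1/2`. Positivity allows the Fourier weight to be recovered from the Gagliardo seminorm by division.
-/
theorem gagConst_ne_zero (σ : ℝ) : gagConst σ ≠ 0 := by
  intro h0
  have hm := measurable_gag_integrand σ 1
  simp only [mul_one] at hm
  rw [gagConst, lintegral_eq_zero_iff hm] at h0
  have hc : Continuous fun h : ℝ => (Real.fourierChar h : ℂ) := by fun_prop
  have hU : IsOpen {h : ℝ | (Real.fourierChar h : ℂ) ≠ 1} :=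
    isOpen_ne.preimage hc
  have hne : ({h : ℝ | (Real.fourierChar h : ℂ) ≠ 1}).Nonempty := by
    refine ⟨1 / 2, ?_⟩
    show (Real.fourierChar (1 / 2) : ℂ) ≠ 1
    rw [Real.fourierChar_apply]
    have : ((2 * Real.pi * (1 / 2) : ℝ) : ℂ) * Complex.I = Real.pi * Complex.I := by
      push_cast; ring
    rw [this, Complex.exp_pi_mul_I]; norm_num
  refine (hU.measure_pos volume hne).ne' ?_
  rw [Filter.EventuallyEq, ae_iff] at h0
  refine measure_mono_null (fun h hh => ?_) h0
  have hh' : (Real.fourierChar h : ℂ) ≠ 1 := hh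
  have h1 : ‖(Real.fourierChar h : ℂ) - 1‖ₑ ^ 2 ≠ 0 := by
    simpa [sub_eq_zero] using hh'
  show ¬ (_ = _)
  rw [Pi.zero_apply, ENNReal.div_eq_zero_iff]
  push Not
  exact ⟨h1, by
    by_cases h0 : h = 0
    · subst h0; simp at hh'
    · exact ENNReal.rpow_ne_top_of_ne_zero (by simpa using h0) enorm_ne_top⟩

/-- The integral of the kernel against a function that is quadratically small at `0`. -/
theorem lintegral_min_kernel_ne_top {σ : ℝ} (hσ : 0 < σ) (hσ1 : σ < 1) :
    ∫⁻ h : ℝ, min 1 (‖h‖ₑ ^ 2) / ‖h‖ₑ ^ (1 + 2 * σ) ≠ ⊤ := by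
  have h1 : Integrable (fun h : ℝ => min 1 (‖h‖ ^ 2) / ‖h‖ ^ (1 + 2 * σ)) volume := by
    rw [integrable_fun_norm_addHaar volume (f := fun y : ℝ => min 1 (y ^ 2) / y ^ (1 + 2 * σ))]
    simp only [Module.finrank_self, Nat.sub_self, pow_zero, one_smul]
    rw [← Ioc_union_Ioi_eq_Ioi zero_le_one]
    -- Near the origin the integrand is `y ^ (1 - 2σ)`, integrable because `σ < 1`; beyond `1` it is
    -- `y ^ (-(1 + 2σ))`, integrable because `σ > 0`.
    refine IntegrableOn.union ?_ ?_
    · have h2 := (intervalIntegral.intervalIntegrable_rpow' (a := 0) (b := 1) (r := 1 - 2 * σ)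
        (by linarith)).1
      refine h2.congr_fun (fun y hy => ?_) measurableSet_Ioc
      have : y ^ 2 ≤ 1 := pow_le_one₀ hy.1.le hy.2
      dsimp only
      rw [min_eq_right this, ← Real.rpow_natCast, ← Real.rpow_sub hy.1]
      congr 1; push_cast; ring
    · have h2 := integrableOn_Ioi_rpow_of_lt (a := -(1 + 2 * σ)) (by linarith) zero_lt_one
      refine h2.congr_fun (fun y hy => ?_) measurableSet_Ioi
      have hy' : (1 : ℝ) < y := hy
      have : 1 ≤ y ^ 2 := one_le_pow₀ hy'.le
      dsimp only
      rw [min_eq_left this, Real.rpow_neg (by linarith), one_div]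
  have h2 := h1.2
  rw [HasFiniteIntegral] at h2
  refine (lt_of_eq_of_lt (lintegral_congr_ae ?_) h2).ne
  have h0 : ∀ᵐ h : ℝ, h ≠ 0 := by simp [ae_iff]
  filter_upwards [h0] with h hh
  have hn : 0 < ‖h‖ := norm_pos_iff.2 hh
  rw [← ofReal_norm (min 1 (‖h‖ ^ 2) / ‖h‖ ^ (1 + 2 * σ)), Real.norm_of_nonneg (by positivity),
    ENNReal.ofReal_div_of_pos (by positivity), ← ENNReal.ofReal_rpow_of_pos hn, ofReal_norm,
    ENNReal.ofReal_min, ENNReal.ofReal_pow (norm_nonneg _), ofReal_norm, ENNReal.ofReal_one]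

theorem gagConst_ne_top {σ : ℝ} (hσ : 0 < σ) (hσ1 : σ < 1) : gagConst σ ≠ ⊤ := by
  have h1 : ∀ h : ℝ, ‖(Real.fourierChar h : ℂ) - 1‖ₑ ^ 2 / ‖h‖ₑ ^ (1 + 2 * σ)
      ≤ ENNReal.ofReal ((2 * Real.pi) ^ 2) * (min 1 (‖h‖ₑ ^ 2) / ‖h‖ₑ ^ (1 + 2 * σ)) := fun h => by
    rw [← mul_div_assoc]
    refine ENNReal.div_le_div_right ?_ _
    have h2 : ‖(Real.fourierChar h : ℂ) - 1‖ ≤ 2 := by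
      refine (norm_sub_le _ _).trans ?_
      rw [Circle.norm_coe, norm_one]; norm_num
    have h3 : ‖(Real.fourierChar h : ℂ) - 1‖ ≤ 2 * Real.pi * ‖h‖ := by
      rw [Real.fourierChar_apply]
      have := Real.norm_exp_I_mul_ofReal_sub_one_le (x := 2 * Real.pi * h)
      rw [mul_comm] at this
      refine this.trans (le_of_eq ?_)
      rw [norm_mul, Real.norm_of_nonneg (by positivity)]
    have h5 : (2 : ℝ) ≤ 2 * Real.pi := by nlinarith [Real.pi_gt_three]
    rw [← ofReal_norm, ← ofReal_norm, ← ENNReal.ofReal_pow (norm_nonneg _),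
      ← ENNReal.ofReal_pow (norm_nonneg _), ← ENNReal.ofReal_one, ← ENNReal.ofReal_min,
      ← ENNReal.ofReal_mul (by positivity)]
    refine ENNReal.ofReal_le_ofReal ?_
    rw [mul_min_of_nonneg _ _ (by positivity), mul_one, ← mul_pow]
    exact le_min (pow_le_pow_left₀ (norm_nonneg _) (h2.trans h5) 2)
      (pow_le_pow_left₀ (norm_nonneg _) h3 2)
  refine ((lintegral_mono h1).trans_lt ?_).ne
  rw [lintegral_const_mul' _ _ ENNReal.ofReal_ne_top]
  exact ENNReal.mul_lt_top ENNReal.ofReal_lt_top (lintegral_min_kernel_ne_top hσ hσ1).lt_top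

/-- The substitution `h ↦ h * a` for `a ≠ 0`: the kernel contributes `|a| ^ (1 + 2σ)` and the
measure `|a|⁻¹`. -/
theorem lintegral_fourierChar_kernel {σ : ℝ} (hσ : 0 < σ) (a : ℝ) :
    ∫⁻ h : ℝ, ‖(Real.fourierChar (h * a) : ℂ) - 1‖ₑ ^ 2 / ‖h‖ₑ ^ (1 + 2 * σ)
      = gagConst σ * ‖a‖ₑ ^ (2 * σ) := by
  rcases eq_or_ne a 0 with rfl | ha
  · simp [hσ]
  have hm := measurable_gag_integrand σ 1
  simp only [mul_one] at hm
  have h1 : gagConst σ = ‖a‖ₑ * ∫⁻ h : ℝ,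
      ‖(Real.fourierChar (h * a) : ℂ) - 1‖ₑ ^ 2 / ‖h * a‖ₑ ^ (1 + 2 * σ) := by
    have h2 := lintegral_map (μ := volume) (g := fun h : ℝ => h * a) hm (by fun_prop)
    rw [Real.map_volume_mul_right ha, lintegral_smul_measure, abs_inv,
      ENNReal.ofReal_inv_of_pos (abs_pos.2 ha), ← Real.norm_eq_abs, ofReal_norm] at h2
    rw [← h2, smul_eq_mul, ← mul_assoc, ENNReal.mul_inv_cancel (by simpa using ha) enorm_ne_top,
      one_mul]
    rfl
  have ha0 : ‖a‖ₑ ≠ 0 := by simpa using ha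
  have h3 : ∀ h : ℝ, ‖(Real.fourierChar (h * a) : ℂ) - 1‖ₑ ^ 2 / ‖h‖ₑ ^ (1 + 2 * σ)
      = ‖a‖ₑ ^ (1 + 2 * σ) *
        (‖(Real.fourierChar (h * a) : ℂ) - 1‖ₑ ^ 2 / ‖h * a‖ₑ ^ (1 + 2 * σ)) := fun h => by
    rcases eq_or_ne h 0 with rfl | hh
    · simp
    rw [enorm_mul, ENNReal.mul_rpow_of_ne_top enorm_ne_top enorm_ne_top, div_eq_mul_inv,
      div_eq_mul_inv, ENNReal.mul_inv (Or.inr (ENNReal.rpow_ne_top_of_ne_zero ha0 enorm_ne_top))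
        (Or.inl (ENNReal.rpow_ne_top_of_ne_zero (by simpa using hh) enorm_ne_top))]
    have h4 : ‖a‖ₑ ^ (1 + 2 * σ) * (‖a‖ₑ ^ (1 + 2 * σ))⁻¹ = 1 :=
      ENNReal.mul_inv_cancel (by simp [ha0]) (ENNReal.rpow_ne_top_of_ne_zero ha0 enorm_ne_top)
    calc _ = ‖(Real.fourierChar (h * a) : ℂ) - 1‖ₑ ^ 2 * (‖h‖ₑ ^ (1 + 2 * σ))⁻¹ *
          (‖a‖ₑ ^ (1 + 2 * σ) * (‖a‖ₑ ^ (1 + 2 * σ))⁻¹) := by rw [h4, mul_one]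
      _ = _ := by ring
  simp only [h3]
  rw [lintegral_const_mul' _ _ (ENNReal.rpow_ne_top_of_ne_zero ha0 enorm_ne_top),
    ENNReal.rpow_add _ _ ha0 enorm_ne_top, ENNReal.rpow_one, h1]
  ring

theorem lintegral_euclidean (F : EuclideanSpace ℝ ι → ℝ≥0∞) :
    ∫⁻ x : ι → ℝ, F (WithLp.toLp 2 x) ∂(Measure.pi fun _ => volume) = ∫⁻ x, F x :=
  (PiLp.volume_preserving_toLp ι).lintegral_comp_emb
    (MeasurableEquiv.toLp 2 (ι → ℝ)).measurableEmbedding F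

theorem toLp_update (x : ι → ℝ) (i : ι) (t : ℝ) :
    WithLp.toLp 2 (Function.update x i t)
      = (WithLp.toLp 2 x : EuclideanSpace ℝ ι) + (t - x i) • EuclideanSpace.single i (1 : ℝ) := by
  ext j
  by_cases hj : j = i
  · subst hj; simp
  · simp [hj]

/-- The Gagliardo seminorm in one coordinate, as a weighted norm of the Fourier transform. -/
theorem dirGag_eq_lintegral_fourierL2 {σ : ℝ} (hσ : 0 < σ) (i : ι)
    {v : EuclideanSpace ℝ ι → ℂ} (hv : MemLp v 2 volume) (hvm : Measurable v) :
    dirGag volume σ i (fun x => v (WithLp.toLp 2 x))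
      = gagConst σ * ∫⁻ ξ, ‖ξ i‖ₑ ^ (2 * σ) * ‖fourierL2 hv ξ‖ₑ ^ 2 := by
  set e : EuclideanSpace ℝ ι := EuclideanSpace.single i (1 : ℝ) with he
  have h1 : dirGag volume σ i (fun x => v (WithLp.toLp 2 x))
      = ∫⁻ x : EuclideanSpace ℝ ι, ∫⁻ h : ℝ, ‖v (x + h • e) - v x‖ₑ ^ 2 / ‖h‖ₑ ^ (1 + 2 * σ) := by
    rw [← lintegral_euclidean]
    refine lintegral_congr fun x => ?_
    dsimp only
    rw [← lintegral_sub_right_eq_self (μ := volume) (fun h : ℝ =>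
      ‖v (WithLp.toLp 2 x + h • e) - v (WithLp.toLp 2 x)‖ₑ ^ 2 / ‖h‖ₑ ^ (1 + 2 * σ)) (x i)]
    refine lintegral_congr fun t => ?_
    rw [toLp_update, enorm_sub_rev, enorm_sub_rev (x i)]
  have hmeas : Measurable fun q : EuclideanSpace ℝ ι × ℝ =>
      ‖v (q.1 + q.2 • e) - v q.1‖ₑ ^ 2 / ‖q.2‖ₑ ^ (1 + 2 * σ) := by
    have : Measurable fun q : EuclideanSpace ℝ ι × ℝ => v (q.1 + q.2 • e) :=
      hvm.comp (f := fun q : EuclideanSpace ℝ ι × ℝ => q.1 + q.2 • e) (by fun_prop)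
    exact ((this.sub (hvm.comp measurable_fst)).enorm.pow_const 2).div (by fun_prop)
  -- Plancherel for the difference of `v` and its translate along the coordinate; the translate
  -- acquires the phase of the character.
  have h2 : ∀ h : ℝ, ∫⁻ x : EuclideanSpace ℝ ι, ‖v (x + h • e) - v x‖ₑ ^ 2
      = ∫⁻ ξ, ‖(Real.fourierChar (h * ξ i) : ℂ) - 1‖ₑ ^ 2 * ‖fourierL2 hv ξ‖ₑ ^ 2 := by
    intro h
    have hva : MemLp (fun x => v (x + h • e)) 2 volume :=
      hv.comp_measurePreserving (measurePreserving_add_right volume (h • e))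
    have hsub := hva.sub hv
    have h3 : fourierL2 hsub =ᵐ[volume] fun ξ => fourierL2 hva ξ - fourierL2 hv ξ := by
      have : FourierTransform.fourier (hsub.toLp _)
          = FourierTransform.fourier (hva.toLp _) - FourierTransform.fourier (hv.toLp _) := by
        rw [MemLp.toLp_sub]
        exact map_sub (Lp.fourierTransformₗᵢ (EuclideanSpace ℝ ι) ℂ) _ _
      rw [fourierL2, this]
      exact Lp.coeFn_sub _ _
    refine (lintegral_fourierL2_sq hsub).symm.trans (lintegral_congr_ae ?_)
    filter_upwards [h3, fourierL2_translate hv (h • e) hva] with ξ h4 h5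
    rw [h4, h5, inner_smul_left, he, EuclideanSpace.inner_single_left, ← sub_one_mul, enorm_mul,
      mul_pow]
    simp
  have hF : AEMeasurable (fun ξ => ‖fourierL2 hv ξ‖ₑ ^ 2) volume :=
    (memLp_fourierL2 hv).aestronglyMeasurable.aemeasurable.enorm.pow_const 2
  rw [h1, lintegral_lintegral_swap hmeas.aemeasurable]
  have h6 : ∀ h : ℝ, ∫⁻ x : EuclideanSpace ℝ ι, ‖v (x + h • e) - v x‖ₑ ^ 2 / ‖h‖ₑ ^ (1 + 2 * σ)
      = ∫⁻ ξ : EuclideanSpace ℝ ι, (‖(Real.fourierChar (h * ξ i) : ℂ) - 1‖ₑ ^ 2 /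
        ‖h‖ₑ ^ (1 + 2 * σ)) * ‖fourierL2 hv ξ‖ₑ ^ 2 := by
    intro h
    rcases eq_or_ne h 0 with rfl | hh
    · simp
    have hne : (‖h‖ₑ ^ (1 + 2 * σ))⁻¹ ≠ ⊤ := by
      simp only [ne_eq, ENNReal.inv_eq_top, ENNReal.rpow_eq_zero_iff, not_or]
      simp [hh]
    simp only [div_eq_mul_inv]
    rw [lintegral_mul_const' _ _ hne, h2, ← lintegral_mul_const' _ _ hne]
    refine lintegral_congr fun ξ => by ring
  simp only [h6]
  have hK : Measurable fun q : ℝ × EuclideanSpace ℝ ι =>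
      ‖(Real.fourierChar (q.1 * q.2 i) : ℂ) - 1‖ₑ ^ 2 / ‖q.1‖ₑ ^ (1 + 2 * σ) := by
    have : Continuous fun q : ℝ × EuclideanSpace ℝ ι => (Real.fourierChar (q.1 * q.2 i) : ℂ) := by
      fun_prop
    exact ((this.measurable.sub_const 1).enorm.pow_const 2).div (by fun_prop)
  rw [lintegral_lintegral_swap (hK.aemeasurable.mul
    (hF.comp_quasiMeasurePreserving Measure.quasiMeasurePreserving_snd))]
  have h7 : ∀ ξ : EuclideanSpace ℝ ι, ∫⁻ h : ℝ, (‖(Real.fourierChar (h * ξ i) : ℂ) - 1‖ₑ ^ 2 /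
        ‖h‖ₑ ^ (1 + 2 * σ)) * ‖fourierL2 hv ξ‖ₑ ^ 2
      = gagConst σ * (‖ξ i‖ₑ ^ (2 * σ) * ‖fourierL2 hv ξ‖ₑ ^ 2) := fun ξ => by
    rw [lintegral_mul_const _ (measurable_gag_integrand σ (ξ i)), lintegral_fourierChar_kernel hσ,
      mul_assoc]
  simp only [h7]
  rw [lintegral_const_mul'' _ (AEMeasurable.fun_mul (by fun_prop) hF)]

end FourierGagliardo

/-! ### Poincaré inequalities on the unit interval -/

section OneDimensional

theorem exists_unit_test_function :
    ∃ φ : ℝ → ℝ, ContDiff ℝ ∞ φ ∧ HasCompactSupport φ ∧ tsupport φ ⊆ Icc 0 1 ∧ ∫ t, φ t = 1 := by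
  let b : ContDiffBump (1 / 2 : ℝ) := ⟨1 / 8, 1 / 4, by norm_num, by norm_num⟩
  refine ⟨b.normed volume, b.contDiff_normed, b.hasCompactSupport_normed, ?_, b.integral_normed⟩
  rw [b.tsupport_normed_eq]
  intro t ht
  rw [Metric.mem_closedBall, Real.dist_eq, abs_le] at ht
  change -(1 / 4 : ℝ) ≤ t - 1 / 2 ∧ t - 1 / 2 ≤ 1 / 4 at ht
  constructor <;> linarith

theorem exists_enorm_le_of_hasCompactSupport {E F : Type*} [TopologicalSpace E]
    [NormedAddCommGroup F] {φ : E → F} (hφ : Continuous φ) (hc : HasCompactSupport φ) :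
    ∃ M : ℝ≥0, ∀ x, ‖φ x‖ₑ ≤ M := by
  obtain ⟨M, hM⟩ := hc.exists_bound_of_continuous hφ
  refine ⟨M.toNNReal, fun x => ?_⟩
  rw [← ofReal_norm]
  exact ENNReal.ofReal_le_ofReal (hM x)

/-- Jensen's inequality for the unweighted square. -/
theorem enorm_integral_sq_le {α : Type*} [MeasurableSpace α] {μ : Measure α} [IsFiniteMeasure μ]
    {f : α → ℂ} (hf : AEStronglyMeasurable f μ) :
    ‖∫ x, f x ∂μ‖ₑ ^ 2 ≤ μ univ * ∫⁻ x, ‖f x‖ₑ ^ 2 ∂μ := by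
  have h1 : ‖∫ x, f x ∂μ‖ₑ ≤ ∫⁻ x, ‖f x‖ₑ ∂μ := enorm_integral_le_lintegral_enorm f
  have h2 := ENNReal.lintegral_mul_le_Lp_mul_Lq μ (p := 2) (q := 2)
    (Real.HolderConjugate.two_two) (f := fun _ => 1) (g := fun x => ‖f x‖ₑ) aemeasurable_const
    hf.enorm
  simp only [Pi.mul_apply, one_mul, ENNReal.one_rpow, lintegral_const] at h2
  calc ‖∫ x, f x ∂μ‖ₑ ^ 2 ≤ (∫⁻ x, ‖f x‖ₑ ∂μ) ^ 2 := by gcongr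
    _ ≤ ((μ univ) ^ (1 / 2 : ℝ) * (∫⁻ x, ‖f x‖ₑ ^ (2 : ℝ) ∂μ) ^ (1 / 2 : ℝ)) ^ 2 := by gcongr
    _ = _ := by
      rw [mul_pow, ← ENNReal.rpow_natCast, ← ENNReal.rpow_natCast, ← ENNReal.rpow_mul,
        ← ENNReal.rpow_mul]
      norm_num

/-- The fundamental theorem of calculus and the Cauchy–Schwarz inequality on an interval of length
at most `1`. -/
theorem enorm_sub_sq_le_lintegral_deriv {g g' : ℝ → ℂ} (hg : ∀ t, HasDerivAt g (g' t) t)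
    (hg' : Continuous g') {s t : ℝ} (hs : s ∈ Icc (0 : ℝ) 1) (ht : t ∈ Icc (0 : ℝ) 1) :
    ‖g s - g t‖ₑ ^ 2 ≤ ∫⁻ r in Icc (0 : ℝ) 1, ‖g' r‖ₑ ^ 2 := by
  wlog hst : t ≤ s generalizing s t
  · rw [enorm_sub_rev]; exact this ht hs (le_of_not_ge hst)
  rw [← intervalIntegral.integral_eq_sub_of_hasDerivAt (fun x _ => hg x)
    (hg'.intervalIntegrable _ _), intervalIntegral.integral_of_le hst]
  refine (enorm_integral_sq_le hg'.aestronglyMeasurable.restrict).trans ?_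
  have hsub : Ioc t s ⊆ Icc (0 : ℝ) 1 := fun r hr => ⟨ht.1.trans hr.1.le, hr.2.trans hs.2⟩
  have h1 : volume.restrict (Ioc t s) univ ≤ 1 := by
    rw [Measure.restrict_apply_univ]
    refine (measure_mono hsub).trans ?_
    simp
  calc _ ≤ 1 * ∫⁻ r in Icc (0 : ℝ) 1, ‖g' r‖ₑ ^ 2 := mul_le_mul' h1 (lintegral_mono_set hsub)
    _ = _ := one_mul _

/-- Testing a derivative against a fixed function is bounded by the `L²` norm of the function. -/
theorem exists_enorm_integral_mul_deriv_le {φ : ℝ → ℝ} (hφ : ContDiff ℝ ∞ φ)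
    (hc : HasCompactSupport φ) (hs : tsupport φ ⊆ Icc 0 1) (l : ℕ) :
    ∃ C : ℝ≥0, ∀ g : ℕ → ℝ → ℂ, (∀ k t, HasDerivAt (g k) (g (k + 1) t) t) →
      ‖∫ t in Icc (0 : ℝ) 1, φ t • g l t‖ₑ ^ 2 ≤ C * ∫⁻ t in Icc (0 : ℝ) 1, ‖g 0 t‖ₑ ^ 2 := by
  induction l generalizing φ with
  | zero =>
    obtain ⟨M, hM⟩ := exists_enorm_le_of_hasCompactSupport hφ.continuous hc
    refine ⟨M ^ 2, fun g hg => ?_⟩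
    have hgc : Continuous (g 0) := continuous_iff_continuousAt.2 fun t => (hg 0 t).continuousAt
    refine (enorm_integral_sq_le (hφ.continuous.smul hgc).aestronglyMeasurable.restrict).trans ?_
    rw [Measure.restrict_apply_univ, Real.volume_Icc, sub_zero, ENNReal.ofReal_one, one_mul,
      ← lintegral_const_mul' _ _ ENNReal.coe_ne_top]
    refine lintegral_mono fun t => ?_
    change ‖φ t • g 0 t‖ₑ ^ 2 ≤ _
    rw [enorm_smul, mul_pow, ENNReal.coe_pow]
    gcongr
    exact hM t
  | succ l ih =>
    have hφ' : ContDiff ℝ ∞ (deriv φ) := (contDiff_infty_iff_deriv.1 hφ).2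
    obtain ⟨C, hC⟩ := ih hφ' hc.deriv ((tsupport_deriv_subset).trans hs)
    refine ⟨C, fun g hg => ?_⟩
    have hgc : ∀ k, Continuous (g k) := fun k =>
      continuous_iff_continuousAt.2 fun t => (hg k t).continuousAt
    have hz : ∀ {ψ : ℝ → ℝ}, tsupport ψ ⊆ Icc 0 1 → ∀ k, 
        ∫ t in Icc (0 : ℝ) 1, ψ t • g k t = ∫ t, ψ t • g k t := fun {ψ} hψ k => by
      refine setIntegral_eq_integral_of_forall_compl_eq_zero fun t ht => ?_
      rw [image_eq_zero_of_notMem_tsupport fun h => ht (hψ h), zero_smul]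
    -- Integration by parts has no boundary terms because `φ` has compact support, and `deriv φ` is
    -- again supported in the interval.
    have key : ∫ t, φ t • g (l + 1) t = - ∫ t, deriv φ t • g l t := by
      refine integral_bilinear_hasDerivAt_right_eq_neg_left_of_integrable
        (L := ContinuousLinearMap.lsmul ℝ ℝ) (fun t _ => (hφ.differentiable (by simp) t).hasDerivAt) (fun t _ => hg l t) ?_ ?_ ?_
      · exact ((hφ.continuous.smul (hgc _)).integrable_of_hasCompactSupport hc.smul_right)
      · exact ((hφ'.continuous.smul (hgc _)).integrable_of_hasCompactSupport hc.deriv.smul_right)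
      · exact ((hφ.continuous.smul (hgc _)).integrable_of_hasCompactSupport hc.smul_right)
    rw [hz hs, key, enorm_neg, ← hz ((tsupport_deriv_subset).trans hs)]
    exact hC g hg

/-- Poincaré's inequality on the unit interval, in unintegrated form. -/
theorem exists_lintegral_sq_le_of_test {φ : ℝ → ℝ} (hφ : Continuous φ)
    (hc : HasCompactSupport φ) (hs : tsupport φ ⊆ Icc 0 1) (h1 : ∫ t, φ t = 1) :
    ∃ C : ℝ≥0, ∀ g : ℝ → ℂ, Continuous g →
      ∫⁻ s in Icc (0 : ℝ) 1, ‖g s‖ₑ ^ 2 ≤ C * (‖∫ t in Icc (0 : ℝ) 1, φ t • g t‖ₑ ^ 2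
        + ∫⁻ s in Icc (0 : ℝ) 1, ∫⁻ t in Icc (0 : ℝ) 1, ‖g s - g t‖ₑ ^ 2) := by
  obtain ⟨M, hM⟩ := exists_enorm_le_of_hasCompactSupport hφ hc
  set K : ℝ≥0 := M ^ 2 with hK
  have hφ1 : ∫ t in Icc (0 : ℝ) 1, φ t = 1 := by
    rw [setIntegral_eq_integral_of_forall_compl_eq_zero fun t ht =>
      image_eq_zero_of_notMem_tsupport fun h => ht (hs h), h1]
  refine ⟨2 * (K + 1), fun g hg => ?_⟩
  have hint : ∀ k : ℝ → ℂ, Continuous k → IntegrableOn (fun t => φ t • k t) (Icc (0 : ℝ) 1) :=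
    fun k hk => (hφ.smul hk).continuousOn.integrableOn_Icc
  have hpt : ∀ s, ‖g s‖ₑ ^ 2 ≤ 2 * (‖∫ t in Icc (0 : ℝ) 1, φ t • g t‖ₑ ^ 2
      + K * ∫⁻ t in Icc (0 : ℝ) 1, ‖g s - g t‖ₑ ^ 2) := by
    intro s
    -- Since `φ` has integral `1`, subtracting the weighted mean of `g` averages the differences `g
    -- s - g t`.
    have h2 : g s - ∫ t in Icc (0 : ℝ) 1, φ t • g t
        = ∫ t in Icc (0 : ℝ) 1, φ t • (g s - g t) := by
      simp only [smul_sub]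
      rw [integral_sub (hint _ continuous_const) (hint _ hg), integral_smul_const, hφ1, one_smul]
    have h3 := enorm_sub_sq_le (g s) (∫ t in Icc (0 : ℝ) 1, φ t • g t) 0
    rw [sub_zero, sub_zero, h2, add_comm] at h3
    refine h3.trans ?_
    gcongr
    refine (enorm_integral_sq_le
      (hφ.smul (continuous_const.sub hg)).aestronglyMeasurable.restrict).trans ?_
    rw [Measure.restrict_apply_univ, Real.volume_Icc, sub_zero, ENNReal.ofReal_one, one_mul,
      ← lintegral_const_mul' _ _ ENNReal.coe_ne_top]
    refine lintegral_mono fun t => ?_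
    change ‖φ t • (g s - g t)‖ₑ ^ 2 ≤ _
    rw [enorm_smul, mul_pow, hK, ENNReal.coe_pow]
    gcongr
    exact hM t
  refine (lintegral_mono hpt).trans ?_
  rw [lintegral_const_mul' _ _ (by simp), lintegral_add_left measurable_const, lintegral_const,
    Measure.restrict_apply_univ, Real.volume_Icc, sub_zero, ENNReal.ofReal_one, mul_one,
    lintegral_const_mul' _ _ ENNReal.coe_ne_top]
  push_cast
  rw [mul_assoc]
  gcongr
  rw [mul_add]
  gcongr
  · exact le_mul_of_one_le_left' le_add_self
  · exact le_self_add

/-- Poincaré's inequality for the `l`-th derivative. Its mean against `φ` is bounded by the `L²`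
norm of `g 0` after `l` integrations by parts, its oscillation by the next derivative. -/
theorem exists_lintegral_deriv_sq_le_deriv (l : ℕ) :
    ∃ C : ℝ≥0, ∀ g : ℕ → ℝ → ℂ, (∀ k t, HasDerivAt (g k) (g (k + 1) t) t) →
      ∫⁻ t in Icc (0 : ℝ) 1, ‖g l t‖ₑ ^ 2
        ≤ C * ((∫⁻ t in Icc (0 : ℝ) 1, ‖g 0 t‖ₑ ^ 2)
            + ∫⁻ t in Icc (0 : ℝ) 1, ‖g (l + 1) t‖ₑ ^ 2) := by
  obtain ⟨φ, hφ, hc, hs, h1⟩ := exists_unit_test_function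
  obtain ⟨C₁, hC₁⟩ := exists_enorm_integral_mul_deriv_le hφ hc hs l
  obtain ⟨C₂, hC₂⟩ := exists_lintegral_sq_le_of_test hφ.continuous hc hs h1
  refine ⟨C₂ * (C₁ + 1), fun g hg => ?_⟩
  have hgc : ∀ k, Continuous (g k) := fun k =>
    continuous_iff_continuousAt.2 fun t => (hg k t).continuousAt
  refine (hC₂ _ (hgc l)).trans ?_
  push_cast
  rw [mul_assoc]
  refine mul_le_mul_right ?_ _
  rw [mul_add]
  refine add_le_add ((hC₁ g hg).trans (by gcongr; exact le_self_add)) ?_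
  calc _ ≤ ∫⁻ s in Icc (0 : ℝ) 1, ∫⁻ t in Icc (0 : ℝ) 1,
        ∫⁻ r in Icc (0 : ℝ) 1, ‖g (l + 1) r‖ₑ ^ 2 :=
        setLIntegral_mono' measurableSet_Icc fun s hs => setLIntegral_mono' measurableSet_Icc
          fun t ht => enorm_sub_sq_le_lintegral_deriv (hg l) (hgc (l + 1)) hs ht
    _ = ∫⁻ r in Icc (0 : ℝ) 1, ‖g (l + 1) r‖ₑ ^ 2 := by simp
    _ ≤ _ := le_mul_of_one_le_left' le_add_self

/-- As with the next derivative, but the oscillation is bounded by the Gagliardo seminorm, because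
`|s - t| ≤ 1` makes the kernel at least `1`. -/
theorem exists_lintegral_deriv_sq_le_gag {σ : ℝ} (hσ : 0 < σ) (l : ℕ) :
    ∃ C : ℝ≥0, ∀ g : ℕ → ℝ → ℂ, (∀ k t, HasDerivAt (g k) (g (k + 1) t) t) →
      ∫⁻ t in Icc (0 : ℝ) 1, ‖g l t‖ₑ ^ 2
        ≤ C * ((∫⁻ t in Icc (0 : ℝ) 1, ‖g 0 t‖ₑ ^ 2)
            + ∫⁻ s in Icc (0 : ℝ) 1, ∫⁻ t in Icc (0 : ℝ) 1,
              ‖g l s - g l t‖ₑ ^ 2 / ‖s - t‖ₑ ^ (1 + 2 * σ)) := by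
  obtain ⟨φ, hφ, hc, hs, h1⟩ := exists_unit_test_function
  obtain ⟨C₁, hC₁⟩ := exists_enorm_integral_mul_deriv_le hφ hc hs l
  obtain ⟨C₂, hC₂⟩ := exists_lintegral_sq_le_of_test hφ.continuous hc hs h1
  refine ⟨C₂ * (C₁ + 1), fun g hg => ?_⟩
  have hgc : ∀ k, Continuous (g k) := fun k =>
    continuous_iff_continuousAt.2 fun t => (hg k t).continuousAt
  refine (hC₂ _ (hgc l)).trans ?_
  push_cast
  rw [mul_assoc]
  refine mul_le_mul_right ?_ _
  rw [mul_add]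
  refine add_le_add ((hC₁ g hg).trans (by gcongr; exact le_self_add)) ?_
  refine le_trans ?_ (le_mul_of_one_le_left' le_add_self)
  refine setLIntegral_mono' measurableSet_Icc fun s hs => setLIntegral_mono' measurableSet_Icc
    fun t ht => ?_
  have h3 : ‖s - t‖ₑ ^ (1 + 2 * σ) ≤ 1 := by
    refine ENNReal.rpow_le_one ?_ (by positivity)
    rw [← ofReal_norm, ← ENNReal.ofReal_one]
    refine ENNReal.ofReal_le_ofReal ?_
    rw [Real.norm_eq_abs, abs_le]
    constructor <;> linarith [hs.1, hs.2, ht.1, ht.2]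
  calc ‖g l s - g l t‖ₑ ^ 2 = ‖g l s - g l t‖ₑ ^ 2 / 1 := by simp
    _ ≤ _ := ENNReal.div_le_div_left h3 _

end OneDimensional

/-! ### Directional seminorms and intermediate derivatives on the unit cube -/

section Cube

variable {ι : Type} [Fintype ι] [DecidableEq ι]

/-- The partial derivative in direction `i`. -/
noncomputable def pderivC (i : ι) (f : (ι → ℝ) → ℂ) : (ι → ℝ) → ℂ :=
  fun x => fderiv ℝ f x (Pi.single i 1)

theorem contDiff_pderivC {f : (ι → ℝ) → ℂ} (hf : ContDiff ℝ ∞ f) (i : ι) :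
    ContDiff ℝ ∞ (pderivC i f) :=
  (hf.fderiv_right (m := ∞) (by simp)).clm_apply contDiff_const

theorem contDiff_iterate_pderivC {f : (ι → ℝ) → ℂ} (hf : ContDiff ℝ ∞ f) (i : ι) (l : ℕ) :
    ContDiff ℝ ∞ ((pderivC i)^[l] f) := by
  induction l with
  | zero => exact hf
  | succ l ih => rw [Function.iterate_succ_apply']; exact contDiff_pderivC ih i

theorem hasDerivAt_comp_update {f : (ι → ℝ) → ℂ} (hf : ContDiff ℝ ∞ f) (i : ι) (x : ι → ℝ) (t : ℝ) :
    HasDerivAt (fun t => f (Function.update x i t)) (pderivC i f (Function.update x i t)) t :=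
  (hf.differentiable (by simp) (Function.update x i t)).hasFDerivAt.comp_hasDerivAt t
    (hasDerivAt_update x i t)

/-- The squared `L²` norm (for `σ = 0`) or Gagliardo seminorm in the `i`-th coordinate. -/
noncomputable def dirVal (μ : Measure ℝ) (σ : ℝ) (i : ι) (v : (ι → ℝ) → ℂ) : ℝ≥0∞ :=
  if σ = 0 then ∫⁻ x, ‖v x‖ₑ ^ 2 ∂(Measure.pi fun _ => μ) else dirGag μ σ i v

theorem measurable_dirGag_integrand {v : (ι → ℝ) → ℂ} (hv : Measurable v) (σ : ℝ) (i : ι) :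
    Measurable fun q : (ι → ℝ) × ℝ =>
      ‖v q.1 - v (Function.update q.1 i q.2)‖ₑ ^ 2 / ‖q.1 i - q.2‖ₑ ^ (1 + 2 * σ) := by
  have hu : Measurable fun q : (ι → ℝ) × ℝ => Function.update q.1 i q.2 :=
    measurable_update' (a := i)
  exact (((hv.comp measurable_fst).sub (hv.comp hu)).enorm.pow_const 2).div (by fun_prop)

/-- The unit interval has mass one, so averaging over a resampled coordinate changes nothing. This
exposes the lines in direction `i`, on which the one-dimensional inequalities apply. -/
theorem lintegral_eq_lintegral_update (i : ι) {F : (ι → ℝ) → ℝ≥0∞} (hF : Measurable F) :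
    ∫⁻ x, F x ∂(Measure.pi fun _ : ι => volume.restrict (Icc (0 : ℝ) 1))
      = ∫⁻ x, ∫⁻ t in Icc (0 : ℝ) 1, F (Function.update x i t) ∂volume
          ∂(Measure.pi fun _ : ι => volume.restrict (Icc (0 : ℝ) 1)) := by
  rw [lintegral_update _ i hF]
  simp

theorem dirGag_eq_lintegral_update {v : (ι → ℝ) → ℂ} (hv : Measurable v) (σ : ℝ) (i : ι) :
    dirGag (volume.restrict (Icc (0 : ℝ) 1)) σ i v
      = ∫⁻ x, ∫⁻ s in Icc (0 : ℝ) 1, ∫⁻ t in Icc (0 : ℝ) 1,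
          ‖v (Function.update x i s) - v (Function.update x i t)‖ₑ ^ 2 / ‖s - t‖ₑ ^ (1 + 2 * σ)
          ∂volume ∂volume ∂(Measure.pi fun _ : ι => volume.restrict (Icc (0 : ℝ) 1)) := by
  rw [dirGag, lintegral_eq_lintegral_update i (measurable_dirGag_integrand hv σ i).lintegral_prod_right']
  simp

/-- Intermediate derivatives in one coordinate are controlled by the extreme ones. -/
theorem exists_lintegral_pderivC_sq_le (i : ι) {σ : ℝ} (hσ : 0 ≤ σ) (m : ℕ) {l : ℕ} (hl : l ≤ m) :
    ∃ C : ℝ≥0, ∀ f : (ι → ℝ) → ℂ, ContDiff ℝ ∞ f →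
      ∫⁻ x, ‖(pderivC i)^[l] f x‖ₑ ^ 2 ∂(Measure.pi fun _ => volume.restrict (Icc (0 : ℝ) 1))
        ≤ C * ((∫⁻ x, ‖f x‖ₑ ^ 2 ∂(Measure.pi fun _ => volume.restrict (Icc (0 : ℝ) 1)))
          + dirVal (volume.restrict (Icc (0 : ℝ) 1)) σ i ((pderivC i)^[m] f)) := by
  have hseq : ∀ {f : (ι → ℝ) → ℂ}, ContDiff ℝ ∞ f → ∀ x k t,
      HasDerivAt (fun t => (pderivC i)^[k] f (Function.update x i t))
        ((pderivC i)^[k + 1] f (Function.update x i t)) t := fun hf x k t => by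
    rw [Function.iterate_succ_apply']
    exact hasDerivAt_comp_update (contDiff_iterate_pderivC hf i k) i x t
  have hmeas : ∀ {f : (ι → ℝ) → ℂ}, ContDiff ℝ ∞ f → ∀ k,
      Measurable fun x => ‖(pderivC i)^[k] f x‖ₑ ^ 2 := fun hf k =>
    (contDiff_iterate_pderivC hf i k).continuous.measurable.enorm.pow_const 2
  have hmeas2 : ∀ {f : (ι → ℝ) → ℂ}, ContDiff ℝ ∞ f → ∀ k, Measurable fun x : ι → ℝ =>
      ∫⁻ t in Icc (0 : ℝ) 1, ‖(pderivC i)^[k] f (Function.update x i t)‖ₑ ^ 2 := fun hf k =>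
    Measurable.lintegral_prod_right' (ν := volume.restrict (Icc (0 : ℝ) 1))
      (f := fun q : (ι → ℝ) × ℝ => ‖(pderivC i)^[k] _ (Function.update q.1 i q.2)‖ₑ ^ 2)
      ((hmeas hf k).comp (measurable_update' (a := i)))
  -- The induction descends from the top order `m`, where the seminorm of order `σ` enters; each
  -- lower order is bounded by the function and the order just above.
  induction hl using Nat.decreasingInduction with
  | self =>
    rcases hσ.eq_or_lt with rfl | hσ
    · refine ⟨1, fun f hf => ?_⟩
      simp [dirVal]
    obtain ⟨C, hC⟩ := exists_lintegral_deriv_sq_le_gag hσ m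
    refine ⟨C, fun f hf => ?_⟩
    change _ ≤ (C : ℝ≥0∞) * ((∫⁻ x, ‖(pderivC i)^[0] f x‖ₑ ^ 2
      ∂(Measure.pi fun _ => volume.restrict (Icc (0 : ℝ) 1))) + _)
    rw [dirVal, if_neg hσ.ne', lintegral_eq_lintegral_update i (hmeas hf m),
      lintegral_eq_lintegral_update i (hmeas hf 0),
      dirGag_eq_lintegral_update (contDiff_iterate_pderivC hf i m).continuous.measurable,
      ← lintegral_add_left (hmeas2 hf 0), ← lintegral_const_mul' _ _ ENNReal.coe_ne_top]
    exact lintegral_mono fun x => hC (fun k t => (pderivC i)^[k] f (Function.update x i t))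
      (hseq hf x)
  | of_succ l hl ih =>
    obtain ⟨C₁, hC₁⟩ := ih
    obtain ⟨C, hC⟩ := exists_lintegral_deriv_sq_le_deriv l
    refine ⟨C * (1 + C₁), fun f hf => ?_⟩
    have h1 : ∫⁻ x, ‖(pderivC i)^[l] f x‖ₑ ^ 2
          ∂(Measure.pi fun _ => volume.restrict (Icc (0 : ℝ) 1))
        ≤ C * ((∫⁻ x, ‖(pderivC i)^[0] f x‖ₑ ^ 2
            ∂(Measure.pi fun _ => volume.restrict (Icc (0 : ℝ) 1)))
          + ∫⁻ x, ‖(pderivC i)^[l + 1] f x‖ₑ ^ 2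
            ∂(Measure.pi fun _ => volume.restrict (Icc (0 : ℝ) 1))) := by
      rw [lintegral_eq_lintegral_update i (hmeas hf l),
        lintegral_eq_lintegral_update i (hmeas hf (l + 1)),
        lintegral_eq_lintegral_update i (hmeas hf 0),
        ← lintegral_add_left (hmeas2 hf 0), ← lintegral_const_mul' _ _ ENNReal.coe_ne_top]
      exact lintegral_mono fun x => hC (fun k t => (pderivC i)^[k] f (Function.update x i t))
        (hseq hf x)
    refine h1.trans ?_
    push_cast
    rw [mul_assoc]
    refine mul_le_mul_right ?_ _
    rw [add_mul, one_mul]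
    exact add_le_add le_self_add (hC₁ f hf)

/-- `L²` norms under composition with contracting coordinatewise maps. -/
theorem lintegral_sq_comp_le {μ ν : Measure ℝ} [SigmaFinite μ] [SigmaFinite ν] {θ : ι → ℝ → ℝ}
    (hθ : ∀ i, Measurable (θ i)) {c : ℝ≥0} (h : ∀ i, μ.map (θ i) ≤ c • ν)
    {v : (ι → ℝ) → ℂ} (hv : Measurable v) :
    ∫⁻ x, ‖v fun j => θ j (x j)‖ₑ ^ 2 ∂(Measure.pi fun _ => μ)
      ≤ (c : ℝ≥0∞) ^ Fintype.card ι * ∫⁻ x, ‖v x‖ₑ ^ 2 ∂(Measure.pi fun _ => ν) :=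
  lintegral_comp_pi_le hθ h (F := fun x => ‖v x‖ₑ ^ 2) (hv.enorm.pow_const 2)

/-- The maps `θ i` do not increase distances, so the kernel at the images is at least as large; the
change of measure costs one factor `c` for each coordinate and one for `t`. -/
theorem dirGag_comp_le {μ ν : Measure ℝ} [SigmaFinite μ] [SigmaFinite ν] {θ : ι → ℝ → ℝ}
    (hθ : ∀ i, Measurable (θ i)) {c : ℝ≥0} (h : ∀ i, μ.map (θ i) ≤ c • ν)
    (hL : ∀ i s t, |θ i s - θ i t| ≤ |s - t|) {σ : ℝ} (hσ : 0 ≤ σ) (i : ι)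
    {v : (ι → ℝ) → ℂ} (hv : Measurable v) :
    dirGag μ σ i (fun x => v fun j => θ j (x j))
      ≤ (c : ℝ≥0∞) ^ (Fintype.card ι + 1) * dirGag ν σ i v := by
  refine le_trans ?_ (lintegral_comp_pi_real_le hθ h i (measurable_dirGag_integrand hv σ i))
  refine lintegral_mono fun x => lintegral_mono fun t => ?_
  have h1 : (fun j => θ j (Function.update x i t j))
      = Function.update (fun j => θ j (x j)) i (θ i t) := by
    funext j
    by_cases hj : j = i
    · subst hj; simp
    · simp [hj]
  dsimp only
  rw [h1]
  refine ENNReal.div_le_div_left (ENNReal.rpow_le_rpow ?_ (by positivity)) _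
  rw [← ofReal_norm, ← ofReal_norm]
  exact ENNReal.ofReal_le_ofReal (hL i _ _)

end Cube

/-! ### Higher-order reflection across the faces of the cube -/

section Reflection

/-- The folding map that is the identity on `[0,1]` and reflects, with dilation `r`, at the two
end points. -/
noncomputable def reflMap (r t : ℝ) : ℝ :=
  if t < 0 then -r * t else if t ≤ 1 then t else 1 + r * (1 - t)

theorem reflMap_of_mem (r : ℝ) {t : ℝ} (ht : t ∈ Icc (0 : ℝ) 1) : reflMap r t = t := by
  rw [reflMap, if_neg (not_lt.2 ht.1), if_pos ht.2]

theorem reflMap_of_le (r : ℝ) {t : ℝ} (ht : t ≤ 0) : reflMap r t = -r * t := by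
  rcases ht.eq_or_lt with rfl | ht
  · simp [reflMap]
  · rw [reflMap, if_pos ht]

theorem reflMap_of_ge (r : ℝ) {t : ℝ} (ht : 1 ≤ t) : reflMap r t = 1 + r * (1 - t) := by
  rcases ht.eq_or_lt with rfl | ht
  · rw [reflMap_of_mem r (right_mem_Icc.2 zero_le_one)]; ring
  · rw [reflMap, if_neg (by linarith), if_neg (by linarith)]

theorem abs_reflMap_sub_le {r : ℝ} (h0 : 0 ≤ r) (h1 : r ≤ 1) (s t : ℝ) :
    |reflMap r s - reflMap r t| ≤ |s - t| := by
  wlog hst : s ≤ t generalizing s t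
  · rw [abs_sub_comm, abs_sub_comm s]; exact this t s (le_of_not_ge hst)
  rw [abs_sub_comm s, abs_of_nonneg (sub_nonneg.2 hst), abs_le]
  unfold reflMap
  split_ifs <;> constructor <;> nlinarith

theorem continuous_reflMap {r : ℝ} (h0 : 0 ≤ r) (h1 : r ≤ 1) : Continuous (reflMap r) :=
  (LipschitzWith.of_dist_le_mul (K := 1) fun s t => by
    simpa [Real.dist_eq] using abs_reflMap_sub_le h0 h1 s t).continuous

theorem reflMap_mem {r : ℝ} (h0 : 0 ≤ r) (h1 : r ≤ 1) {t : ℝ} (ht : t ∈ Icc (-1 : ℝ) 2) :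
    reflMap r t ∈ Icc (0 : ℝ) 1 := by
  have := ht.1
  have := ht.2
  unfold reflMap
  split_ifs <;> constructor <;> nlinarith

/-- A preimage has three pieces: a part of the set itself in `[0,1]`, and on either side an affine
copy stretched by `r⁻¹`. -/
theorem map_reflMap_le {r : ℝ} (h0 : 0 < r) (h1 : r ≤ 1) :
    (volume.restrict (Icc (-1 : ℝ) 2)).map (reflMap r)
      ≤ (1 + 2 * r⁻¹).toNNReal • volume.restrict (Icc (0 : ℝ) 1) := by
  refine Measure.le_iff.2 fun s hs => ?_
  rw [Measure.map_apply (continuous_reflMap h0.le h1).measurable hs,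
    Measure.restrict_apply ((continuous_reflMap h0.le h1).measurable hs), Measure.smul_apply,
    Measure.restrict_apply hs]
  have hsub : reflMap r ⁻¹' s ∩ Icc (-1) 2 ⊆ (s ∩ Icc (0 : ℝ) 1) ∪
      (((fun t => -r * t) ⁻¹' (s ∩ Icc (0 : ℝ) 1)) ∪
        ((fun t => -r * t) ⁻¹' ((fun t => (1 + r) + t) ⁻¹' (s ∩ Icc (0 : ℝ) 1)))) := by
    rintro t ⟨ht, htB⟩
    have ht' : reflMap r t ∈ s := ht
    have hm := reflMap_mem h0.le h1 htB
    rcases le_or_gt t 0 with h | h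
    · rw [reflMap_of_le r h] at ht' hm
      exact Or.inr (Or.inl ⟨ht', hm⟩)
    rcases le_or_gt t 1 with h' | h'
    · rw [reflMap_of_mem r ⟨h.le, h'⟩] at ht' hm
      exact Or.inl ⟨ht', hm⟩
    · rw [reflMap_of_ge r h'.le] at ht' hm
      have e : 1 + r * (1 - t) = (1 + r) + -r * t := by ring
      rw [e] at ht' hm
      exact Or.inr (Or.inr ⟨ht', hm⟩)
  refine (measure_mono hsub).trans ((measure_union_le _ _).trans
    ((add_le_add le_rfl (measure_union_le _ _)).trans (le_of_eq ?_)))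
  have hr : -r ≠ 0 := by linarith
  rw [Real.volume_preimage_mul_left hr, Real.volume_preimage_mul_left hr, measure_preimage_add,
    ENNReal.smul_def, smul_eq_mul, inv_neg, abs_neg, abs_of_pos (inv_pos.2 h0)]
  change _ = ENNReal.ofReal (1 + 2 * r⁻¹) * _
  rw [ENNReal.ofReal_add zero_le_one (by positivity), ENNReal.ofReal_mul zero_le_two]
  simp
  ring

/-- The Vandermonde matrix of the distinct nodes `-1/(k+1)` is invertible. These moment conditions
make the derivatives up to order `m` match at the end points. -/
theorem exists_reflection_coefficients (m : ℕ) :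
    ∃ a : Fin (m + 1) → ℝ, ∀ p ≤ m, ∑ k : Fin (m + 1), a k * (-((k : ℝ) + 1)⁻¹) ^ p = 1 := by
  set v : Fin (m + 1) → ℝ := fun k => -((k : ℝ) + 1)⁻¹ with hv
  have hinj : Function.Injective v := fun k l h => by
    simpa [hv, Fin.ext_iff] using h
  have hdet : IsUnit (Matrix.vandermonde v).det :=
    isUnit_iff_ne_zero.2 (Matrix.det_vandermonde_ne_zero_iff.2 hinj)
  refine ⟨Matrix.vecMul (fun _ => 1) (Matrix.vandermonde v)⁻¹, fun p hp => ?_⟩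
  have h1 : Matrix.vecMul (Matrix.vecMul (fun _ => (1 : ℝ)) (Matrix.vandermonde v)⁻¹)
      (Matrix.vandermonde v) = fun _ => 1 := by
    rw [Matrix.vecMul_vecMul, Matrix.nonsing_inv_mul _ hdet, Matrix.vecMul_one]
  have h2 := congrFun h1 ⟨p, Nat.lt_succ_of_le hp⟩
  simpa [Matrix.vecMul, dotProduct, Matrix.vandermonde_apply] using h2

variable {ι K : Type} [Fintype ι] [DecidableEq ι] [Fintype K]

/-- The iterated reflection of `F` across the faces of the unit cube. The weight `(-r)^p` in the
direction `i` accounts for `p` derivatives in that direction. -/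
noncomputable def reflOp (a r : K → ℝ) (p : ℕ) (i : ι) (F : (ι → ℝ) → ℂ) (x : ι → ℝ) : ℂ :=
  ∑ κ : ι → K, ((∏ j, a (κ j)) * (-r (κ i)) ^ p) • F fun j => reflMap (r (κ j)) (x j)

/-- For `p = 0` no direction is distinguished, so one and the same extension can be differentiated
along every coordinate. -/
theorem reflOp_zero_eq (a r : K → ℝ) (i i' : ι) (F : (ι → ℝ) → ℂ) :
    reflOp a r 0 i F = reflOp a r 0 i' F := by
  funext x; simp [reflOp]

/-- If the term does not depend on `κ i`, summation over `κ i` produces only a moment, which is `1`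
for either exponent. This applies where the `i`-th coordinate lies in `[0,1]` and is not moved by
the folding. -/
theorem sum_reflection_weights_eq {a r : K → ℝ} {p q : ℕ} (hp : ∑ k, a k * (-r k) ^ p = 1)
    (hq : ∑ k, a k * (-r k) ^ q = 1) (i : ι) {G : (ι → K) → ℂ}
    (hG : ∀ κ k, G (Function.update κ i k) = G κ) :
    ∑ κ : ι → K, ((∏ j, a (κ j)) * (-r (κ i)) ^ p) • G κ
      = ∑ κ : ι → K, ((∏ j, a (κ j)) * (-r (κ i)) ^ q) • G κ := by
  classical
  rcases isEmpty_or_nonempty K with hK | ⟨⟨k₀⟩⟩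
  · simp at hp
  have key : ∀ q, ∑ k, a k * (-r k) ^ q = 1 →
      ∑ κ : ι → K, ((∏ j, a (κ j)) * (-r (κ i)) ^ q) • G κ
        = ∑ ρ : {j // j ≠ i} → K, (∏ j, a (ρ j)) • G ((Equiv.funSplitAt i K).symm (k₀, ρ)) := by
    intro q hq
    rw [← (Equiv.funSplitAt i K).symm.sum_comp, Fintype.sum_prod_type, Finset.sum_comm]
    refine Finset.sum_congr rfl fun ρ _ => ?_
    have h1 : ∀ k, ((Equiv.funSplitAt i K).symm (k, ρ)) i = k := fun k => by simp
    have h2 : ∀ k (j : {j // j ≠ i}), ((Equiv.funSplitAt i K).symm (k, ρ)) j = ρ j := fun k j => by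
      simp [j.2]
    have h3 : ∀ k, G ((Equiv.funSplitAt i K).symm (k, ρ))
        = G ((Equiv.funSplitAt i K).symm (k₀, ρ)) := fun k => by
      rw [← hG ((Equiv.funSplitAt i K).symm (k, ρ)) k₀]
      congr 1
      funext j
      by_cases hj : j = i
      · subst hj; simp
      · simp [hj]
    have h4 : ∀ k, ∏ j, a ((Equiv.funSplitAt i K).symm (k, ρ) j) = a k * ∏ j, a (ρ j) := fun k => by
      rw [Fintype.prod_eq_mul_prod_subtype_ne _ i, h1]
      simp only [h2]
    simp only [h1, h3, h4]
    rw [← Finset.sum_smul]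
    congr 1
    calc _ = (∑ k, a k * (-r k) ^ q) * ∏ j, a (ρ j) := by
          rw [Finset.sum_mul]; exact Finset.sum_congr rfl fun k _ => by ring
      _ = _ := by rw [hq, one_mul]
  rw [key p hp, key q hq]

theorem reflOp_zero_of_mem {a : K → ℝ} (ha : ∑ k, a k = 1) (r : K → ℝ) (i : ι)
    (F : (ι → ℝ) → ℂ) {x : ι → ℝ} (hx : ∀ j, x j ∈ Icc (0 : ℝ) 1) : reflOp a r 0 i F x = F x := by
  classical
  have h1 : ∀ κ : ι → K, (fun j => reflMap (r (κ j)) (x j)) = x := fun κ =>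
    funext fun j => reflMap_of_mem _ (hx j)
  have h2 : ∑ κ : ι → K, ∏ j, a (κ j) = 1 := by
    have := Finset.prod_univ_sum (fun _ : ι => (Finset.univ : Finset K)) (fun _ k => a k)
    rw [Fintype.piFinset_univ] at this
    rw [← this]
    simp [ha]
  simp only [reflOp, h1, pow_zero, mul_one]
  rw [← Finset.sum_smul, h2, one_smul]

theorem continuous_reflOp (a : K → ℝ) {r : K → ℝ} (h0 : ∀ k, 0 < r k) (h1 : ∀ k, r k ≤ 1) (p : ℕ)
    (i : ι) {F : (ι → ℝ) → ℂ} (hF : Continuous F) : Continuous (reflOp a r p i F) := by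
  refine continuous_finsetSum _ fun κ _ => (hF.comp (continuous_pi fun j => ?_)).fun_const_smul _
  exact (continuous_reflMap (h0 _).le (h1 _)).comp (continuous_apply j)

theorem measurable_reflOp (a : K → ℝ) {r : K → ℝ} (h0 : ∀ k, 0 < r k) (h1 : ∀ k, r k ≤ 1) (p : ℕ)
    (i : ι) {F : (ι → ℝ) → ℂ} (hF : Measurable F) : Measurable (reflOp a r p i F) := by
  refine Finset.measurable_fun_sum _ fun κ _ => (hF.comp (measurable_pi_lambda _ fun j => ?_)).fun_const_smul _
  exact (continuous_reflMap (h0 _).le (h1 _)).measurable.comp (measurable_pi_apply j)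

/-- Reflection commutes with differentiation, up to the change of weight. -/
theorem hasDerivAt_reflOp {a r : K → ℝ} {p : ℕ} (hp : ∑ k, a k * (-r k) ^ p = 1)
    (hp' : ∑ k, a k * (-r k) ^ (p + 1) = 1) (i : ι) {f : (ι → ℝ) → ℂ} (hf : ContDiff ℝ ∞ f)
    (x : ι → ℝ) (t : ℝ) :
    HasDerivAt (fun t => reflOp a r p i f (Function.update x i t))
      (reflOp a r (p + 1) i (pderivC i f) (Function.update x i t)) t := by
  have hupd : ∀ (κ : ι → K) (t : ℝ), (fun j => reflMap (r (κ j)) (Function.update x i t j))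
      = Function.update (fun j => reflMap (r (κ j)) (x j)) i (reflMap (r (κ i)) t) := fun κ t => by
    funext j
    by_cases hj : j = i
    · subst hj; simp
    · simp [hj]
  -- On a set where all foldings are affine in `t`, the chain rule gives the derivative within that
  -- set; `d k` is the slope of the folding with dilation `r k`.
  have hterm : ∀ {S : Set ℝ} {c d : K → ℝ}, (∀ k, ∀ t ∈ S, reflMap (r k) t = c k + d k * t) →
      t ∈ S → HasDerivWithinAt (fun t => reflOp a r p i f (Function.update x i t))
        (∑ κ : ι → K, ((∏ j, a (κ j)) * (-r (κ i)) ^ p) • (d (κ i) • pderivC i f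
          fun j => reflMap (r (κ j)) (Function.update x i t j))) S t := by
    intro S c d hS ht
    refine HasDerivWithinAt.fun_sum fun κ _ => HasDerivWithinAt.fun_const_smul _ ?_
    rw [hupd, hS _ t ht]
    have h1 : HasDerivAt (fun t => c (κ i) + d (κ i) * t) (d (κ i)) t := by
      simpa using ((hasDerivAt_id t).const_mul (d (κ i))).const_add (c (κ i))
    have h2 := (hasDerivAt_comp_update hf i (fun j => reflMap (r (κ j)) (x j))
      (c (κ i) + d (κ i) * t)).scomp t h1
    refine h2.hasDerivWithinAt.congr (fun s hs => ?_) ?_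
    · simp only [Function.comp_apply]; rw [hupd, hS _ s hs]
    · simp only [Function.comp_apply]; rw [hupd, hS _ t ht]
  -- Outside the interval the slope is `-r k`, which raises the exponent of the weight from `p` to
  -- `p + 1`. A point off the closed set `S` satisfies the claim vacuously.
  have hout : ∀ {S : Set ℝ} {c : K → ℝ}, IsClosed S →
      (∀ k, ∀ t ∈ S, reflMap (r k) t = c k + -r k * t) →
      HasDerivWithinAt (fun t => reflOp a r p i f (Function.update x i t))
        (reflOp a r (p + 1) i (pderivC i f) (Function.update x i t)) S t := by
    intro S c hSc hS
    by_cases ht : t ∈ S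
    · convert hterm hS ht using 1
      refine Finset.sum_congr rfl fun κ _ => ?_
      rw [smul_smul, pow_succ, mul_assoc]
    · exact HasFDerivWithinAt.of_notMem_closure (by rwa [hSc.closure_eq])
  -- Inside the interval the slope is `1`, and the weight of exponent `p` may be replaced by that of
  -- exponent `p + 1` by the moment conditions.
  have hin : HasDerivWithinAt (fun t => reflOp a r p i f (Function.update x i t))
        (reflOp a r (p + 1) i (pderivC i f) (Function.update x i t)) (Icc 0 1) t := by
    by_cases ht : t ∈ Icc (0 : ℝ) 1
    · convert hterm (S := Icc (0 : ℝ) 1) (c := fun _ => 0) (d := fun _ => 1)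
        (fun k s hs => by rw [reflMap_of_mem _ hs]; ring) ht using 1
      simp only [one_smul]
      refine sum_reflection_weights_eq hp' hp i fun κ k => ?_
      congr 1
      funext j
      by_cases hj : j = i
      · subst hj; simp [reflMap_of_mem _ ht]
      · simp [hj]
    · exact HasFDerivWithinAt.of_notMem_closure (by rwa [isClosed_Icc.closure_eq])
  have hleft := hout (S := Iic 0) (c := fun _ => 0) isClosed_Iic fun k s hs => by
    rw [reflMap_of_le _ hs]; ring
  have hright := hout (S := Ici 1) (c := fun k => 1 + r k) isClosed_Ici fun k s hs => by
    rw [reflMap_of_ge _ hs]; ring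
  -- The three closed pieces cover the line and yield the same derivative at the points `0` and `1`,
  -- so it is a two-sided derivative.
  have hall := (hleft.union hin).union hright
  rwa [Iic_union_Icc_eq_Iic zero_le_one, Iic_union_Ici, hasDerivWithinAt_univ] at hall

theorem enorm_sum_sq_le {α : Type*} (s : Finset α) (f : α → ℂ) :
    ‖∑ x ∈ s, f x‖ₑ ^ 2 ≤ s.card * ∑ x ∈ s, ‖f x‖ₑ ^ 2 := by
  have h1 : ‖∑ x ∈ s, f x‖₊ ≤ ∑ x ∈ s, ‖f x‖₊ := nnnorm_sum_le _ _
  have h2 := (pow_le_pow_left' h1 2).trans (sq_sum_le_card_mul_sum_sq (s := s) (f := fun x => ‖f x‖₊))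
  simp only [enorm_eq_nnnorm]
  exact_mod_cast h2

theorem measurable_comp_coord {θ : ι → ℝ → ℝ} (hθ : ∀ i, Measurable (θ i)) {v : (ι → ℝ) → ℂ}
    (hv : Measurable v) : Measurable fun x : ι → ℝ => v fun j => θ j (x j) :=
  hv.comp (measurable_pi_lambda _ fun j => (hθ j).comp (measurable_pi_apply j))

theorem dirVal_comp_le {μ ν : Measure ℝ} [SigmaFinite μ] [SigmaFinite ν] {θ : ι → ℝ → ℝ}
    (hθ : ∀ i, Measurable (θ i)) {c : ℝ≥0} (h : ∀ i, μ.map (θ i) ≤ c • ν) (hc : 1 ≤ c)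
    (hL : ∀ i s t, |θ i s - θ i t| ≤ |s - t|) {σ : ℝ} (hσ : 0 ≤ σ) (i : ι)
    {v : (ι → ℝ) → ℂ} (hv : Measurable v) :
    dirVal μ σ i (fun x => v fun j => θ j (x j))
      ≤ (c : ℝ≥0∞) ^ (Fintype.card ι + 1) * dirVal ν σ i v := by
  unfold dirVal
  split_ifs
  · refine (lintegral_sq_comp_le hθ h hv).trans (mul_le_mul_left ?_ _)
    exact pow_le_pow_right₀ (by exact_mod_cast hc) (Nat.le_succ _)
  · exact dirGag_comp_le hθ h hL hσ i hv

theorem dirVal_sum_le {A : Type*} [Fintype A] {μ : Measure ℝ} [SigmaFinite μ] (σ : ℝ) (i : ι)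
    (c : A → ℝ) {F : A → (ι → ℝ) → ℂ} (hF : ∀ k, Measurable (F k)) :
    dirVal μ σ i (fun x => ∑ k, c k • F k x)
      ≤ Fintype.card A * ∑ k, ‖c k‖ₑ ^ 2 * dirVal μ σ i (F k) := by
  have hc : ∀ k, ‖c k‖ₑ ^ 2 ≠ ⊤ := fun k => ENNReal.pow_ne_top enorm_ne_top
  unfold dirVal
  split_ifs
  · have h1 : ∀ x, ‖∑ k, c k • F k x‖ₑ ^ 2 ≤ Fintype.card A * ∑ k, ‖c k‖ₑ ^ 2 * ‖F k x‖ₑ ^ 2 :=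
      fun x => by
        refine (enorm_sum_sq_le _ _).trans (le_of_eq ?_)
        simp only [enorm_smul, mul_pow, Finset.card_univ]
    refine (lintegral_mono h1).trans ?_
    rw [lintegral_const_mul' _ _ (by simp), lintegral_finsetSum _ fun k _ =>
      ((hF k).enorm.pow_const 2).const_mul _]
    simp only [lintegral_const_mul' _ _ (hc _)]
    exact le_rfl
  · unfold dirGag
    obtain ⟨G, hG⟩ : ∃ G : A → (ι → ℝ) → ℝ → ℝ≥0∞, ∀ k x t, G k x t =
        ‖F k x - F k (Function.update x i t)‖ₑ ^ 2 / ‖x i - t‖ₑ ^ (1 + 2 * σ) :=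
      ⟨_, fun _ _ _ => rfl⟩
    have hGm : ∀ k, Measurable (Function.uncurry (G k)) := fun k => by
      have : Function.uncurry (G k) = _ := funext fun q => hG k q.1 q.2
      rw [this]
      exact measurable_dirGag_integrand (hF k) σ i
    have h1 : ∀ x t, ‖∑ k, c k • F k x - ∑ k, c k • F k (Function.update x i t)‖ₑ ^ 2
        / ‖x i - t‖ₑ ^ (1 + 2 * σ) ≤ Fintype.card A * ∑ k, ‖c k‖ₑ ^ 2 * G k x t := fun x t => by
        rw [← Finset.sum_sub_distrib]
        simp only [← smul_sub, hG, div_eq_mul_inv, ← mul_assoc]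
        rw [← Finset.sum_mul, ← mul_assoc]
        refine mul_le_mul_left ((enorm_sum_sq_le _ _).trans (le_of_eq ?_)) _
        simp only [enorm_smul, mul_pow, Finset.card_univ]
    refine (lintegral_mono fun x => lintegral_mono (h1 x)).trans ?_
    have h4 : ∀ x, ∫⁻ t, Fintype.card A * ∑ k, ‖c k‖ₑ ^ 2 * G k x t ∂μ
        = Fintype.card A * ∑ k, ‖c k‖ₑ ^ 2 * ∫⁻ t, G k x t ∂μ := fun x => by
      rw [lintegral_const_mul' _ _ (by simp), lintegral_finsetSum _ fun k _ =>
        (hGm k).of_uncurry_left.const_mul _]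
      simp only [lintegral_const_mul' _ _ (hc _)]
    simp only [h4, ← hG]
    rw [lintegral_const_mul' _ _ (by simp), lintegral_finsetSum _ fun k _ =>
      ((hGm k).lintegral_prod_right (ν := μ)).const_mul _]
    simp only [lintegral_const_mul' _ _ (hc _)]
    exact le_rfl

/-- Reflection is bounded for the `L²` norm and for the Gagliardo seminorms. -/
theorem exists_dirVal_reflOp_le (a : K → ℝ) {r : K → ℝ} (h0 : ∀ k, 0 < r k) (h1 : ∀ k, r k ≤ 1)
    (p : ℕ) (i i' : ι) {σ : ℝ} (hσ : 0 ≤ σ) :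
    ∃ C : ℝ≥0, ∀ F : (ι → ℝ) → ℂ, Measurable F →
      dirVal (volume.restrict (Icc (-1) 2)) σ i' (reflOp a r p i F)
        ≤ C * dirVal (volume.restrict (Icc 0 1)) σ i' F := by
  -- One constant dominates the pushforward bounds of all dilations. The summand `1` gives `c ≥ 1`,
  -- so that the `L²` case can use the larger power needed for the Gagliardo case.
  obtain ⟨c, hc⟩ : ∃ c : ℝ≥0, c = ∑ k, (1 + 2 * (r k)⁻¹).toNNReal + 1 := ⟨_, rfl⟩
  have hc1 : 1 ≤ c := hc ▸ le_add_self
  have hθ : ∀ k, Measurable (reflMap (r k)) := fun k => (continuous_reflMap (h0 k).le (h1 k)).measurable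
  have hmap : ∀ k, (volume.restrict (Icc (-1 : ℝ) 2)).map (reflMap (r k))
      ≤ c • volume.restrict (Icc (0 : ℝ) 1) := fun k => by
    refine (map_reflMap_le (h0 k) (h1 k)).trans (Measure.le_iff.2 fun s _ => ?_)
    rw [Measure.smul_apply, Measure.smul_apply, ENNReal.smul_def, ENNReal.smul_def, smul_eq_mul,
      smul_eq_mul]
    refine mul_le_mul_left ?_ _
    have : (1 + 2 * (r k)⁻¹).toNNReal ≤ ∑ k, (1 + 2 * (r k)⁻¹).toNNReal :=
      Finset.single_le_sum (f := fun k => (1 + 2 * (r k)⁻¹).toNNReal) (fun _ _ => zero_le)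
        (Finset.mem_univ k)
    rw [hc]
    exact_mod_cast this.trans le_self_add
  have hκ : ∀ (κ : ι → K) (F : (ι → ℝ) → ℂ), Measurable F →
      dirVal (volume.restrict (Icc (-1) 2)) σ i' (fun x => F fun j => reflMap (r (κ j)) (x j))
        ≤ (c : ℝ≥0∞) ^ (Fintype.card ι + 1) * dirVal (volume.restrict (Icc 0 1)) σ i' F :=
    fun κ F hF => dirVal_comp_le (θ := fun j => reflMap (r (κ j))) (fun j => hθ (κ j))
      (fun j => hmap (κ j)) hc1 (fun j => abs_reflMap_sub_le (h0 _).le (h1 _)) hσ i' hF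
  refine ⟨Fintype.card (ι → K) * ∑ κ : ι → K, ‖(∏ j, a (κ j)) * (-r (κ i)) ^ p‖₊ ^ 2 *
    c ^ (Fintype.card ι + 1), fun F hF => ?_⟩
  have h2 := dirVal_sum_le (A := ι → K) (μ := volume.restrict (Icc (-1) 2)) σ i'
    (fun κ => (∏ j, a (κ j)) * (-r (κ i)) ^ p)
    (F := fun κ x => F fun j => reflMap (r (κ j)) (x j))
    (fun κ => measurable_comp_coord (fun j => hθ (κ j)) hF)
  refine h2.trans ?_
  rw [ENNReal.coe_mul, ENNReal.ofNNReal_finsetSum, mul_assoc, Finset.sum_mul, ENNReal.coe_natCast]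
  refine mul_le_mul_right (Finset.sum_le_sum fun κ _ => ?_) _
  rw [ENNReal.coe_mul, ENNReal.coe_pow, ENNReal.coe_pow, mul_assoc]
  exact mul_le_mul_right (hκ κ F hF) _

end Reflection

/-! ### Multiplication of Gagliardo seminorms by a cutoff -/

section Cutoff

variable {ι : Type} [Fintype ι] [DecidableEq ι]

/-- Multiplication by a Lipschitz cutoff function maps local Gagliardo seminorms to global ones. -/
theorem exists_dirGag_cutoff_le {J : Set ℝ} (hJ : MeasurableSet J) {χ : (ι → ℝ) → ℝ} 
    (hχm : Measurable χ) {M L : ℝ≥0} (hM : ∀ x, ‖χ x‖ₑ ≤ M) {i : ι}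
    (hL : ∀ x t, ‖χ x - χ (Function.update x i t)‖ₑ ≤ L * ‖x i - t‖ₑ)
    (hs : ∀ x, (¬ ∀ j, x j ∈ J) → χ x = 0) {σ : ℝ} (hσ : 0 < σ) (hσ1 : σ < 1) :
    ∃ C : ℝ≥0, ∀ F : (ι → ℝ) → ℂ, Measurable F →
      dirGag volume σ i (fun x => χ x • F x)
        ≤ C * ((∫⁻ x, ‖F x‖ₑ ^ 2 ∂(Measure.pi fun _ => volume.restrict J))
          + dirGag (volume.restrict J) σ i F) := by
  set K := ∫⁻ h : ℝ, min 1 (‖h‖ₑ ^ 2) / ‖h‖ₑ ^ (1 + 2 * σ) with hK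
  have hKt : K ≠ ⊤ := lintegral_min_kernel_ne_top hσ hσ1
  set A : ℝ≥0 := (2 * M + L) ^ 2 with hA
  set B : Set (ι → ℝ) := univ.pi fun _ => J with hB
  have hBm : MeasurableSet B := MeasurableSet.univ_pi fun _ => hJ
  have hBrest : ∀ f : (ι → ℝ) → ℝ≥0∞, ∫⁻ x, B.indicator f x ∂(Measure.pi fun _ => volume)
      = ∫⁻ x, f x ∂(Measure.pi fun _ => volume.restrict J) := fun f => by
    rw [lintegral_indicator hBm, hB, Measure.restrict_pi_pi]
  have hχ0 : ∀ x, x ∉ B → χ x = 0 := fun x hx => hs x (by simpa [hB] using hx)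
  -- A bounded Lipschitz function has differences of size at most a constant times `min 1 |x i -
  -- t|`, and with this numerator the kernel is integrable over the whole line.
  have hdiff : ∀ x t, ‖χ x - χ (Function.update x i t)‖ₑ ^ 2 / ‖x i - t‖ₑ ^ (1 + 2 * σ)
      ≤ A * (min 1 (‖x i - t‖ₑ ^ 2) / ‖x i - t‖ₑ ^ (1 + 2 * σ)) := fun x t => by
    rw [← mul_div_assoc]
    refine ENNReal.div_le_div_right ?_ _
    have h1 : ‖χ x - χ (Function.update x i t)‖ₑ ≤ (2 * M + L : ℝ≥0) := by
      refine (enorm_sub_le).trans ((add_le_add (hM _) (hM _)).trans ?_)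
      rw [← two_mul]; push_cast; exact le_self_add
    have h2 : ‖χ x - χ (Function.update x i t)‖ₑ ≤ (2 * M + L : ℝ≥0) * ‖x i - t‖ₑ :=
      (hL x t).trans (mul_le_mul_left (by push_cast; exact le_add_self) _)
    rcases le_total 1 (‖x i - t‖ₑ ^ 2) with h | h
    · rw [min_eq_left h, mul_one, hA, ENNReal.coe_pow]; gcongr
    · rw [min_eq_right h, hA, ENNReal.coe_pow, ← mul_pow]; gcongr
  refine ⟨4 * (M ^ 2 + A * K.toNNReal), fun F hF => ?_⟩
  set D : (ι → ℝ) → ℝ → ℝ≥0∞ := fun x t =>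
    ‖F x - F (Function.update x i t)‖ₑ ^ 2 / ‖x i - t‖ₑ ^ (1 + 2 * σ) with hD
  have hDm : Measurable (Function.uncurry D) := measurable_dirGag_integrand hF σ i
  set X : (ι → ℝ) → ℝ → ℝ≥0∞ := fun x t =>
    ‖χ x - χ (Function.update x i t)‖ₑ ^ 2 / ‖x i - t‖ₑ ^ (1 + 2 * σ) with hX
  have hu : Measurable fun q : (ι → ℝ) × ℝ => Function.update q.1 i q.2 :=
    measurable_update' (a := i)
  have hXm : Measurable (Function.uncurry X) :=
    (((hχm.comp measurable_fst).sub (hχm.comp hu)).enorm.pow_const 2).div (by fun_prop)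
  -- The bound attached to the first of the two points, present only if it lies in the box. The
  -- difference of `F` is charged only when the second point also lies there; the difference of the
  -- cutoff is charged against `F` at the first point.
  set G : (ι → ℝ) → ℝ → ℝ≥0∞ := fun x t =>
    B.indicator (fun x => J.indicator (fun t => M ^ 2 * D x t) t + ‖F x‖ₑ ^ 2 * X x t) x with hG
  have hGm : Measurable (Function.uncurry G) := by
    have e : Function.uncurry G = (B ×ˢ univ).indicator fun q =>
        (univ ×ˢ J).indicator (fun q => M ^ 2 * D q.1 q.2) q + ‖F q.1‖ₑ ^ 2 * X q.1 q.2 := by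
      funext q
      by_cases h1 : q.1 ∈ B <;> by_cases h2 : q.2 ∈ J <;>
        simp [hG, Function.uncurry, h1, h2, Set.indicator]
    rw [e]
    refine Measurable.indicator (Measurable.add (Measurable.indicator (hDm.const_mul _)
      (MeasurableSet.univ.prod hJ)) (Measurable.fun_mul ?_ hXm)) (hBm.prod MeasurableSet.univ)
    exact (hF.comp measurable_fst).enorm.pow_const 2
  have hpt : ∀ x t, ‖χ x • F x - χ (Function.update x i t) • F (Function.update x i t)‖ₑ ^ 2
      / ‖x i - t‖ₑ ^ (1 + 2 * σ) ≤ 2 * G x t + 2 * G (Function.update x i t) (x i) := by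
    intro x t
    set y := Function.update x i t with hy
    have hyt : y i = t := by simp [hy]
    have hyx : Function.update y i (x i) = x := by simp [hy]
    have hXy : ‖F y‖ₑ ^ 2 * X y (x i)
        = ‖F y‖ₑ ^ 2 * ‖χ x - χ y‖ₑ ^ 2 / ‖x i - t‖ₑ ^ (1 + 2 * σ) := by
      simp only [hX, hyx, hyt]
      rw [enorm_sub_rev, enorm_sub_rev t, mul_div_assoc]
    have hXx : ‖F x‖ₑ ^ 2 * X x t
        = ‖F x‖ₑ ^ 2 * ‖χ x - χ y‖ₑ ^ 2 / ‖x i - t‖ₑ ^ (1 + 2 * σ) := by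
      simp only [hX]
      rw [mul_div_assoc]
    have hGx : x ∈ B → ‖F x‖ₑ ^ 2 * X x t ≤ G x t := fun h => by
      simp only [hG, Set.indicator_of_mem h]; exact le_add_self
    have hGy : y ∈ B → ‖F y‖ₑ ^ 2 * X y (x i) ≤ G y (x i) := fun h => by
      simp only [hG, Set.indicator_of_mem h]; exact le_add_self
    have htwo : ∀ a : ℝ≥0∞, a ≤ 2 * a := fun a => le_mul_of_one_le_left' (by norm_num)
    -- With both points in the box the difference is split as for a product. With one point in the
    -- box the cutoff vanishes at the other, and only the difference of the cutoff times `F` at the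
    -- inner point remains.
    by_cases h1 : x ∈ B <;> by_cases h2 : y ∈ B
    · have htJ : t ∈ J := hyt ▸ h2 i (mem_univ i)
      have h3 := enorm_sub_sq_le (χ x • F x) (χ x • F y) (χ y • F y)
      have h4 : ‖χ x • F x - χ x • F y‖ₑ ^ 2 ≤ M ^ 2 * ‖F x - F y‖ₑ ^ 2 := by
        rw [← smul_sub, enorm_smul, mul_pow]; gcongr; exact hM x
      have h5 : ‖χ x • F y - χ y • F y‖ₑ ^ 2 = ‖F y‖ₑ ^ 2 * ‖χ x - χ y‖ₑ ^ 2 := by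
        rw [← sub_smul, enorm_smul, mul_pow, mul_comm]
      calc _ ≤ 2 * (M ^ 2 * ‖F x - F y‖ₑ ^ 2 + ‖F y‖ₑ ^ 2 * ‖χ x - χ y‖ₑ ^ 2)
            / ‖x i - t‖ₑ ^ (1 + 2 * σ) := by
              refine ENNReal.div_le_div_right (h3.trans ?_) _
              rw [h5]; gcongr
        _ = 2 * (M ^ 2 * D x t) + 2 * (‖F y‖ₑ ^ 2 * X y (x i)) := by
              rw [hXy]
              simp only [hD, div_eq_mul_inv]
              ring
        _ ≤ _ := by
              gcongr
              · simp only [hG, Set.indicator_of_mem h1, Set.indicator_of_mem htJ]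
                exact le_self_add
              · exact hGy h2
    · rw [hχ0 y h2, zero_smul, sub_zero]
      calc _ = ‖F x‖ₑ ^ 2 * X x t := by
            rw [hXx, hχ0 y h2, sub_zero, enorm_smul, mul_pow, mul_comm (‖F x‖ₑ ^ 2)]
        _ ≤ 2 * G x t := (hGx h1).trans (htwo _)
        _ ≤ _ := le_self_add
    · rw [hχ0 x h1, zero_smul, zero_sub, enorm_neg]
      calc _ = ‖F y‖ₑ ^ 2 * X y (x i) := by
            rw [hXy, hχ0 x h1, zero_sub, enorm_neg, enorm_smul, mul_pow, mul_comm (‖F y‖ₑ ^ 2)]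
        _ ≤ 2 * G y (x i) := (hGy h2).trans (htwo _)
        _ ≤ _ := le_add_self
    · rw [hχ0 x h1, hχ0 y h2]; simp
  have h1 := lintegral_le_four_mul_of_exchange (μ := volume) i hGm
    (Filter.Eventually.of_forall fun x => Filter.Eventually.of_forall fun t => hpt x t)
  refine h1.trans ?_
  have hin : ∀ x, ∫⁻ t, G x t = B.indicator (fun x => (M ^ 2 * ∫⁻ t in J, D x t)
      + ‖F x‖ₑ ^ 2 * ∫⁻ t, X x t) x := fun x => by
    by_cases hx : x ∈ B
    · simp only [hG, Set.indicator_of_mem hx]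
      rw [lintegral_add_left ((hDm.of_uncurry_left.const_mul _).indicator hJ),
        lintegral_indicator hJ, lintegral_const_mul _ hDm.of_uncurry_left,
        lintegral_const_mul _ hXm.of_uncurry_left]
    · simp [hG, hx]
  have hXle : ∀ x, ∫⁻ t, X x t ≤ A * K := fun x => by
    calc ∫⁻ t, X x t ≤ ∫⁻ t, A * (min 1 (‖x i - t‖ₑ ^ 2) / ‖x i - t‖ₑ ^ (1 + 2 * σ)) :=
          lintegral_mono (hdiff x)
      _ = A * ∫⁻ t, min 1 (‖x i - t‖ₑ ^ 2) / ‖x i - t‖ₑ ^ (1 + 2 * σ) :=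
          lintegral_const_mul' _ _ ENNReal.coe_ne_top
      _ = A * K := by
          rw [lintegral_sub_left_eq_self (μ := volume)
            (fun h : ℝ => min 1 (‖h‖ₑ ^ 2) / ‖h‖ₑ ^ (1 + 2 * σ))]
  simp only [hin]
  rw [hBrest, lintegral_add_left (hDm.lintegral_prod_right.const_mul _),
    lintegral_const_mul _ hDm.lintegral_prod_right]
  have h2 : ∫⁻ x, ‖F x‖ₑ ^ 2 * ∫⁻ t, X x t ∂volume ∂(Measure.pi fun _ => volume.restrict J)
      ≤ A * K * ∫⁻ x, ‖F x‖ₑ ^ 2 ∂(Measure.pi fun _ => volume.restrict J) := by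
    rw [← lintegral_const_mul' _ _ (ENNReal.mul_ne_top ENNReal.coe_ne_top hKt)]
    refine lintegral_mono fun x => ?_
    rw [mul_comm]
    exact mul_le_mul_left (hXle x) _
  push_cast
  rw [ENNReal.coe_toNNReal hKt, mul_assoc]
  refine mul_le_mul_right ?_ _
  change M ^ 2 * dirGag (volume.restrict J) σ i F + _ ≤ _
  calc _ ≤ M ^ 2 * dirGag (volume.restrict J) σ i F
        + A * K * ∫⁻ x, ‖F x‖ₑ ^ 2 ∂(Measure.pi fun _ => volume.restrict J) := by gcongr
    _ ≤ (M ^ 2 + A * K) * dirGag (volume.restrict J) σ i F + (M ^ 2 + A * K)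
        * ∫⁻ x, ‖F x‖ₑ ^ 2 ∂(Measure.pi fun _ => volume.restrict J) := by
        gcongr
        · exact le_self_add
        · exact le_add_self
    _ = _ := by rw [← mul_add, add_comm (dirGag _ _ _ _)]

end Cutoff

/-! ### Fourier decay of localized functions, one derivative at a time -/

section CutoffFourier

variable {ι : Type} [Fintype ι] [DecidableEq ι]

/-- A smooth function supported in the cube `[-1,2]^ι`. -/
structure IsCutoff (χ : EuclideanSpace ℝ ι → ℝ) : Prop where
  contDiff : ContDiff ℝ ∞ χ
  hasCompactSupport : HasCompactSupport χ
  mem_of_mem_tsupport : ∀ x ∈ tsupport χ, ∀ i, x i ∈ Icc (-1 : ℝ) 2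

theorem IsCutoff.partialD {χ : EuclideanSpace ℝ ι → ℝ} (hχ : IsCutoff χ) (i : ι) :
    IsCutoff (partialD i χ) :=
  ⟨contDiff_partialD hχ.contDiff i, hχ.hasCompactSupport.fderiv_apply ℝ _, fun x hx =>
    hχ.mem_of_mem_tsupport x (tsupport_fderiv_apply_subset ℝ _ hx)⟩

/-- The product of a cutoff function and a function in coordinates. -/
noncomputable def cutoffMul (χ : EuclideanSpace ℝ ι → ℝ) (F : (ι → ℝ) → ℂ) :
    EuclideanSpace ℝ ι → ℂ :=
  fun x => χ x • F x.ofLp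

theorem IsCutoff.hasCompactSupport_mul {χ : EuclideanSpace ℝ ι → ℝ} (hχ : IsCutoff χ)
    (F : (ι → ℝ) → ℂ) : HasCompactSupport (cutoffMul χ F) :=
  hχ.hasCompactSupport.smul_right

theorem IsCutoff.measurable_mul {χ : EuclideanSpace ℝ ι → ℝ} (hχ : IsCutoff χ)
    {F : (ι → ℝ) → ℂ} (hF : Measurable F) : Measurable (cutoffMul χ F) :=
  hχ.contDiff.continuous.measurable.smul
    (hF.comp (MeasurableEquiv.toLp 2 (ι → ℝ)).symm.measurable)

theorem IsCutoff.continuous_mul {χ : EuclideanSpace ℝ ι → ℝ} (hχ : IsCutoff χ)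
    {F : (ι → ℝ) → ℂ} (hF : Continuous F) : Continuous (cutoffMul χ F) :=
  hχ.contDiff.continuous.smul (hF.comp (PiLp.continuous_ofLp 2 _))

theorem IsCutoff.eq_zero {χ : EuclideanSpace ℝ ι → ℝ} (hχ : IsCutoff χ) {x : EuclideanSpace ℝ ι}
    (hx : ¬ ∀ i, x i ∈ Icc (-1 : ℝ) 2) : χ x = 0 :=
  image_eq_zero_of_notMem_tsupport fun h => hx (hχ.mem_of_mem_tsupport x h)

theorem IsCutoff.exists_lintegral_sq_le {χ : EuclideanSpace ℝ ι → ℝ} (hχ : IsCutoff χ) :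
    ∃ C : ℝ≥0, ∀ F : (ι → ℝ) → ℂ, ∫⁻ x, ‖cutoffMul χ F x‖ₑ ^ 2
      ≤ C * ∫⁻ x, ‖F x‖ₑ ^ 2 ∂(Measure.pi fun _ => volume.restrict (Icc (-1 : ℝ) 2)) := by
  obtain ⟨M, hM⟩ := exists_enorm_le_of_hasCompactSupport hχ.contDiff.continuous
    hχ.hasCompactSupport
  refine ⟨M ^ 2, fun F => ?_⟩
  rw [← lintegral_euclidean, ← lintegral_const_mul' _ _ ENNReal.coe_ne_top,
    ← Measure.restrict_pi_pi, ← lintegral_indicator (MeasurableSet.univ_pi fun _ => measurableSet_Icc)]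
  refine lintegral_mono fun x => ?_
  by_cases hx : x ∈ univ.pi fun _ : ι => Icc (-1 : ℝ) 2
  · rw [Set.indicator_of_mem hx, cutoffMul, enorm_smul, mul_pow, ENNReal.coe_pow]
    gcongr
    exact hM _
  · rw [cutoffMul, hχ.eq_zero (x := WithLp.toLp 2 x) fun h => hx fun j _ => h j]
    simp

theorem IsCutoff.memLp_mul {χ : EuclideanSpace ℝ ι → ℝ} (hχ : IsCutoff χ) {F : (ι → ℝ) → ℂ}
    (hF : Continuous F) : MemLp (cutoffMul χ F) 2 volume :=
  (hχ.continuous_mul hF).memLp_of_hasCompactSupport (hχ.hasCompactSupport_mul F)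

theorem IsCutoff.exists_dirGag_le {χ : EuclideanSpace ℝ ι → ℝ} (hχ : IsCutoff χ) (i : ι) {σ : ℝ}
    (hσ : 0 < σ) (hσ1 : σ < 1) :
    ∃ C : ℝ≥0, ∀ F : (ι → ℝ) → ℂ, Measurable F →
      dirGag volume σ i (fun x => cutoffMul χ F (WithLp.toLp 2 x))
        ≤ C * ((∫⁻ x, ‖F x‖ₑ ^ 2 ∂(Measure.pi fun _ => volume.restrict (Icc (-1 : ℝ) 2)))
          + dirGag (volume.restrict (Icc (-1 : ℝ) 2)) σ i F) := by
  obtain ⟨M, hM⟩ := exists_enorm_le_of_hasCompactSupport hχ.contDiff.continuous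
    hχ.hasCompactSupport
  obtain ⟨L, hL⟩ := hχ.contDiff.lipschitzWith_of_hasCompactSupport hχ.hasCompactSupport (by simp)
  refine exists_dirGag_cutoff_le (χ := fun x => χ (WithLp.toLp 2 x)) measurableSet_Icc
    (hχ.contDiff.continuous.comp (PiLp.continuous_toLp 2 _)).measurable (L := L)
    (fun x => hM _) (fun x t => ?_) (fun x hx => hχ.eq_zero (by simpa using hx)) hσ hσ1
  have h1 := hL (WithLp.toLp 2 x) (WithLp.toLp 2 (Function.update x i t))
  rw [edist_eq_enorm_sub, edist_eq_enorm_sub, toLp_update, sub_add_cancel_left, enorm_neg,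
    enorm_smul, enorm_sub_rev t] at h1
  have h2 : ‖(EuclideanSpace.single i (1 : ℝ) : EuclideanSpace ℝ ι)‖ₑ = 1 := by
    rw [← ofReal_norm]; simp
  rwa [h2, mul_one, ← toLp_update] at h1

/-- The product rule along the coordinate `i` only: reflected functions have the chain of
derivatives in this direction, and joint differentiability is not asked for. -/
theorem hasLineDerivAt_cutoffMul {χ : EuclideanSpace ℝ ι → ℝ} (hχ : IsCutoff χ) {i : ι}
    {F F' : (ι → ℝ) → ℂ} (hF : ∀ x t, HasDerivAt (fun t => F (Function.update x i t))
      (F' (Function.update x i t)) t) (x : EuclideanSpace ℝ ι) :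
    HasLineDerivAt ℝ (cutoffMul χ F) (cutoffMul (partialD i χ) F x + cutoffMul χ F' x) x
      (EuclideanSpace.single i 1) := by
  have h0 : ∀ t : ℝ, (x + t • EuclideanSpace.single i (1 : ℝ)).ofLp
      = Function.update x.ofLp i (x i + t) := fun t => by
    have := toLp_update x.ofLp i (x i + t)
    rw [add_sub_cancel_left] at this
    rw [← WithLp.toLp_ofLp 2 (x + _)]
    exact congrArg WithLp.ofLp this.symm
  have h1 : HasDerivAt (fun t : ℝ => F (x + t • EuclideanSpace.single i (1 : ℝ)).ofLp)
      (F' x.ofLp) 0 := by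
    simp only [h0]
    have := HasDerivAt.comp_const_add (x i) 0 (hF x.ofLp (x i + 0))
    rwa [add_zero, Function.update_eq_self] at this
  have h2 : HasDerivAt (fun t : ℝ => χ (x + t • EuclideanSpace.single i (1 : ℝ)))
      (partialD i χ x) 0 :=
    (hχ.contDiff.differentiable (by simp) x).hasFDerivAt.hasLineDerivAt _
  have h3 := h2.fun_smul h1
  simp only [zero_smul, add_zero] at h3
  rw [add_comm]
  exact h3

theorem integral_partialD_smul_cutoffMul {χ : EuclideanSpace ℝ ι → ℝ} (hχ : IsCutoff χ) {i : ι}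
    {F F' : (ι → ℝ) → ℂ} (hFc : Continuous F) (hFc' : Continuous F')
    (hF : ∀ x t, HasDerivAt (fun t => F (Function.update x i t))
      (F' (Function.update x i t)) t) {φ : EuclideanSpace ℝ ι → ℝ} (hφ : ContDiff ℝ ∞ φ) :
    ∫ x, partialD i φ x • cutoffMul χ F x
      = - ∫ x, φ x • (cutoffMul (partialD i χ) F x + cutoffMul χ F' x) := by
  have c1 := hχ.continuous_mul hFc
  have c2 := ((hχ.partialD i).continuous_mul hFc).add (hχ.continuous_mul hFc')
  have s1 := hχ.hasCompactSupport_mul F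
  have s2 := ((hχ.partialD i).hasCompactSupport_mul F).add (hχ.hasCompactSupport_mul F')
  have h := integral_bilinear_hasLineDerivAt_right_eq_neg_left_of_integrable (μ := volume)
    (B := ContinuousLinearMap.lsmul ℝ ℝ) (f := φ) (f' := partialD i φ) (g := cutoffMul χ F)
    (g' := fun x => cutoffMul (partialD i χ) F x + cutoffMul χ F' x)
    (v := EuclideanSpace.single i 1)
    (((contDiff_partialD hφ i).continuous.smul c1).integrable_of_hasCompactSupport s1.smul_left)
    ((hφ.continuous.smul c2).integrable_of_hasCompactSupport s2.smul_left)
    ((hφ.continuous.smul c1).integrable_of_hasCompactSupport s1.smul_left)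
    (fun x _ => (hφ.differentiable (by simp) x).hasFDerivAt.hasLineDerivAt _)
    (fun x _ => hasLineDerivAt_cutoffMul hχ hF x)
  simp only [ContinuousLinearMap.lsmul_apply] at h
  rw [h, neg_neg]

theorem fourierL2_add {v w : EuclideanSpace ℝ ι → ℂ} (hv : MemLp v 2 volume)
    (hw : MemLp w 2 volume) (hvw : MemLp (fun x => v x + w x) 2 volume) :
    ∀ᵐ ξ, fourierL2 hvw ξ = fourierL2 hv ξ + fourierL2 hw ξ := by
  have h : FourierTransform.fourier (hvw.toLp _)
      = FourierTransform.fourier (hv.toLp _) + FourierTransform.fourier (hw.toLp _) := by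
    rw [show hvw.toLp _ = hv.toLp _ + hw.toLp _ from MemLp.toLp_add hv hw]
    exact map_add (Lp.fourierTransformₗᵢ (EuclideanSpace ℝ ι) ℂ) _ _
  rw [fourierL2, h]
  exact Lp.coeFn_add _ _

theorem fourierL2_sub {v w : EuclideanSpace ℝ ι → ℂ} (hv : MemLp v 2 volume)
    (hw : MemLp w 2 volume) (hvw : MemLp (fun x => v x - w x) 2 volume) :
    ∀ᵐ ξ, fourierL2 hvw ξ = fourierL2 hv ξ - fourierL2 hw ξ := by
  have h : FourierTransform.fourier (hvw.toLp _)
      = FourierTransform.fourier (hv.toLp _) - FourierTransform.fourier (hw.toLp _) := by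
    rw [show hvw.toLp _ = hv.toLp _ - hw.toLp _ from MemLp.toLp_sub hv hw]
    exact map_sub (Lp.fourierTransformₗᵢ (EuclideanSpace ℝ ι) ℂ) _ _
  rw [fourierL2, h]
  exact Lp.coeFn_sub _ _

/-- The weight `|ξ_i|` on the Fourier side costs one derivative. -/
theorem lintegral_weight_fourierL2_le {χ : EuclideanSpace ℝ ι → ℝ} (hχ : IsCutoff χ) {i : ι}
    {F F' : (ι → ℝ) → ℂ} (hFc : Continuous F) (hFc' : Continuous F')
    (hF : ∀ x t, HasDerivAt (fun t => F (Function.update x i t))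
      (F' (Function.update x i t)) t) {p : ℝ} (hp : 0 ≤ p) :
    ∫⁻ ξ, ‖ξ i‖ₑ ^ (2 + p) * ‖fourierL2 (hχ.memLp_mul hFc) ξ‖ₑ ^ 2
      ≤ 2 * ((∫⁻ ξ, ‖ξ i‖ₑ ^ p * ‖fourierL2 ((hχ.partialD i).memLp_mul hFc) ξ‖ₑ ^ 2)
        + ∫⁻ ξ, ‖ξ i‖ₑ ^ p * ‖fourierL2 (hχ.memLp_mul hFc') ξ‖ₑ ^ 2) := by
  have hm := ((hχ.partialD i).memLp_mul hFc).add (hχ.memLp_mul hFc')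
  have h1 := fourierL2_of_weak_partial (hχ.memLp_mul hFc) hm (hχ.hasCompactSupport_mul F)
    (((hχ.partialD i).hasCompactSupport_mul F).add (hχ.hasCompactSupport_mul F')) i
    fun φ hφ _ => integral_partialD_smul_cutoffMul hχ hFc hFc' hF hφ
  have h2 := fourierL2_add ((hχ.partialD i).memLp_mul hFc) (hχ.memLp_mul hFc') hm
  have hmeas : AEMeasurable (fun ξ => ‖ξ i‖ₑ ^ p *
      ‖fourierL2 ((hχ.partialD i).memLp_mul hFc) ξ‖ₑ ^ 2) volume :=
    AEMeasurable.fun_mul (by fun_prop)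
      ((memLp_fourierL2 _).aestronglyMeasurable.aemeasurable.enorm.pow_const 2)
  rw [← lintegral_add_left' hmeas, ← lintegral_const_mul' _ _ (by simp)]
  refine lintegral_mono_ae ?_
  filter_upwards [h1, h2] with ξ h3 h4
  -- The multiplier `2πiξ_i` is at least `|ξ_i|` in modulus, so its constant can be dropped.
  have h5 : ‖ξ i‖ₑ ^ 2 * ‖fourierL2 (hχ.memLp_mul hFc) ξ‖ₑ ^ 2 ≤ ‖fourierL2 hm ξ‖ₑ ^ 2 := by
    rw [h3, enorm_mul, mul_pow]
    gcongr
    rw [enorm_mul]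
    refine le_mul_of_one_le_of_le ?_ (le_of_eq ?_)
    · rw [← ofReal_norm, ← ENNReal.ofReal_one]
      refine ENNReal.ofReal_le_ofReal ?_
      rw [norm_mul, norm_mul, Complex.norm_I, Complex.norm_real, Real.norm_of_nonneg Real.pi_pos.le]
      norm_num
      nlinarith [Real.pi_gt_three]
    · rw [← ofReal_norm, ← ofReal_norm, Complex.norm_real]
  have h6 := enorm_sub_sq_le (fourierL2 hm ξ) (fourierL2 (hχ.memLp_mul hFc') ξ) 0
  rw [sub_zero, sub_zero, h4, add_sub_cancel_right, ← h4] at h6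
  rw [ENNReal.rpow_add_of_nonneg _ _ (by norm_num) hp]
  calc _ = ‖ξ i‖ₑ ^ p * (‖ξ i‖ₑ ^ 2 * ‖fourierL2 (hχ.memLp_mul hFc) ξ‖ₑ ^ 2) := by
        rw [ENNReal.rpow_two, mul_comm (‖ξ i‖ₑ ^ 2), mul_assoc]
    _ ≤ ‖ξ i‖ₑ ^ p * _ := mul_le_mul_right (h5.trans h6) _
    _ = _ := by ring

/-- Weighted bounds of the Fourier transforms of the localized members of a sequence in which each
function is the derivative of the preceding one. -/
theorem exists_lintegral_weight_fourierL2_le (i : ι) {σ : ℝ} (hσ : 0 ≤ σ) (hσ1 : σ < 1) (m k : ℕ) :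
    ∀ l, k + l ≤ m → ∀ χ : EuclideanSpace ℝ ι → ℝ, ∀ hχ : IsCutoff χ, ∃ C : ℝ≥0,
      ∀ (H : ℕ → (ι → ℝ) → ℂ) (hc : ∀ l, Continuous (H l)),
      (∀ l < m, ∀ x t, HasDerivAt (fun t => H l (Function.update x i t))
        (H (l + 1) (Function.update x i t)) t) →
      ∫⁻ ξ, ‖ξ i‖ₑ ^ (2 * (k + σ)) * ‖fourierL2 (hχ.memLp_mul (hc l)) ξ‖ₑ ^ 2
        ≤ C * ((∑ l ∈ Finset.range (m + 1),
            ∫⁻ x, ‖H l x‖ₑ ^ 2 ∂(Measure.pi fun _ => volume.restrict (Icc (-1 : ℝ) 2)))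
          + dirVal (volume.restrict (Icc (-1 : ℝ) 2)) σ i (H m)) := by
  have hsingle : ∀ {l : ℕ}, l ≤ m → ∀ H : ℕ → (ι → ℝ) → ℂ,
      ∫⁻ x, ‖H l x‖ₑ ^ 2 ∂(Measure.pi fun _ => volume.restrict (Icc (-1 : ℝ) 2))
        ≤ ∑ l ∈ Finset.range (m + 1),
            ∫⁻ x, ‖H l x‖ₑ ^ 2 ∂(Measure.pi fun _ => volume.restrict (Icc (-1 : ℝ) 2)) :=
    fun hl H => Finset.single_le_sum (f := fun l => ∫⁻ x, ‖H l x‖ₑ ^ 2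
      ∂(Measure.pi fun _ => volume.restrict (Icc (-1 : ℝ) 2))) (fun _ _ => zero_le)
      (Finset.mem_range.2 (by omega))
  -- Each step trades a weight `|ξ_i|²` for one derivative. It falls on the cutoff or on `H l`,
  -- which is why the statement is uniform in `l` and ranges over all cutoffs.
  induction k with
  | zero =>
    intro l hl χ hχ
    obtain ⟨C₁, hC₁⟩ := hχ.exists_lintegral_sq_le
    rcases hσ.eq_or_lt with rfl | hσ
    · refine ⟨C₁, fun H hc hd => ?_⟩
      simp only [Nat.cast_zero, add_zero, mul_zero, ENNReal.rpow_zero, one_mul]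
      rw [lintegral_fourierL2_sq]
      refine (hC₁ (H l)).trans (mul_le_mul_right ?_ _)
      exact (hsingle (by omega) H).trans le_self_add
    simp only [Nat.cast_zero, zero_add] at hl ⊢
    -- At top order `l = m` the fractional weight is the Gagliardo seminorm of the localized
    -- function. Below top order `|ξ_i|^{2σ} ≤ 1 + |ξ_i|²`, and the full derivative `H (l + 1)` is
    -- available.
    rcases hl.eq_or_lt with rfl | hl
    · obtain ⟨C, hC⟩ := hχ.exists_dirGag_le i hσ hσ1
      refine ⟨(gagConst σ)⁻¹.toNNReal * C, fun H hc hd => ?_⟩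
      have h1 := dirGag_eq_lintegral_fourierL2 hσ i (hχ.memLp_mul (hc l))
        (hχ.measurable_mul (hc l).measurable)
      have h2 : ∫⁻ ξ : EuclideanSpace ℝ ι, ‖ξ i‖ₑ ^ (2 * σ) *
          ‖fourierL2 (hχ.memLp_mul (hc l)) ξ‖ₑ ^ 2
          = (gagConst σ)⁻¹ * dirGag volume σ i (fun x => cutoffMul χ (H l) (WithLp.toLp 2 x)) := by
        rw [h1, ← mul_assoc, ENNReal.inv_mul_cancel (gagConst_ne_zero σ) (gagConst_ne_top hσ hσ1),
          one_mul]
      rw [h2, ENNReal.coe_mul, ENNReal.coe_toNNReal (ENNReal.inv_ne_top.2 (gagConst_ne_zero σ)),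
        mul_assoc]
      refine mul_le_mul_right ((hC _ (hc l).measurable).trans (mul_le_mul_right ?_ _)) _
      rw [dirVal, if_neg hσ.ne']
      exact add_le_add (hsingle le_rfl H) le_rfl
    · obtain ⟨C₂, hC₂⟩ := (hχ.partialD i).exists_lintegral_sq_le
      refine ⟨C₁ + 2 * (C₂ + C₁), fun H hc hd => ?_⟩
      have h1 := lintegral_weight_fourierL2_le hχ (hc l) (hc (l + 1)) (hd l hl) le_rfl
      simp only [add_zero, ENNReal.rpow_zero, one_mul, lintegral_fourierL2_sq] at h1
      have hpt : ∀ ξ : EuclideanSpace ℝ ι, ‖ξ i‖ₑ ^ (2 * σ) *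
          ‖fourierL2 (hχ.memLp_mul (hc l)) ξ‖ₑ ^ 2 ≤ ‖fourierL2 (hχ.memLp_mul (hc l)) ξ‖ₑ ^ 2
            + ‖ξ i‖ₑ ^ (2 : ℝ) * ‖fourierL2 (hχ.memLp_mul (hc l)) ξ‖ₑ ^ 2 := fun ξ => by
        rw [← one_add_mul]
        refine mul_le_mul_left ?_ _
        rcases le_total ‖ξ i‖ₑ 1 with h | h
        · exact (ENNReal.rpow_le_one h (by linarith)).trans le_self_add
        · exact (ENNReal.rpow_le_rpow_of_exponent_le h (by linarith)).trans le_add_self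
      set S := ∑ l ∈ Finset.range (m + 1),
            ∫⁻ x, ‖H l x‖ₑ ^ 2 ∂(Measure.pi fun _ => volume.restrict (Icc (-1 : ℝ) 2)) with hS
      have hF : AEMeasurable (fun ξ => ‖fourierL2 (hχ.memLp_mul (hc l)) ξ‖ₑ ^ 2) volume :=
        (memLp_fourierL2 _).aestronglyMeasurable.aemeasurable.enorm.pow_const 2
      calc _ ≤ _ := lintegral_mono hpt
        _ = (∫⁻ x, ‖cutoffMul χ (H l) x‖ₑ ^ 2) + ∫⁻ ξ : EuclideanSpace ℝ ι, ‖ξ i‖ₑ ^ (2 : ℝ) *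
            ‖fourierL2 (hχ.memLp_mul (hc l)) ξ‖ₑ ^ 2 := by
          rw [lintegral_add_left' hF, lintegral_fourierL2_sq]
        _ ≤ C₁ * S + 2 * (C₂ * S + C₁ * S) := by
          refine add_le_add ((hC₁ _).trans (mul_le_mul_right (hsingle hl.le H) _)) (h1.trans ?_)
          refine mul_le_mul_right (add_le_add ?_ ?_) _
          · exact (hC₂ _).trans (mul_le_mul_right (hsingle hl.le H) _)
          · exact (hC₁ _).trans (mul_le_mul_right (hsingle hl H) _)
        _ = (C₁ + 2 * (C₂ + C₁) : ℝ≥0) * S := by push_cast; ring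
        _ ≤ _ := mul_le_mul_right le_self_add _
  | succ k ih =>
    intro l hl χ hχ
    obtain ⟨C₁, hC₁⟩ := ih l (by omega) _ (hχ.partialD i)
    obtain ⟨C₂, hC₂⟩ := ih (l + 1) (by omega) _ hχ
    refine ⟨2 * (C₁ + C₂), fun H hc hd => ?_⟩
    have h1 := lintegral_weight_fourierL2_le hχ (hc l) (hc (l + 1)) (hd l (by omega))
      (p := 2 * (k + σ)) (by positivity)
    have e : (2 : ℝ) * (((k + 1 : ℕ) : ℝ) + σ) = 2 + 2 * (k + σ) := by push_cast; ring
    rw [e]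
    refine h1.trans ?_
    push_cast
    rw [mul_assoc]
    refine mul_le_mul_right ?_ _
    rw [add_mul]
    exact add_le_add (hC₁ H hc hd) (hC₂ H hc hd)

/-- The Fourier transform of the localized extension of a smooth function has the decay that
corresponds to the regularity in the `i`-th coordinate. -/
theorem exists_lintegral_weight_fourierL2_reflOp_le {K : Type} [Fintype K] {a r : K → ℝ} {m : ℕ}
    (ha : ∀ p ≤ m, ∑ k, a k * (-r k) ^ p = 1) (h0 : ∀ k, 0 < r k) (h1 : ∀ k, r k ≤ 1) (i : ι)
    {σ : ℝ} (hσ : 0 ≤ σ) (hσ1 : σ < 1) {χ : EuclideanSpace ℝ ι → ℝ} (hχ : IsCutoff χ) :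
    ∃ C : ℝ≥0, ∀ f : (ι → ℝ) → ℂ, ContDiff ℝ ∞ f → ∀ hw : MemLp (cutoffMul χ (reflOp a r 0 i f)) 2 volume,
      ∫⁻ ξ, ‖ξ i‖ₑ ^ (2 * (m + σ)) * ‖fourierL2 hw ξ‖ₑ ^ 2
        ≤ C * ((∫⁻ x, ‖f x‖ₑ ^ 2 ∂(Measure.pi fun _ => volume.restrict (Icc (0 : ℝ) 1)))
          + dirVal (volume.restrict (Icc (0 : ℝ) 1)) σ i ((pderivC i)^[m] f)) := by
  obtain ⟨C, hC⟩ := exists_lintegral_weight_fourierL2_le i hσ hσ1 m m 0 le_rfl χ hχ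
  choose C₁ hC₁ using fun l => exists_dirVal_reflOp_le (ι := ι) a h0 h1 l i i (le_refl (0 : ℝ))
  obtain ⟨C₂, hC₂⟩ := exists_dirVal_reflOp_le a h0 h1 m i i hσ
  have hC₃ : ∀ l : ℕ, ∃ D : ℝ≥0, l ≤ m → ∀ f : (ι → ℝ) → ℂ, ContDiff ℝ ∞ f →
      ∫⁻ x, ‖(pderivC i)^[l] f x‖ₑ ^ 2 ∂(Measure.pi fun _ => volume.restrict (Icc (0 : ℝ) 1))
        ≤ D * ((∫⁻ x, ‖f x‖ₑ ^ 2 ∂(Measure.pi fun _ => volume.restrict (Icc (0 : ℝ) 1)))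
          + dirVal (volume.restrict (Icc (0 : ℝ) 1)) σ i ((pderivC i)^[m] f)) := fun l => by
    by_cases hl : l ≤ m
    · obtain ⟨D, hD⟩ := exists_lintegral_pderivC_sq_le i hσ m hl
      exact ⟨D, fun _ => hD⟩
    · exact ⟨0, fun h => absurd h hl⟩
  choose D hD using hC₃
  refine ⟨C * (∑ l ∈ Finset.range (m + 1), C₁ l * D l + C₂), fun f hf hw => ?_⟩
  -- By the moment conditions the reflections of the successive derivatives, with increasing weight
  -- exponents, again form a chain of derivatives in direction `i` up to order `m`.
  set H : ℕ → (ι → ℝ) → ℂ := fun l => reflOp a r l i ((pderivC i)^[l] f) with hH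
  have hfc : ∀ l, Continuous ((pderivC i)^[l] f) := fun l =>
    (contDiff_iterate_pderivC hf i l).continuous
  have hc : ∀ l, Continuous (H l) := fun l => continuous_reflOp a h0 h1 l i (hfc l)
  have hd : ∀ l < m, ∀ x t, HasDerivAt (fun t => H l (Function.update x i t))
        (H (l + 1) (Function.update x i t)) t := fun l hl x t => by
    simp only [hH, Function.iterate_succ_apply']
    exact hasDerivAt_reflOp (ha l hl.le) (ha (l + 1) hl) i (contDiff_iterate_pderivC hf i l) x t
  refine (hC H hc hd).trans ?_
  set T := (∫⁻ x, ‖f x‖ₑ ^ 2 ∂(Measure.pi fun _ => volume.restrict (Icc (0 : ℝ) 1)))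
          + dirVal (volume.restrict (Icc (0 : ℝ) 1)) σ i ((pderivC i)^[m] f) with hT
  rw [ENNReal.coe_mul, mul_assoc]
  refine mul_le_mul_right ?_ _
  rw [ENNReal.coe_add, ENNReal.ofNNReal_finsetSum, add_mul, Finset.sum_mul]
  refine add_le_add (Finset.sum_le_sum fun l hl => ?_) ?_
  · have h2 := hC₁ l _ (hfc l).measurable
    simp only [dirVal, if_true] at h2
    refine h2.trans ?_
    rw [ENNReal.coe_mul, mul_assoc]
    exact mul_le_mul_right (hD l (by simpa [Nat.lt_succ_iff] using hl) f hf) _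
  · exact (hC₂ _ (hfc m).measurable).trans (mul_le_mul_right le_add_self _)

end CutoffFourier

/-! ### Contraction of the cube followed by averaging -/

section Mollify

variable {ι : Type} [Fintype ι] [DecidableEq ι]

/-- The contraction of the unit cube towards its centre. -/
noncomputable def shrink (δ : ℝ) (x : ι → ℝ) : EuclideanSpace ℝ ι :=
  WithLp.toLp 2 fun j => (1 - δ) * x j + δ / 2

theorem continuous_shrink (δ : ℝ) : Continuous (shrink δ : (ι → ℝ) → EuclideanSpace ℝ ι) :=
  (PiLp.continuous_toLp 2 _).comp (by fun_prop)

/-- The average of `v` over translates of the contracted point. -/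
noncomputable def mollify (ρ : Measure (EuclideanSpace ℝ ι)) (δ : ℝ) (v : EuclideanSpace ℝ ι → ℂ)
    (x : ι → ℝ) : ℂ :=
  ∫ z, v (shrink δ x - z) ∂ρ

theorem shrink_sub_eq (δ : ℝ) (x : ι → ℝ) (z : EuclideanSpace ℝ ι) :
    shrink δ x - z = WithLp.toLp 2 fun j => (1 - δ) * x j + (δ / 2 - z j) := by
  ext j; simp [shrink]; ring

/-- The contraction leaves a margin `δ/2` and the shift uses at most `δ/4` of it, so the unit
interval is mapped into itself; the image density is `1/(1-δ) ≤ 2`. -/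
theorem map_affine_le {δ z : ℝ} (hδ : 0 < δ) (hδ' : δ ≤ 1 / 2) (hz : |z| ≤ δ / 4) :
    (volume.restrict (Icc (0 : ℝ) 1)).map (fun t => (1 - δ) * t + (δ / 2 - z))
      ≤ (2 : ℝ≥0) • volume.restrict (Icc (0 : ℝ) 1) := by
  rw [abs_le] at hz
  have hm : Measurable fun t : ℝ => (1 - δ) * t + (δ / 2 - z) := by fun_prop
  refine Measure.le_iff.2 fun s hs => ?_
  rw [Measure.map_apply hm hs, Measure.restrict_apply (hm hs), Measure.smul_apply,
    Measure.restrict_apply hs, ENNReal.smul_def, smul_eq_mul]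
  have hsub : (fun t : ℝ => (1 - δ) * t + (δ / 2 - z)) ⁻¹' s ∩ Icc 0 1
      ⊆ (fun t => (1 - δ) * t) ⁻¹' ((fun t => (δ / 2 - z) + t) ⁻¹' (s ∩ Icc (0 : ℝ) 1)) := by
    rintro t ⟨ht, h0, h1⟩
    have ht' : (1 - δ) * t + (δ / 2 - z) ∈ s := ht
    rw [add_comm] at ht'
    refine ⟨ht', ?_, ?_⟩ <;> dsimp only <;> nlinarith
  refine (measure_mono hsub).trans ?_
  have h1 : (1 - δ) ≠ 0 := by linarith
  rw [Real.volume_preimage_mul_left h1, measure_preimage_add]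
  refine mul_le_mul_left ?_ _
  rw [abs_of_pos (inv_pos.2 (by linarith))]
  have : (1 - δ)⁻¹ ≤ 2 := by
    rw [inv_le_comm₀ (by linarith) two_pos]; linarith
  simpa using ENNReal.ofReal_le_ofReal this

theorem dirVal_translate_le {δ : ℝ} (hδ : 0 < δ) (hδ' : δ ≤ 1 / 2) {z : EuclideanSpace ℝ ι}
    (hz : ∀ j, |z j| ≤ δ / 4) {σ : ℝ} (hσ : 0 ≤ σ) (i : ι) {v : EuclideanSpace ℝ ι → ℂ}
    (hv : Measurable v) :
    dirVal (volume.restrict (Icc (0 : ℝ) 1)) σ i (fun x => v (shrink δ x - z))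
      ≤ 2 ^ (Fintype.card ι + 1) *
        dirVal (volume.restrict (Icc (0 : ℝ) 1)) σ i (fun x => v (WithLp.toLp 2 x)) := by
  simp only [shrink_sub_eq]
  have h := dirVal_comp_le (μ := volume.restrict (Icc (0 : ℝ) 1))
    (ν := volume.restrict (Icc (0 : ℝ) 1)) (θ := fun j t => (1 - δ) * t + (δ / 2 - z j))
    (fun j => by fun_prop) (fun j => map_affine_le hδ hδ' (hz j)) one_le_two (fun j s t => ?_) hσ i
    (v := fun x => v (WithLp.toLp 2 x))
    (hv.comp (MeasurableEquiv.toLp 2 (ι → ℝ)).measurable)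
  · exact_mod_cast h
  · rw [add_sub_add_right_eq_sub, ← mul_sub, abs_mul, abs_of_nonneg (by linarith)]
    exact mul_le_of_le_one_left (abs_nonneg _) (by linarith)

theorem measurable_translate {v : EuclideanSpace ℝ ι → ℂ} (hv : Measurable v) (δ : ℝ) :
    Measurable fun q : (ι → ℝ) × EuclideanSpace ℝ ι => v (shrink δ q.1 - q.2) :=
  hv.comp (((continuous_shrink δ).comp continuous_fst).sub continuous_snd).measurable

/-- Mollification is bounded for the `L²` norm and for the Gagliardo seminorms. -/
theorem dirVal_mollify_le {ρ : Measure (EuclideanSpace ℝ ι)} [IsProbabilityMeasure ρ] {δ : ℝ}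
    (hδ : 0 < δ) (hδ' : δ ≤ 1 / 2) (hρ : ∀ᵐ z ∂ρ, ∀ j, |z j| ≤ δ / 4) {σ : ℝ} (hσ : 0 ≤ σ) (i : ι)
    {v : EuclideanSpace ℝ ι → ℂ} (hv : Measurable v)
    (hint : ∀ x : ι → ℝ, (∀ j, x j ∈ Icc (0 : ℝ) 1) → Integrable (fun z => v (shrink δ x - z)) ρ) :
    dirVal (volume.restrict (Icc (0 : ℝ) 1)) σ i (mollify ρ δ v)
      ≤ 2 ^ (Fintype.card ι + 1) *
        dirVal (volume.restrict (Icc (0 : ℝ) 1)) σ i (fun x => v (WithLp.toLp 2 x)) := by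
  set V := dirVal (volume.restrict (Icc (0 : ℝ) 1)) σ i (fun x => v (WithLp.toLp 2 x)) with hV
  have hvm := measurable_translate (ι := ι) hv δ
  -- Jensen's inequality for the probability measure `ρ`: the seminorm squared of an average is at
  -- most the average of the squares, and each translate is bounded uniformly.
  suffices h : dirVal (volume.restrict (Icc (0 : ℝ) 1)) σ i (mollify ρ δ v)
      ≤ ∫⁻ z, dirVal (volume.restrict (Icc (0 : ℝ) 1)) σ i (fun x => v (shrink δ x - z)) ∂ρ by
    refine h.trans ((lintegral_mono_ae (hρ.mono fun z hz =>
      dirVal_translate_le hδ hδ' hz hσ i hv)).trans (le_of_eq ?_))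
    rw [lintegral_const, measure_univ, mul_one]
  unfold dirVal
  split_ifs
  · rw [lintegral_lintegral_swap (f := fun z x => ‖v (shrink δ x - z)‖ₑ ^ 2)
      ((hvm.comp measurable_swap).enorm.pow_const 2).aemeasurable]
    refine lintegral_mono fun x => ?_
    have h1 := enorm_integral_sq_le (μ := ρ) (f := fun z => v (shrink δ x - z))
      (hvm.comp (measurable_prodMk_left (x := x))).aestronglyMeasurable
    rwa [measure_univ, one_mul] at h1
  · unfold dirGag
    obtain ⟨G, hG⟩ : ∃ G : EuclideanSpace ℝ ι → (ι → ℝ) → ℝ → ℝ≥0∞, ∀ z x t, G z x t =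
        ‖v (shrink δ x - z) - v (shrink δ (Function.update x i t) - z)‖ₑ ^ 2
          / ‖x i - t‖ₑ ^ (1 + 2 * σ) := ⟨_, fun _ _ _ => rfl⟩
    have hu : Measurable fun q : EuclideanSpace ℝ ι × (ι → ℝ) × ℝ =>
        Function.update q.2.1 i q.2.2 :=
      (measurable_update' (a := i)).comp measurable_snd
    have hGm : Measurable fun q : EuclideanSpace ℝ ι × (ι → ℝ) × ℝ => G q.1 q.2.1 q.2.2 := by
      simp only [hG]
      have m1 : Measurable fun q : EuclideanSpace ℝ ι × (ι → ℝ) × ℝ => v (shrink δ q.2.1 - q.1) :=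
        hvm.comp (f := fun q : EuclideanSpace ℝ ι × (ι → ℝ) × ℝ => (q.2.1, q.1)) (by fun_prop)
      have m2 : Measurable fun q : EuclideanSpace ℝ ι × (ι → ℝ) × ℝ =>
          v (shrink δ (Function.update q.2.1 i q.2.2) - q.1) :=
        hvm.comp (f := fun q : EuclideanSpace ℝ ι × (ι → ℝ) × ℝ =>
          (Function.update q.2.1 i q.2.2, q.1)) (hu.prodMk measurable_fst)
      exact ((m1.sub m2).enorm.pow_const 2).div (by fun_prop)
    simp only [← hG]
    have hswap : ∫⁻ z, ∫⁻ x, ∫⁻ t in Icc (0 : ℝ) 1, G z x t ∂volume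
          ∂(Measure.pi fun _ => volume.restrict (Icc (0 : ℝ) 1)) ∂ρ
        = ∫⁻ x, ∫⁻ t in Icc (0 : ℝ) 1, ∫⁻ z, G z x t ∂ρ ∂volume
          ∂(Measure.pi fun _ => volume.restrict (Icc (0 : ℝ) 1)) := by
      have m1 : Measurable fun q : (EuclideanSpace ℝ ι × (ι → ℝ)) × ℝ => G q.1.1 q.1.2 q.2 :=
        hGm.comp (f := fun q : (EuclideanSpace ℝ ι × (ι → ℝ)) × ℝ => (q.1.1, q.1.2, q.2))
          (by fun_prop)
      rw [lintegral_lintegral_swap (f := fun z x => ∫⁻ t in Icc (0 : ℝ) 1, G z x t)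
        (m1.lintegral_prod_right' (ν := volume.restrict (Icc (0 : ℝ) 1))).aemeasurable]
      refine lintegral_congr fun x => ?_
      rw [lintegral_lintegral_swap]
      exact (hGm.comp (f := fun q : EuclideanSpace ℝ ι × ℝ => (q.1, x, q.2))
        (by fun_prop)).aemeasurable
    rw [hswap]
    refine lintegral_mono_ae ((ae_pi_mem measurableSet_Icc).mono fun x hx => ?_)
    refine lintegral_mono_ae ((ae_restrict_mem measurableSet_Icc).mono fun t ht => ?_)
    have hx' : ∀ j, Function.update x i t j ∈ Icc (0 : ℝ) 1 := fun j => by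
      by_cases hj : j = i
      · subst hj; simpa using ht
      · simpa [hj] using hx j
    have h1 := enorm_integral_sq_le (μ := ρ)
      ((hint x hx).sub (hint _ hx')).aestronglyMeasurable
    rw [measure_univ, one_mul, integral_sub' (hint x hx) (hint _ hx')] at h1
    simp only [hG, div_eq_mul_inv]
    have m3 : Measurable fun z => ‖v (shrink δ x - z)
        - v (shrink δ (Function.update x i t) - z)‖ₑ ^ 2 :=
      ((hvm.comp (measurable_prodMk_left (x := x))).sub
        (hvm.comp (measurable_prodMk_left (x := Function.update x i t)))).enorm.pow_const 2
    rw [lintegral_mul_const _ m3]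
    exact mul_le_mul_left h1 _

end Mollify

/-! ### Mollification by smooth densities and its derivatives -/

section SmoothApproximation

open scoped Convolution

variable {ι : Type} [Fintype ι] [DecidableEq ι]

/-- A nonnegative smooth function of integral `1`, supported near the origin. -/
structure IsMollifier (ε : ℝ) (φ : EuclideanSpace ℝ ι → ℝ) : Prop where
  contDiff : ContDiff ℝ ∞ φ
  hasCompactSupport : HasCompactSupport φ
  nonneg : ∀ x, 0 ≤ φ x
  integral_eq_one : ∫ x, φ x = 1
  abs_le : ∀ x ∈ tsupport φ, ∀ i, |x i| ≤ ε

theorem exists_isMollifier {ε : ℝ} (hε : 0 < ε) : ∃ φ : EuclideanSpace ℝ ι → ℝ, IsMollifier ε φ := by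
  let b : ContDiffBump (0 : EuclideanSpace ℝ ι) := ⟨ε / 2, ε, by linarith, by linarith⟩
  refine ⟨b.normed volume, b.contDiff_normed, b.hasCompactSupport_normed, b.nonneg_normed,
    b.integral_normed, fun x hx i => ?_⟩
  rw [b.tsupport_normed_eq, mem_closedBall_zero_iff] at hx
  exact (PiLp.norm_apply_le x i).trans hx

/-- The probability measure with density `φ`. -/
noncomputable def densityMeasure (φ : EuclideanSpace ℝ ι → ℝ) : Measure (EuclideanSpace ℝ ι) :=
  volume.withDensity fun x => (Real.toNNReal (φ x) : ℝ≥0∞)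

theorem IsMollifier.measurable {ε : ℝ} {φ : EuclideanSpace ℝ ι → ℝ} (hφ : IsMollifier ε φ) :
    Measurable fun x => Real.toNNReal (φ x) :=
  hφ.contDiff.continuous.measurable.real_toNNReal

theorem IsMollifier.isProbabilityMeasure {ε : ℝ} {φ : EuclideanSpace ℝ ι → ℝ}
    (hφ : IsMollifier ε φ) : IsProbabilityMeasure (densityMeasure φ) := by
  refine ⟨?_⟩
  rw [densityMeasure, withDensity_apply _ MeasurableSet.univ, Measure.restrict_univ]
  change ∫⁻ x, ENNReal.ofReal (φ x) = 1
  rw [← ofReal_integral_eq_lintegral_ofReal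
    (hφ.contDiff.continuous.integrable_of_hasCompactSupport hφ.hasCompactSupport)
    (Filter.Eventually.of_forall hφ.nonneg), hφ.integral_eq_one, ENNReal.ofReal_one]

theorem IsMollifier.ae_abs_le {ε : ℝ} {φ : EuclideanSpace ℝ ι → ℝ} (hφ : IsMollifier ε φ) :
    ∀ᵐ z ∂(densityMeasure φ), ∀ j, |z j| ≤ ε := by
  rw [densityMeasure, ae_withDensity_iff (by exact hφ.measurable.coe_nnreal_ennreal)]
  refine Filter.Eventually.of_forall fun z hz => hφ.abs_le z (subset_tsupport _ ?_)
  rintro h0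
  rw [h0] at hz
  simp at hz

/-- The average over translates gives the bounds by Jensen's inequality; the convolution form lets
derivatives fall on `φ`. -/
theorem IsMollifier.integral_eq {ε : ℝ} {φ : EuclideanSpace ℝ ι → ℝ} (hφ : IsMollifier ε φ)
    (v : EuclideanSpace ℝ ι → ℂ) (X : EuclideanSpace ℝ ι) :
    ∫ z, v (X - z) ∂(densityMeasure φ) = ∫ y, φ (X - y) • v y := by
  rw [densityMeasure, integral_withDensity_eq_integral_smul hφ.measurable,
    ← integral_sub_left_eq_self (μ := volume) _ X]
  refine integral_congr_ae (Filter.Eventually.of_forall fun z => ?_)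
  dsimp only
  rw [sub_sub_cancel, NNReal.smul_def, Real.coe_toNNReal _ (hφ.nonneg _)]

theorem IsMollifier.integrable_iff {ε : ℝ} {φ : EuclideanSpace ℝ ι → ℝ} (hφ : IsMollifier ε φ)
    (v : EuclideanSpace ℝ ι → ℂ) (X : EuclideanSpace ℝ ι) :
    Integrable (fun z => v (X - z)) (densityMeasure φ) ↔ Integrable fun y => φ (X - y) • v y := by
  rw [densityMeasure, integrable_withDensity_iff_integrable_smul hφ.measurable,
    ← integrable_comp_sub_left (μ := volume) _ X]
  refine integrable_congr (Filter.Eventually.of_forall fun z => ?_)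
  dsimp only
  rw [sub_sub_cancel, NNReal.smul_def, Real.coe_toNNReal _ (hφ.nonneg _)]

/-- The open unit cube. -/
def openCube (ι : Type) : Set (EuclideanSpace ℝ ι) := {x | ∀ i, x i ∈ Ioo (0 : ℝ) 1}

theorem isOpen_openCube : IsOpen (openCube ι) := by
  have : openCube ι = ⋂ i, {x | x i ∈ Ioo (0 : ℝ) 1} := by
    ext x; simp [openCube]
  rw [this]
  exact isOpen_iInter_of_finite fun i => isOpen_Ioo.preimage (by fun_prop)

/-- The contracted point keeps distance `δ/2` from the faces and the mollifier has radius `δ/4`.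
Values of `v` outside the open cube are therefore never used. -/
theorem mem_openCube_of_mem_tsupport {δ : ℝ} (hδ : 0 < δ) (hδ' : δ ≤ 1 / 2)
    {φ : EuclideanSpace ℝ ι → ℝ} (hφ : IsMollifier (δ / 4) φ) {x : ι → ℝ}
    (hx : ∀ j, x j ∈ Icc (0 : ℝ) 1) {y : EuclideanSpace ℝ ι} (hy : shrink δ x - y ∈ tsupport φ) :
    y ∈ openCube ι := by
  intro i
  have h := hφ.abs_le _ hy i
  rw [abs_le] at h
  have h0 := (hx i).1
  have h1 := (hx i).2
  change -(δ / 4) ≤ ((1 - δ) * x i + δ / 2) - y i ∧ ((1 - δ) * x i + δ / 2) - y i ≤ δ / 4 at h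
  constructor <;> nlinarith [h.1, h.2]

theorem tsupport_comp_sub (X : EuclideanSpace ℝ ι) (φ : EuclideanSpace ℝ ι → ℝ) :
    tsupport (fun y => φ (X - y)) = (fun y => X - y) ⁻¹' tsupport φ := by
  have := tsupport_comp_eq_preimage φ (Homeomorph.subLeft X)
  exact this

theorem HasCompactSupport.comp_sub {φ : EuclideanSpace ℝ ι → ℝ} (hφ : HasCompactSupport φ)
    (X : EuclideanSpace ℝ ι) : HasCompactSupport fun y => φ (X - y) :=
  hφ.comp_homeomorph (Homeomorph.subLeft X)

theorem integrable_smul_of_locallyIntegrableOn {U : Set (EuclideanSpace ℝ ι)} 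
    {φ : EuclideanSpace ℝ ι → ℝ} (hφ : Continuous φ) (hc : HasCompactSupport φ)
    (hs : tsupport φ ⊆ U) {v : EuclideanSpace ℝ ι → ℂ} (hv : LocallyIntegrableOn v U volume) :
    Integrable fun y => φ y • v y := by
  have h1 : IntegrableOn v (tsupport φ) volume := hv.integrableOn_compact_subset hs hc
  have h2 : IntegrableOn (fun y => φ y • v y) (tsupport φ) volume :=
    h1.continuousOn_smul hφ.continuousOn hc
  refine (integrableOn_iff_integrable_of_support_subset fun y hy => ?_).1 h2
  by_contra h
  exact hy (by simp [image_eq_zero_of_notMem_tsupport h])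

theorem contDiff_iterate_partialD {φ : EuclideanSpace ℝ ι → ℝ} (hφ : ContDiff ℝ ∞ φ) (i : ι) (m : ℕ) :
    ContDiff ℝ ∞ ((partialD i)^[m] φ) := by
  induction m with
  | zero => exact hφ
  | succ m ih => rw [Function.iterate_succ_apply']; exact contDiff_partialD ih i

theorem iterate_partialD_comp_sub {φ : EuclideanSpace ℝ ι → ℝ} (hφ : ContDiff ℝ ∞ φ) (i : ι) (m : ℕ)
    (X : EuclideanSpace ℝ ι) : (partialD i)^[m] (fun y => φ (X - y))
      = fun y => (-1 : ℝ) ^ m * (partialD i)^[m] φ (X - y) := by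
  induction m with
  | zero => simp
  | succ m ih =>
    rw [Function.iterate_succ_apply', ih]
    funext y
    have h1 : HasFDerivAt (fun y => X - y) (-ContinuousLinearMap.id ℝ (EuclideanSpace ℝ ι)) y :=
      (hasFDerivAt_id y).const_sub X
    have h2 := (((contDiff_iterate_partialD hφ i m).differentiable (by simp) (X - y)).hasFDerivAt.comp y h1).const_mul
      ((-1 : ℝ) ^ m)
    rw [partialD]
    erw [h2.fderiv]
    rw [Function.iterate_succ_apply', partialD]
    simp [pow_succ]

theorem foldr_iterate_single (i : ι) (m : ℕ) (f : ι → (EuclideanSpace ℝ ι → ℝ) → EuclideanSpace ℝ ι → ℝ)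
    (φ : EuclideanSpace ℝ ι → ℝ) {l : List ι} (hl : l.Nodup) :
    l.foldr (fun j g => (f j)^[(Pi.single i m : ι → ℕ) j] g) φ
      = if i ∈ l then (f i)^[m] φ else φ := by
  induction l with
  | nil => simp
  | cons j l ih =>
    rw [List.nodup_cons] at hl
    rw [List.foldr_cons, ih hl.2]
    by_cases hj : i = j
    · subst hj
      simp [hl.1]
    · simp [hj]

theorem multiD_single (i : ι) (m : ℕ) (φ : EuclideanSpace ℝ ι → ℝ) :
    multiD (Pi.single i m) φ = (partialD i)^[m] φ := by
  rw [multiD, foldr_iterate_single i m partialD φ (Finset.nodup_toList _)]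
  simp

theorem hasCompactSupport_iterate_partialD {φ : EuclideanSpace ℝ ι → ℝ} (hφ : HasCompactSupport φ)
    (i : ι) (m : ℕ) : HasCompactSupport ((partialD i)^[m] φ) := by
  induction m with
  | zero => exact hφ
  | succ m ih => rw [Function.iterate_succ_apply']; exact ih.fderiv_apply ℝ _

theorem tsupport_iterate_partialD_subset (φ : EuclideanSpace ℝ ι → ℝ) (i : ι) (m : ℕ) :
    tsupport ((partialD i)^[m] φ) ⊆ tsupport φ := by
  induction m with
  | zero => exact subset_rfl
  | succ m ih =>
    rw [Function.iterate_succ_apply']; exact (tsupport_fderiv_apply_subset ℝ _).trans ih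

theorem contDiff_integral_smul {φ : EuclideanSpace ℝ ι → ℝ} (hφ : ContDiff ℝ ∞ φ)
    (hc : HasCompactSupport φ) {u : EuclideanSpace ℝ ι → ℂ} (hu : LocallyIntegrable u volume) :
    ContDiff ℝ ∞ fun X => ∫ y, φ (X - y) • u y :=
  hc.contDiff_convolution_right (ContinuousLinearMap.lsmul ℝ ℝ).flip hu hφ

theorem fderiv_integral_smul {φ : EuclideanSpace ℝ ι → ℝ} (hφ : ContDiff ℝ ∞ φ)
    (hc : HasCompactSupport φ) {u : EuclideanSpace ℝ ι → ℂ} (hu : LocallyIntegrable u volume) (i : ι)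
    (X : EuclideanSpace ℝ ι) :
    fderiv ℝ (fun X => ∫ y, φ (X - y) • u y) X (EuclideanSpace.single i 1)
      = ∫ y, partialD i φ (X - y) • u y := by
  have h := hc.hasFDerivAt_convolution_right (μ := volume)
    (ContinuousLinearMap.lsmul ℝ ℝ : ℝ →L[ℝ] ℂ →L[ℝ] ℂ).flip hu (hφ.of_le (by simp)) X
  have h' := congrArg (fun A => A (EuclideanSpace.single i (1 : ℝ))) h.fderiv
  rw [convolution_precompR_apply _ hu (hc.fderiv ℝ) (hφ.continuous_fderiv (by simp))] at h'
  exact h'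

/-- Derivatives of the mollification of a function. -/
theorem iterate_pderivC_mollify {φ : EuclideanSpace ℝ ι → ℝ} (hφ : ContDiff ℝ ∞ φ)
    (hc : HasCompactSupport φ) {u : EuclideanSpace ℝ ι → ℂ} (hu : LocallyIntegrable u volume) (i : ι)
    (δ : ℝ) (m : ℕ) :
    (pderivC i)^[m] (fun x => ∫ y, φ (shrink δ x - y) • u y)
      = fun x => (1 - δ) ^ m • ∫ y, (partialD i)^[m] φ (shrink δ x - y) • u y := by
  induction m with
  | zero => simp
  | succ m ih =>
    rw [Function.iterate_succ_apply', ih]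
    funext x
    have hs : HasDerivAt (fun t : ℝ => shrink δ (x + t • Pi.single i 1))
        ((1 - δ) • EuclideanSpace.single i (1 : ℝ)) 0 := by
      have e : (fun t : ℝ => shrink δ (x + t • Pi.single i 1))
          = fun t : ℝ => shrink δ x + t • ((1 - δ) • EuclideanSpace.single i (1 : ℝ)) := by
        funext t
        ext j
        by_cases hj : j = i
        · subst hj; simp [shrink]; ring
        · simp [shrink, hj]
      rw [e]
      simpa using ((hasDerivAt_id (0 : ℝ)).smul_const _).const_add (shrink δ x)
    have hφm := contDiff_iterate_partialD hφ i m
    have hcm := hasCompactSupport_iterate_partialD hc i m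
    have hg := contDiff_integral_smul hφm hcm hu
    have h1 := ((hg.differentiable (by simp) (shrink δ (x + (0 : ℝ) • Pi.single i 1))).hasFDerivAt.comp_hasDerivAt
      0 hs).const_smul ((1 - δ) ^ m)
    have hsm : ContDiff ℝ ∞ fun x : ι → ℝ =>
        (1 - δ) ^ m • ∫ y, (partialD i)^[m] φ (shrink δ x - y) • u y := by
      refine (hg.comp (?_ : ContDiff ℝ ∞ (shrink δ))).const_smul _
      exact (PiLp.contDiff_toLp).comp (by fun_prop)
    have h2 : HasDerivAt (fun t : ℝ => (fun x : ι → ℝ =>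
        (1 - δ) ^ m • ∫ y, (partialD i)^[m] φ (shrink δ x - y) • u y) (x + t • Pi.single i 1))
        (pderivC i _ x) 0 :=
      (hsm.differentiable (by simp) x).hasFDerivAt.hasLineDerivAt (Pi.single i 1)
    refine (h2.unique h1).trans ?_
    rw [zero_smul, add_zero, map_smul, fderiv_integral_smul hφm hcm hu, smul_smul, ← pow_succ,
      Function.iterate_succ_apply']

theorem contDiff_mollify {φ : EuclideanSpace ℝ ι → ℝ} (hφ : ContDiff ℝ ∞ φ)
    (hc : HasCompactSupport φ) {u : EuclideanSpace ℝ ι → ℂ} (hu : LocallyIntegrable u volume) 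
    (δ : ℝ) : ContDiff ℝ ∞ fun x : ι → ℝ => ∫ y, φ (shrink δ x - y) • u y := by
  refine (contDiff_integral_smul hφ hc hu).comp (?_ : ContDiff ℝ ∞ (shrink δ))
  exact (PiLp.contDiff_toLp).comp (by fun_prop)

/-- On the unit cube, derivatives of a mollification are mollifications of weak derivatives. -/
theorem integral_iterate_partialD_eq_of_isWeakDeriv {δ : ℝ} (hδ : 0 < δ) (hδ' : δ ≤ 1 / 2)
    {φ : EuclideanSpace ℝ ι → ℝ} (hφ : IsMollifier (δ / 4) φ) {i : ι} {m : ℕ}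
    {u v : EuclideanSpace ℝ ι → ℂ} (hv : IsWeakDeriv (openCube ι) (Pi.single i m) u v) {x : ι → ℝ}
    (hx : ∀ j, x j ∈ Icc (0 : ℝ) 1) :
    ∫ y, (partialD i)^[m] φ (shrink δ x - y) • (openCube ι).indicator u y
      = ∫ y, φ (shrink δ x - y) • v y := by
  set X := shrink δ x with hX
  have hsub : tsupport (fun y => φ (X - y)) ⊆ openCube ι := fun y hy => by
    rw [tsupport_comp_sub] at hy
    exact mem_openCube_of_mem_tsupport hδ hδ' hφ hx hy
  have h := hv.integral_eq (fun y => φ (X - y)) (hφ.contDiff.comp (contDiff_const.sub contDiff_id))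
    (hφ.hasCompactSupport.comp_sub X) hsub
  have h1 : ∑ j, (Pi.single i m : ι → ℕ) j = m := by simp
  rw [multiD_single, iterate_partialD_comp_sub hφ.contDiff, h1] at h
  have h2 : ∫ y in openCube ι, ((-1 : ℝ) ^ m * (partialD i)^[m] φ (X - y)) • u y
      = (-1 : ℝ) ^ m • ∫ y in openCube ι, (partialD i)^[m] φ (X - y) • u y := by
    rw [← integral_smul]
    simp only [mul_smul]
  rw [h2] at h
  have h3 : ((-1 : ℝ) ^ m) ≠ 0 := by simp
  -- The sign from differentiating `φ (X - y)` in `y` and the sign in the definition of a weak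
  -- derivative are both `(-1) ^ m`, and cancel.
  have h4 := smul_right_injective ℂ h3 h
  have h5 : ∫ y in openCube ι, φ (X - y) • v y = ∫ y, φ (X - y) • v y :=
    setIntegral_eq_integral_of_forall_compl_eq_zero fun y hy => by
      rw [image_eq_zero_of_notMem_tsupport (f := fun y => φ (X - y)) fun h => hy (hsub h), zero_smul]
  rw [← h5, ← h4, ← integral_indicator isOpen_openCube.measurableSet]
  refine integral_congr_ae (Filter.Eventually.of_forall fun y => ?_)
  by_cases hy : y ∈ openCube ι <;> simp [hy]

end SmoothApproximation

/-! ### Smooth approximation with bounded directional seminorms -/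

section ApproximationInCube

variable {ι : Type} [Fintype ι] [DecidableEq ι]

theorem dirVal_mono {I : Set ℝ} (hI : MeasurableSet I) (σ : ℝ) (i : ι) {F G : (ι → ℝ) → ℂ}
    (h1 : ∀ x, (∀ j, x j ∈ I) → ‖F x‖ₑ ≤ ‖G x‖ₑ)
    (h2 : ∀ x y, (∀ j, x j ∈ I) → (∀ j, y j ∈ I) → ‖F x - F y‖ₑ ≤ ‖G x - G y‖ₑ) :
    dirVal (volume.restrict I) σ i F ≤ dirVal (volume.restrict I) σ i G := by
  unfold dirVal
  split_ifs
  · refine lintegral_mono_ae ((ae_pi_mem hI).mono fun x hx => ?_)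
    have := h1 x hx
    gcongr
  · unfold dirGag
    refine lintegral_mono_ae ((ae_pi_mem hI).mono fun x hx => ?_)
    refine lintegral_mono_ae ((ae_restrict_mem hI).mono fun t ht => ?_)
    have := h2 x (Function.update x i t) hx fun j => by
      by_cases hj : j = i
      · subst hj; simpa using ht
      · simpa [hj] using hx j
    refine ENNReal.div_le_div_right ?_ _
    gcongr

/-- The closed unit cube and the open unit cube agree up to a null set. -/
theorem pi_restrict_Icc_eq :
    (Measure.pi fun _ : ι => volume.restrict (Icc (0 : ℝ) 1))
      = (Measure.pi fun _ : ι => volume.restrict (Ioo (0 : ℝ) 1)) := by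
  simp only [restrict_Ioo_eq_restrict_Icc]

theorem lintegral_openCube (F : EuclideanSpace ℝ ι → ℝ≥0∞) :
    ∫⁻ x in openCube ι, F x = ∫⁻ x : ι → ℝ, F (WithLp.toLp 2 x)
      ∂(Measure.pi fun _ => volume.restrict (Icc (0 : ℝ) 1)) := by
  rw [pi_restrict_Icc_eq, ← Measure.restrict_pi_pi,
    ← lintegral_indicator isOpen_openCube.measurableSet,
    ← lintegral_indicator (MeasurableSet.univ_pi fun _ => measurableSet_Ioo), ← lintegral_euclidean]
  refine lintegral_congr fun x => ?_
  by_cases hx : x ∈ univ.pi fun _ : ι => Ioo (0 : ℝ) 1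
  · rw [Set.indicator_of_mem hx, Set.indicator_of_mem (by exact fun i => hx i (mem_univ i))]
  · rw [Set.indicator_of_notMem hx, Set.indicator_of_notMem (by exact fun h => hx fun i _ => h i)]

theorem abs_shrink_sub_le {δ : ℝ} (hδ : 0 < δ) {x : ι → ℝ}
    (hx : ∀ j, x j ∈ Icc (0 : ℝ) 1) {z : EuclideanSpace ℝ ι} (hz : ∀ j, |z j| ≤ δ / 4) (j : ι) :
    |(shrink δ x - z).ofLp j - x j| ≤ δ := by
  have h := hz j
  rw [abs_le] at h ⊢
  have h0 := (hx j).1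
  have h1 := (hx j).2
  change -δ ≤ ((1 - δ) * x j + δ / 2 - z j) - x j ∧ ((1 - δ) * x j + δ / 2 - z j) - x j ≤ δ
  constructor <;> nlinarith [h.1, h.2]

/-- Every point that enters the average differs from `x` by at most `δ` in each coordinate, so
uniform continuity of `g` suffices. -/
theorem exists_forall_enorm_mollify_sub_le {g : EuclideanSpace ℝ ι → ℂ} (hg : Continuous g)
    (hc : HasCompactSupport g) {ε : ℝ≥0} (hε : 0 < ε) :
    ∃ δ₀ > 0, ∀ δ, 0 < δ → δ < δ₀ → ∀ ρ : Measure (EuclideanSpace ℝ ι), IsProbabilityMeasure ρ →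
      (∀ᵐ z ∂ρ, ∀ j, |z j| ≤ δ / 4) → ∀ x : ι → ℝ, (∀ j, x j ∈ Icc (0 : ℝ) 1) →
      ‖mollify ρ δ g x - g (WithLp.toLp 2 x)‖ₑ ≤ ε := by
  have huc : UniformContinuous fun x : ι → ℝ => g (WithLp.toLp 2 x) :=
    (hc.uniformContinuous_of_continuous hg).comp (PiLp.uniformContinuous_toLp 2 _)
  obtain ⟨δ₀, hδ₀, h⟩ := Metric.uniformContinuous_iff.1 huc ε (by exact_mod_cast hε)
  refine ⟨δ₀, hδ₀, fun δ hδ hδ' ρ hρ hρz x hx => ?_⟩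
  have hb : ∀ᵐ z ∂ρ, ‖g (shrink δ x - z) - g (WithLp.toLp 2 x)‖ ≤ ε := by
    filter_upwards [hρz] with z hz
    have h1 : dist (shrink δ x - z).ofLp x < δ₀ := by
      refine lt_of_le_of_lt ((dist_pi_le_iff hδ.le).2 fun j => ?_) hδ'
      rw [Real.dist_eq]
      exact abs_shrink_sub_le hδ hx hz j
    have h2 := h h1
    rw [dist_eq_norm] at h2
    exact h2.le
  obtain ⟨M, hM⟩ := hc.exists_bound_of_continuous hg
  have hint : Integrable (fun z => g (shrink δ x - z)) ρ :=
    Integrable.of_bound (hg.comp (continuous_const.sub continuous_id)).aestronglyMeasurable M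
      (Filter.Eventually.of_forall fun z => hM _)
  have h3 : mollify ρ δ g x - g (WithLp.toLp 2 x)
      = ∫ z, (g (shrink δ x - z) - g (WithLp.toLp 2 x)) ∂ρ := by
    rw [integral_sub hint (integrable_const _)]
    simp [mollify]
  have h4 := norm_integral_le_of_norm_le_const hb
  rw [← h3, probReal_univ, mul_one] at h4
  rw [← ofReal_norm]
  exact (ENNReal.ofReal_le_ofReal h4).trans (by simp)

theorem two_mul_le_of_sq (a b c d : ℂ) :
    ‖a - d‖ₑ ^ 2 ≤ 4 * (‖a - b‖ₑ ^ 2 + ‖b - c‖ₑ ^ 2 + ‖c - d‖ₑ ^ 2) := by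
  calc ‖a - d‖ₑ ^ 2 ≤ 2 * (‖a - b‖ₑ ^ 2 + ‖b - d‖ₑ ^ 2) := enorm_sub_sq_le a b d
    _ ≤ 2 * (2 * ‖a - b‖ₑ ^ 2 + 2 * (‖b - c‖ₑ ^ 2 + ‖c - d‖ₑ ^ 2)) := by
      gcongr
      · exact le_mul_of_one_le_left' (by norm_num)
      · exact enorm_sub_sq_le b c d
    _ = _ := by ring

/-- Mollifications of a square-integrable function converge in the unit cube. -/
theorem exists_forall_lintegral_mollify_sub_le {u : EuclideanSpace ℝ ι → ℂ} (hu : MemLp u 2 volume)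
    (hum : Measurable u) {ε : ℝ≥0} (hε : 0 < ε) :
    ∃ δ₀ > 0, ∀ δ, 0 < δ → δ < δ₀ → δ ≤ 1 / 2 → ∀ φ : EuclideanSpace ℝ ι → ℝ,
      IsMollifier (δ / 4) φ →
      ∫⁻ x : ι → ℝ, ‖mollify (densityMeasure φ) δ u x - u (WithLp.toLp 2 x)‖ₑ ^ 2
        ∂(Measure.pi fun _ => volume.restrict (Icc (0 : ℝ) 1)) ≤ ε := by
  rcases isEmpty_or_nonempty ι with hι | ⟨⟨i₀⟩⟩
  · refine ⟨1, one_pos, fun δ hδ _ hδ' φ hφ => ?_⟩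
    have := hφ.isProbabilityMeasure
    have h1 : ∀ x : ι → ℝ, mollify (densityMeasure φ) δ u x - u (WithLp.toLp 2 x) = 0 := fun x => by
      have h2 : ∀ z, shrink δ x - z = WithLp.toLp 2 x := fun z => Subsingleton.elim _ _
      simp [mollify, h2]
    simp [h1]
  set n := Fintype.card ι with hn
  -- The error is split into `u` against a continuous `g` after mollification, `g` against its
  -- mollification, and `g` against `u`, with bounds `2 ^ (n + 1) * η`, `η` and `η`; the factor `4`
  -- comes from squaring a sum of three terms.
  set η : ℝ≥0 := ε / (4 * (2 ^ (n + 1) + 2)) with hη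
  have hη0 : 0 < η := by positivity
  obtain ⟨g, hgc, hgu, hg, hgm⟩ := hu.exists_hasCompactSupport_eLpNorm_sub_le (by simp)
    (ε := (NNReal.sqrt η : ℝ≥0∞)) (by simpa using hη0.ne')
  have hgsq : ∫⁻ x, ‖u x - g x‖ₑ ^ 2 ≤ η := by
    have h1 := pow_le_pow_left' hgu 2
    rw [eLpNorm_eq_lintegral_rpow_enorm_toReal two_ne_zero ENNReal.ofNat_ne_top,
      ← ENNReal.rpow_natCast, ← ENNReal.rpow_mul, ← ENNReal.coe_pow, NNReal.sq_sqrt] at h1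
    norm_num at h1
    simpa using h1
  obtain ⟨δ₀, hδ₀, h⟩ := exists_forall_enorm_mollify_sub_le hg hgc (ε := NNReal.sqrt η)
    (by simpa using hη0)
  refine ⟨δ₀, hδ₀, fun δ hδ hδ1 hδ2 φ hφ => ?_⟩
  have hρ := hφ.isProbabilityMeasure
  have hcube : ∀ F : EuclideanSpace ℝ ι → ℝ≥0∞, ∫⁻ x : ι → ℝ, F (WithLp.toLp 2 x)
      ∂(Measure.pi fun _ => volume.restrict (Icc (0 : ℝ) 1)) ≤ ∫⁻ x, F x := fun F => by
    rw [← lintegral_openCube]; exact setLIntegral_le_lintegral _ _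
  have hint : ∀ {v : EuclideanSpace ℝ ι → ℂ}, MemLp v 2 volume → ∀ x : ι → ℝ,
      Integrable (fun z => v (shrink δ x - z)) (densityMeasure φ) := fun {v} hv x => by
    rw [hφ.integrable_iff]
    refine integrable_smul_of_locallyIntegrableOn (U := univ)
      (hφ.contDiff.continuous.comp (continuous_const.sub continuous_id))
      (hφ.hasCompactSupport.comp_sub _) (subset_univ _) ?_
    exact (hv.locallyIntegrable one_le_two).locallyIntegrableOn _
  have h1 : ∫⁻ x : ι → ℝ, ‖mollify (densityMeasure φ) δ u x - mollify (densityMeasure φ) δ g x‖ₑ ^ 2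
      ∂(Measure.pi fun _ => volume.restrict (Icc (0 : ℝ) 1)) ≤ 2 ^ (n + 1) * η := by
    have h2 := dirVal_mollify_le (ρ := densityMeasure φ) hδ hδ2 hφ.ae_abs_le (le_refl (0 : ℝ)) i₀
      (v := fun x => u x - g x) (hum.sub hg.measurable) fun x _ => (hint hu x).sub (hint hgm x)
    simp only [dirVal, if_true] at h2
    have h3 : ∀ x, mollify (densityMeasure φ) δ (fun x => u x - g x) x
        = mollify (densityMeasure φ) δ u x - mollify (densityMeasure φ) δ g x := fun x =>
      integral_sub (hint hu x) (hint hgm x)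
    simp only [h3] at h2
    exact h2.trans (mul_le_mul_right ((hcube fun x => ‖u x - g x‖ₑ ^ 2).trans hgsq) _)
  have h2 : ∫⁻ x : ι → ℝ, ‖mollify (densityMeasure φ) δ g x - g (WithLp.toLp 2 x)‖ₑ ^ 2
      ∂(Measure.pi fun _ => volume.restrict (Icc (0 : ℝ) 1)) ≤ η := by
    calc _ ≤ ∫⁻ x : ι → ℝ, (η : ℝ≥0∞) ∂(Measure.pi fun _ => volume.restrict (Icc (0 : ℝ) 1)) := by
          refine lintegral_mono_ae ((ae_pi_mem measurableSet_Icc).mono fun x hx => ?_)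
          have := pow_le_pow_left' (h δ hδ hδ1 _ hρ hφ.ae_abs_le x hx) 2
          rwa [← ENNReal.coe_pow, NNReal.sq_sqrt] at this
      _ = η := by simp [Measure.pi_univ]
  have h3 : ∫⁻ x : ι → ℝ, ‖g (WithLp.toLp 2 x) - u (WithLp.toLp 2 x)‖ₑ ^ 2
      ∂(Measure.pi fun _ => volume.restrict (Icc (0 : ℝ) 1)) ≤ η := by
    simp only [enorm_sub_rev (g _)]
    exact (hcube fun x => ‖u x - g x‖ₑ ^ 2).trans hgsq
  have hmg : Measurable (mollify (densityMeasure φ) δ g) := by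
    have : StronglyMeasurable (Function.uncurry fun (x : ι → ℝ) z => g (shrink δ x - z)) :=
      (hg.comp (((continuous_shrink δ).comp continuous_fst).sub continuous_snd)).stronglyMeasurable
    exact this.integral_prod_right.measurable
  have hmu : Measurable (mollify (densityMeasure φ) δ u) := by
    have : StronglyMeasurable (Function.uncurry fun (x : ι → ℝ) z => u (shrink δ x - z)) :=
      (measurable_translate hum δ).stronglyMeasurable
    exact this.integral_prod_right.measurable
  have hgl : Measurable fun x : ι → ℝ => g (WithLp.toLp 2 x) :=
    hg.measurable.comp (MeasurableEquiv.toLp 2 (ι → ℝ)).measurable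
  have m1 : Measurable fun x : ι → ℝ => ‖mollify (densityMeasure φ) δ u x
      - mollify (densityMeasure φ) δ g x‖ₑ ^ 2 := (hmu.sub hmg).enorm.pow_const 2
  have m2 : Measurable fun x : ι → ℝ => ‖mollify (densityMeasure φ) δ g x
      - g (WithLp.toLp 2 x)‖ₑ ^ 2 := (hmg.sub hgl).enorm.pow_const 2
  calc _ ≤ ∫⁻ x : ι → ℝ, 4 * (‖mollify (densityMeasure φ) δ u x
          - mollify (densityMeasure φ) δ g x‖ₑ ^ 2
        + ‖mollify (densityMeasure φ) δ g x - g (WithLp.toLp 2 x)‖ₑ ^ 2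
        + ‖g (WithLp.toLp 2 x) - u (WithLp.toLp 2 x)‖ₑ ^ 2)
        ∂(Measure.pi fun _ => volume.restrict (Icc (0 : ℝ) 1)) :=
        lintegral_mono fun x => two_mul_le_of_sq _ _ _ _
    _ ≤ 4 * (2 ^ (n + 1) * η + η + η) := by
        rw [lintegral_const_mul' _ _ (by simp), lintegral_add_left (m1.fun_add m2),
          lintegral_add_left m1]
        gcongr
    _ = ε := by
        have : 4 * (2 ^ (n + 1) * η + η + η) = ε := by
          rw [hη]
          field_simp
          ring
        exact_mod_cast this

/-- Approximation of a function with weak derivatives in the unit cube by smooth functions. -/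
theorem exists_smooth_approximation {u : EuclideanSpace ℝ ι → ℂ} (hum : Measurable u)
    (hu : MemLp u 2 (volume.restrict (openCube ι))) {m : ℕ} {v : ι → EuclideanSpace ℝ ι → ℂ}
    (hvm : ∀ i, Measurable (v i))
    (hv : ∀ i, IsWeakDeriv (openCube ι) (Pi.single i m) u (v i)) {ε : ℝ≥0} (hε : 0 < ε) :
    ∃ f : (ι → ℝ) → ℂ, ContDiff ℝ ∞ f ∧
      ∫⁻ x : ι → ℝ, ‖f x - u (WithLp.toLp 2 x)‖ₑ ^ 2
        ∂(Measure.pi fun _ => volume.restrict (Icc (0 : ℝ) 1)) ≤ ε ∧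
      ∀ i, ∀ σ : ℝ, 0 ≤ σ → dirVal (volume.restrict (Icc (0 : ℝ) 1)) σ i ((pderivC i)^[m] f)
        ≤ 2 ^ (Fintype.card ι + 1) * dirVal (volume.restrict (Icc (0 : ℝ) 1)) σ i
          (fun x => v i (WithLp.toLp 2 x)) := by
  set u₁ := (openCube ι).indicator u with hu₁
  have hO := (isOpen_openCube (ι := ι)).measurableSet
  have hu₁m : Measurable u₁ := hum.indicator hO
  have hu₁L : MemLp u₁ 2 volume := (memLp_indicator_iff_restrict hO).2 hu
  have hloc := hu₁L.locallyIntegrable one_le_two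
  obtain ⟨δ₀, hδ₀, h⟩ := exists_forall_lintegral_mollify_sub_le hu₁L hu₁m hε
  set δ := min (δ₀ / 2) (1 / 2) with hδd
  have hδ : 0 < δ := by positivity
  have hδ' : δ ≤ 1 / 2 := min_le_right _ _
  obtain ⟨φ, hφ⟩ := exists_isMollifier (ι := ι) (ε := δ / 4) (by positivity)
  have hρ := hφ.isProbabilityMeasure
  have hcv := h δ hδ ((min_le_left _ _).trans_lt (by linarith)) hδ' φ hφ
  have hmoll : mollify (densityMeasure φ) δ u₁ = fun x => ∫ y, φ (shrink δ x - y) • u₁ y :=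
    funext fun x => hφ.integral_eq _ _
  refine ⟨fun x => ∫ y, φ (shrink δ x - y) • u₁ y,
    contDiff_mollify hφ.contDiff hφ.hasCompactSupport hloc δ, ?_, fun i σ hσ => ?_⟩
  · rw [hmoll] at hcv
    refine le_trans (lintegral_mono_ae ?_) hcv
    have : ∀ᵐ x : ι → ℝ ∂(Measure.pi fun _ => volume.restrict (Icc (0 : ℝ) 1)),
        ∀ i, x i ∈ Ioo (0 : ℝ) 1 := by
      rw [pi_restrict_Icc_eq]; exact ae_pi_mem measurableSet_Ioo
    filter_upwards [this] with x hx
    have hmem : (WithLp.toLp 2 x : EuclideanSpace ℝ ι) ∈ openCube ι := hx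
    rw [hu₁, Set.indicator_of_mem hmem]
  · rw [iterate_pderivC_mollify hφ.contDiff hφ.hasCompactSupport hloc]
    -- On the closed cube the `m`-th derivative is `(1 - δ) ^ m` times the mollification of `v i`.
    -- The factor is at most `1`, which gives a bound uniform in `δ`.
    have heq : ∀ x : ι → ℝ, (∀ j, x j ∈ Icc (0 : ℝ) 1) →
        ∫ y, (partialD i)^[m] φ (shrink δ x - y) • u₁ y = mollify (densityMeasure φ) δ (v i) x :=
      fun x hx => by
        rw [integral_iterate_partialD_eq_of_isWeakDeriv hδ hδ' hφ (hv i) hx]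
        exact (hφ.integral_eq _ _).symm
    have hc1 : ‖(1 - δ) ^ m‖ₑ ≤ 1 := by
      rw [← ofReal_norm, ← ENNReal.ofReal_one]
      refine ENNReal.ofReal_le_ofReal ?_
      rw [norm_pow, Real.norm_of_nonneg (by linarith)]
      exact pow_le_one₀ (by linarith) (by linarith)
    refine (dirVal_mono measurableSet_Icc σ i (G := mollify (densityMeasure φ) δ (v i))
      (fun x hx => ?_) fun x y hx hy => ?_).trans
      (dirVal_mollify_le hδ hδ' hφ.ae_abs_le hσ i (hvm i) fun x hx => ?_)
    · rw [heq x hx, enorm_smul]; exact mul_le_of_le_one_left' hc1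
    · rw [heq x hx, heq y hy, ← smul_sub, enorm_smul]; exact mul_le_of_le_one_left' hc1
    · rw [hφ.integrable_iff]
      refine integrable_smul_of_locallyIntegrableOn (U := openCube ι)
        (hφ.contDiff.continuous.comp (continuous_const.sub continuous_id))
        (hφ.hasCompactSupport.comp_sub _) (fun y hy => ?_) (hv i).locallyIntegrable_right
      replace hy : y ∈ tsupport (fun y => φ (shrink δ x - y)) := hy
      rw [tsupport_comp_sub] at hy
      exact mem_openCube_of_mem_tsupport hδ hδ' hφ hx hy

end ApproximationInCube

/-! ### The extension operator and its weighted Fourier bounds -/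

section Extension

variable {ι : Type} [Fintype ι] [DecidableEq ι]

theorem exists_isCutoff_eq_one :
    ∃ χ : EuclideanSpace ℝ ι → ℝ, IsCutoff χ ∧ ∀ x : EuclideanSpace ℝ ι,
      (∀ i, x i ∈ Icc (0 : ℝ) 1) → χ x = 1 := by
  let b : ContDiffBump (1 / 2 : ℝ) := ⟨1 / 2, 1, by norm_num, by norm_num⟩
  have hb : ∀ t, b t ≠ 0 → t ∈ Icc (-1 : ℝ) 2 := fun t ht => by
    have h1 : t ∈ Function.support b := ht
    rw [b.support_eq, Metric.mem_ball, Real.dist_eq, abs_lt] at h1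
    change -1 < t - 1 / 2 ∧ t - 1 / 2 < 1 at h1
    constructor <;> linarith
  set K : Set (EuclideanSpace ℝ ι) := {x | ∀ i, x i ∈ Icc (-1 : ℝ) 2} with hK
  have hKc : IsCompact K := by
    have h1 : IsCompact (univ.pi fun _ : ι => Icc (-1 : ℝ) 2) :=
      isCompact_univ_pi fun _ => isCompact_Icc
    have h2 := h1.image (PiLp.continuous_toLp 2 fun _ : ι => ℝ)
    convert h2 using 1
    ext x
    constructor
    · exact fun hx => ⟨x.ofLp, fun i _ => hx i, rfl⟩
    · rintro ⟨y, hy, rfl⟩; exact fun i => hy i (mem_univ i)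
  have hsupp : Function.support (fun x : EuclideanSpace ℝ ι => ∏ i, b (x i)) ⊆ K := fun x hx i =>
    hb _ (Finset.prod_ne_zero_iff.1 hx i (Finset.mem_univ i))
  have hts : tsupport (fun x : EuclideanSpace ℝ ι => ∏ i, b (x i)) ⊆ K :=
    closure_minimal hsupp hKc.isClosed
  refine ⟨fun x => ∏ i, b (x i), ⟨contDiff_prod fun i _ => b.contDiff.comp (by fun_prop),
    HasCompactSupport.of_support_subset_isCompact hKc hsupp, fun x hx => hts hx⟩, fun x hx => ?_⟩
  refine Finset.prod_eq_one fun i _ => b.one_of_mem_closedBall ?_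
  rw [Metric.mem_closedBall, Real.dist_eq, abs_le]
  change -(1 / 2) ≤ x i - 1 / 2 ∧ x i - 1 / 2 ≤ 1 / 2
  constructor <;> linarith [(hx i).1, (hx i).2]

theorem ennreal_le_of_forall_le_add_mul {A B D : ℝ≥0∞} (hD : D ≠ ⊤)
    (h : ∀ ε : ℝ≥0, 0 < ε → A ≤ B + D * ε) : A ≤ B := by
  refine ENNReal.le_of_forall_pos_le_add fun ε hε _ => ?_
  lift D to ℝ≥0 using hD
  refine (h (ε / (D + 1)) (by positivity)).trans ?_
  gcongr
  rw [← ENNReal.coe_mul, ENNReal.coe_le_coe, mul_div_assoc', div_le_iff₀ (by positivity), mul_comm]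
  gcongr
  exact le_self_add

/-- Monotone convergence in the truncation of the weight. A bounded weight defines an
`L²`-continuous functional, so the truncated bounds survive `L²` limits. -/
theorem lintegral_mul_le_of_forall_min {α : Type*} [MeasurableSpace α] {μ : Measure α}
    {P F : α → ℝ≥0∞} (hP : Measurable P) (hF : AEMeasurable F μ) {B : ℝ≥0∞}
    (h : ∀ n : ℕ, ∫⁻ x, min (P x) n * F x ∂μ ≤ B) : ∫⁻ x, P x * F x ∂μ ≤ B := by
  have h1 : ∀ x, P x * F x = ⨆ n : ℕ, min (P x) n * F x := fun x => by
    rw [← ENNReal.iSup_mul, ← inf_iSup_eq, ENNReal.iSup_natCast, inf_top_eq]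
  simp only [h1]
  rw [lintegral_iSup' (fun n => (hP.min measurable_const).aemeasurable.fun_mul hF)]
  · exact iSup_le h
  · refine Filter.Eventually.of_forall fun x k l hkl => ?_
    dsimp only
    gcongr

theorem cutoffMul_reflOp_sub {K : Type} [Fintype K] (χ : EuclideanSpace ℝ ι → ℝ) (a r : K → ℝ)
    (p : ℕ) (i : ι) (F G : (ι → ℝ) → ℂ) :
    cutoffMul χ (reflOp a r p i fun x => F x - G x)
      = fun x => cutoffMul χ (reflOp a r p i F) x - cutoffMul χ (reflOp a r p i G) x := by
  funext x
  simp only [cutoffMul, reflOp, smul_sub, Finset.sum_sub_distrib]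

/-- Extension of a function from the unit cube, with the regularity expressed by the Fourier
transform. -/
theorem exists_extension_fourierL2 [Nonempty ι] (m : ℕ) {σ : ℝ} (hσ : 0 ≤ σ) (hσ1 : σ < 1) :
    ∃ C : ℝ≥0, ∀ u : EuclideanSpace ℝ ι → ℂ, Measurable u →
      MemLp u 2 (volume.restrict (openCube ι)) →
      ∀ v : ι → EuclideanSpace ℝ ι → ℂ, (∀ i, Measurable (v i)) →
      (∀ i, IsWeakDeriv (openCube ι) (Pi.single i m) u (v i)) →
      ∃ (w : EuclideanSpace ℝ ι → ℂ) (hw : MemLp w 2 volume), HasCompactSupport w ∧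
        (∀ x ∈ openCube ι, w x = u x) ∧
        ∫⁻ x, ‖w x‖ₑ ^ 2 ≤ C * ∫⁻ x in openCube ι, ‖u x‖ₑ ^ 2 ∧
        ∀ i, ∫⁻ ξ, ‖ξ i‖ₑ ^ (2 * (m + σ)) * ‖fourierL2 hw ξ‖ₑ ^ 2
          ≤ C * ((∫⁻ x in openCube ι, ‖u x‖ₑ ^ 2)
            + dirVal (volume.restrict (Icc (0 : ℝ) 1)) σ i fun x => v i (WithLp.toLp 2 x)) := by
  obtain ⟨i₀⟩ := ‹Nonempty ι›
  obtain ⟨a, ha⟩ := exists_reflection_coefficients m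
  set r : Fin (m + 1) → ℝ := fun k => ((k : ℝ) + 1)⁻¹ with hr
  have h0 : ∀ k, 0 < r k := fun k => by positivity
  have h1 : ∀ k, r k ≤ 1 := fun k => inv_le_one_of_one_le₀ (by simp)
  obtain ⟨χ, hχ, hχ1⟩ := exists_isCutoff_eq_one (ι := ι)
  obtain ⟨C₁, hC₁⟩ := hχ.exists_lintegral_sq_le
  obtain ⟨C₂, hC₂⟩ := exists_dirVal_reflOp_le (ι := ι) a h0 h1 0 i₀ i₀ (le_refl (0 : ℝ))
  simp only [dirVal, if_true] at hC₂
  choose C₃ hC₃ using fun i => exists_lintegral_weight_fourierL2_reflOp_le ha h0 h1 i hσ hσ1 hχ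
  have hL2 : ∀ F : (ι → ℝ) → ℂ, Measurable F → ∫⁻ x, ‖cutoffMul χ (reflOp a r 0 i₀ F) x‖ₑ ^ 2
      ≤ C₁ * C₂ * ∫⁻ x, ‖F x‖ₑ ^ 2 ∂(Measure.pi fun _ => volume.restrict (Icc (0 : ℝ) 1)) :=
    fun F hF => (hC₁ _).trans (by rw [mul_assoc]; exact mul_le_mul_right (hC₂ F hF) _)
  set n := Fintype.card ι with hn
  refine ⟨C₁ * C₂ + ∑ i, 2 * C₃ i * (2 + 2 ^ (n + 1)), fun u hum hu v hvm hv => ?_⟩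
  set U : (ι → ℝ) → ℂ := fun x => u (WithLp.toLp 2 x) with hU
  have hUm : Measurable U := hum.comp (MeasurableEquiv.toLp 2 (ι → ℝ)).measurable
  set w := cutoffMul χ (reflOp a r 0 i₀ U) with hw
  have hwm : Measurable w := hχ.measurable_mul (measurable_reflOp a h0 h1 0 i₀ hUm)
  set I := ∫⁻ x in openCube ι, ‖u x‖ₑ ^ 2 with hI
  have hIU : ∫⁻ x, ‖U x‖ₑ ^ 2 ∂(Measure.pi fun _ => volume.restrict (Icc (0 : ℝ) 1)) = I :=
    (lintegral_openCube fun x => ‖u x‖ₑ ^ 2).symm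
  have hIt : I < ⊤ := by
    have := hu.2
    rw [eLpNorm_lt_top_iff_lintegral_rpow_enorm_lt_top two_ne_zero ENNReal.ofNat_ne_top] at this
    simpa [hI] using this
  have hwI : ∫⁻ x, ‖w x‖ₑ ^ 2 ≤ C₁ * C₂ * I := hIU ▸ hL2 U hUm
  have hwL : MemLp w 2 volume := by
    refine ⟨hwm.aestronglyMeasurable, ?_⟩
    rw [eLpNorm_lt_top_iff_lintegral_rpow_enorm_lt_top two_ne_zero ENNReal.ofNat_ne_top]
    have : ∫⁻ x, ‖w x‖ₑ ^ 2 < ⊤ := hwI.trans_lt (ENNReal.mul_lt_top (by finiteness) hIt)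
    simpa using this
  refine ⟨w, hwL, hχ.hasCompactSupport_mul _, fun x hx => ?_, ?_, fun i => ?_⟩
  · have hx' : ∀ i, x i ∈ Icc (0 : ℝ) 1 := fun i => Ioo_subset_Icc_self (hx i)
    rw [hw, cutoffMul, hχ1 x hx', one_smul,
      reflOp_zero_of_mem (by simpa using ha 0 (Nat.zero_le m)) r i₀ U hx']
  · refine hwI.trans (mul_le_mul_left ?_ _)
    push_cast
    exact le_self_add
  · set V := dirVal (volume.restrict (Icc (0 : ℝ) 1)) σ i fun x => v i (WithLp.toLp 2 x) with hV
    have hbound : ∫⁻ ξ, ‖ξ i‖ₑ ^ (2 * (m + σ)) * ‖fourierL2 hwL ξ‖ₑ ^ 2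
        ≤ 2 * C₃ i * (2 * I + 2 ^ (n + 1) * V) := by
      have hwF : AEMeasurable (fun ξ => ‖fourierL2 hwL ξ‖ₑ ^ 2) volume :=
        (memLp_fourierL2 _).aestronglyMeasurable.aemeasurable.enorm.pow_const 2
      -- The smooth approximations are only known to converge in `L²`. With the weight cut off at
      -- `M` the approximation error is at most a multiple of `M * ε`, which vanishes as `ε → 0` for
      -- fixed `M`.
      refine lintegral_mul_le_of_forall_min (by fun_prop) hwF fun M => ?_
      refine ennreal_le_of_forall_le_add_mul (D := 2 * (C₃ i * 2 + M * (C₁ * C₂))) (by finiteness)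
        fun ε hε => ?_
      obtain ⟨f, hf, hfu, hfv⟩ := exists_smooth_approximation hum hu hvm hv hε
      have hfc := continuous_reflOp (p := 0) (i := i₀) a h0 h1 hf.continuous
      have hfL := hχ.memLp_mul hfc
      have hf1 : ∫⁻ ξ, ‖ξ i‖ₑ ^ (2 * (m + σ)) * ‖fourierL2 hfL ξ‖ₑ ^ 2
          ≤ C₃ i * ((∫⁻ x, ‖f x‖ₑ ^ 2 ∂(Measure.pi fun _ => volume.restrict (Icc (0 : ℝ) 1)))
            + dirVal (volume.restrict (Icc (0 : ℝ) 1)) σ i ((pderivC i)^[m] f)) := by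
        have h := hC₃ i f hf
        -- The bound in direction `i` refers to the same extension, formed with the fixed index
        -- `i₀`.
        rw [reflOp_zero_eq a _ i i₀] at h
        exact h hfL
      have hf2 : ∫⁻ ξ, ‖ξ i‖ₑ ^ (2 * (m + σ)) * ‖fourierL2 hfL ξ‖ₑ ^ 2
          ≤ C₃ i * ((2 * I + 2 * ε) + 2 ^ (n + 1) * V) := by
        refine hf1.trans (mul_le_mul_right (add_le_add ?_ (hfv i σ hσ)) _)
        calc _ ≤ ∫⁻ x, (2 * ‖U x‖ₑ ^ 2 + 2 * ‖f x - U x‖ₑ ^ 2)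
              ∂(Measure.pi fun _ => volume.restrict (Icc (0 : ℝ) 1)) := by
              refine lintegral_mono fun x => ?_
              have := enorm_sub_sq_le (f x) (U x) 0
              rw [sub_zero, sub_zero] at this
              refine this.trans (le_of_eq (by ring))
          _ = 2 * I + 2 * ∫⁻ x, ‖f x - U x‖ₑ ^ 2
              ∂(Measure.pi fun _ => volume.restrict (Icc (0 : ℝ) 1)) := by
              rw [lintegral_add_left ((hUm.enorm.pow_const 2).const_mul _),
                lintegral_const_mul' _ _ (by simp), lintegral_const_mul' _ _ (by simp), hIU]
          _ ≤ _ := by gcongr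
      have hd := hwL.sub hfL
      have hd1 : ∫⁻ ξ, ‖fourierL2 hd ξ‖ₑ ^ 2 ≤ C₁ * C₂ * ε := by
        rw [lintegral_fourierL2_sq]
        have e : w - cutoffMul χ (reflOp a r 0 i₀ f)
            = cutoffMul χ (reflOp a r 0 i₀ fun x => U x - f x) := by
          rw [cutoffMul_reflOp_sub]; rfl
        rw [e]
        refine (hL2 _ (hUm.sub hf.continuous.measurable)).trans (mul_le_mul_right ?_ _)
        exact le_trans (le_of_eq (lintegral_congr fun x => congrArg (· ^ 2) (enorm_sub_rev _ _))) hfu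
      have hpt : ∀ᵐ ξ : EuclideanSpace ℝ ι, min (‖ξ i‖ₑ ^ (2 * (m + σ))) M * ‖fourierL2 hwL ξ‖ₑ ^ 2
          ≤ 2 * (‖ξ i‖ₑ ^ (2 * (m + σ)) * ‖fourierL2 hfL ξ‖ₑ ^ 2)
            + 2 * (M * ‖fourierL2 hd ξ‖ₑ ^ 2) := by
        filter_upwards [fourierL2_sub hwL hfL hd] with ξ hξ
        have := enorm_sub_sq_le (fourierL2 hwL ξ) (fourierL2 hfL ξ) 0
        rw [sub_zero, sub_zero, ← hξ] at this
        calc _ ≤ min (‖ξ i‖ₑ ^ (2 * (m + σ))) M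
              * (2 * (‖fourierL2 hd ξ‖ₑ ^ 2 + ‖fourierL2 hfL ξ‖ₑ ^ 2)) := by gcongr
          _ = 2 * (min (‖ξ i‖ₑ ^ (2 * (m + σ))) M * ‖fourierL2 hfL ξ‖ₑ ^ 2)
              + 2 * (min (‖ξ i‖ₑ ^ (2 * (m + σ))) M * ‖fourierL2 hd ξ‖ₑ ^ 2) := by ring
          _ ≤ _ := by
            gcongr
            · exact min_le_left _ _
            · exact min_le_right _ _
      have hfF : AEMeasurable (fun ξ => ‖fourierL2 hfL ξ‖ₑ ^ 2) volume :=
        (memLp_fourierL2 _).aestronglyMeasurable.aemeasurable.enorm.pow_const 2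
      calc _ ≤ _ := lintegral_mono_ae hpt
        _ = 2 * (∫⁻ ξ, ‖ξ i‖ₑ ^ (2 * (m + σ)) * ‖fourierL2 hfL ξ‖ₑ ^ 2)
            + 2 * (M * ∫⁻ ξ, ‖fourierL2 hd ξ‖ₑ ^ 2) := by
          rw [lintegral_add_left' ((AEMeasurable.fun_mul (by fun_prop) hfF).const_mul _),
            lintegral_const_mul' _ _ (by simp), lintegral_const_mul' _ _ (by simp),
            lintegral_const_mul' _ _ (by simp)]
        _ ≤ 2 * (C₃ i * ((2 * I + 2 * ε) + 2 ^ (n + 1) * V)) + 2 * (M * (C₁ * C₂ * ε)) := by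
          gcongr
        _ = _ := by ring
    refine hbound.trans ?_
    calc 2 * (C₃ i : ℝ≥0∞) * (2 * I + 2 ^ (n + 1) * V)
        ≤ 2 * C₃ i * ((2 + 2 ^ (n + 1)) * I + (2 + 2 ^ (n + 1)) * V) := by
          gcongr
          · exact le_self_add
          · exact le_add_self
      _ = ((2 * C₃ i * (2 + 2 ^ (n + 1)) : ℝ≥0) : ℝ≥0∞) * (I + V) := by push_cast; ring
      _ ≤ _ := by
          refine mul_le_mul_left (ENNReal.coe_le_coe.2 ?_) _
          exact (Finset.single_le_sum (f := fun i => 2 * C₃ i * (2 + 2 ^ (n + 1)))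
            (fun _ _ => zero_le) (Finset.mem_univ i)).trans le_add_self

end Extension

/-! ### Mixed derivatives from pure ones -/

section Derivatives

variable {ι : Type} [Fintype ι] [DecidableEq ι]

/-- Every coordinate of `ξ` is bounded by the largest one in modulus, and the total degree is `2(m +
σ)` on both sides. -/
theorem enorm_rpow_mul_symbol_sq_le [Nonempty ι] {m : ℕ} {β : ι → ℕ} (hβ : ∑ i, β i = m) {σ : ℝ}
    (hσ : 0 ≤ σ) (k : ι) (ξ : EuclideanSpace ℝ ι) :
    ‖ξ k‖ₑ ^ (2 * σ) * ‖symbol β ξ‖ₑ ^ 2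
      ≤ ‖(2 * Real.pi : ℝ)‖ₑ ^ (2 * m) * ∑ i, ‖ξ i‖ₑ ^ (2 * (m + σ)) := by
  obtain ⟨i, hi⟩ := Finite.exists_max fun j => ‖ξ j‖ₑ
  have h1 : ‖symbol β ξ‖ₑ ≤ ‖(2 * Real.pi : ℝ)‖ₑ ^ m * ‖ξ i‖ₑ ^ m := by
    have e : ‖symbol β ξ‖ₑ = ∏ j, (‖(2 * Real.pi : ℝ)‖ₑ * ‖ξ j‖ₑ) ^ β j := by
      simp only [symbol, ← ofReal_norm, norm_prod, norm_pow, norm_mul, Complex.norm_I, mul_one,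
        Complex.norm_real, RCLike.norm_ofNat]
      rw [ENNReal.ofReal_prod_of_nonneg fun _ _ => by positivity]
      refine Finset.prod_congr rfl fun j _ => ?_
      rw [ENNReal.ofReal_pow (by positivity), ENNReal.ofReal_mul (by positivity)]
    rw [e, ← mul_pow, ← hβ, ← Finset.prod_pow_eq_pow_sum]
    gcongr with j
    exact hi j
  calc ‖ξ k‖ₑ ^ (2 * σ) * ‖symbol β ξ‖ₑ ^ 2
      ≤ ‖ξ i‖ₑ ^ (2 * σ) * (‖(2 * Real.pi : ℝ)‖ₑ ^ m * ‖ξ i‖ₑ ^ m) ^ 2 := by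
        gcongr
        exact hi k
    _ = ‖(2 * Real.pi : ℝ)‖ₑ ^ (2 * m) * ‖ξ i‖ₑ ^ (2 * (m + σ)) := by
        rw [mul_pow, ← pow_mul, ← pow_mul, mul_add,
          ENNReal.rpow_add_of_nonneg _ _ (by positivity) (by positivity), mul_comm m 2,
          show (2 * (m : ℝ)) = ((2 * m : ℕ) : ℝ) by push_cast; ring, ENNReal.rpow_natCast]
        ring
    _ ≤ _ := by
        gcongr
        exact Finset.single_le_sum (f := fun i => ‖ξ i‖ₑ ^ (2 * (m + σ))) (fun _ _ => zero_le)
          (Finset.mem_univ i)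

theorem dirVal_eq_lintegral_fourierL2 {σ : ℝ} (hσ : 0 ≤ σ) (i : ι)
    {v : EuclideanSpace ℝ ι → ℂ} (hv : MemLp v 2 volume) (hvm : Measurable v) :
    dirVal volume σ i (fun x => v (WithLp.toLp 2 x))
      = (if σ = 0 then 1 else gagConst σ)
        * ∫⁻ ξ, ‖ξ i‖ₑ ^ (2 * σ) * ‖fourierL2 hv ξ‖ₑ ^ 2 := by
  rcases hσ.eq_or_lt with rfl | h
  · simp only [dirVal, if_true, mul_zero, ENNReal.rpow_zero, one_mul]
    rw [lintegral_fourierL2_sq, ← lintegral_euclidean]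
  · simp only [dirVal, h.ne', if_false]
    exact dirGag_eq_lintegral_fourierL2 h i hv hvm

theorem enorm_rpow_le_one_add (x : ℝ≥0∞) {p q : ℝ} (hp : 0 ≤ p) (hpq : p ≤ q) :
    x ^ p ≤ 1 + x ^ q := by
  rcases le_total x 1 with h | h
  · exact (ENNReal.rpow_le_one h hp).trans le_self_add
  · exact (ENNReal.rpow_le_rpow_of_exponent_le h hpq).trans le_add_self

/-- Extension of a function from the unit cube, with all weak derivatives of order `m`. -/
theorem exists_extension_weakDeriv [Nonempty ι] (m : ℕ) {σ : ℝ} (hσ : 0 ≤ σ) (hσ1 : σ < 1) :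
    ∃ C : ℝ≥0, ∀ u : EuclideanSpace ℝ ι → ℂ, Measurable u →
      MemLp u 2 (volume.restrict (openCube ι)) →
      ∀ v : ι → EuclideanSpace ℝ ι → ℂ, (∀ i, Measurable (v i)) →
      (∀ i, IsWeakDeriv (openCube ι) (Pi.single i m) u (v i)) →
      (∀ i, dirVal (volume.restrict (Icc (0 : ℝ) 1)) σ i (fun x => v i (WithLp.toLp 2 x)) ≠ ⊤) →
      ∃ w : EuclideanSpace ℝ ι → ℂ, MemLp w 2 volume ∧ HasCompactSupport w ∧
        (∀ x ∈ openCube ι, w x = u x) ∧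
        ∫⁻ x, ‖w x‖ₑ ^ 2 ≤ C * ∫⁻ x in openCube ι, ‖u x‖ₑ ^ 2 ∧
        ∀ β : ι → ℕ, ∑ i, β i = m → ∃ g : EuclideanSpace ℝ ι → ℂ, Measurable g ∧
          IsWeakDeriv univ β w g ∧ ∀ k, dirVal volume σ k (fun x => g (WithLp.toLp 2 x))
            ≤ C * ((∫⁻ x in openCube ι, ‖u x‖ₑ ^ 2)
              + ∑ i, dirVal (volume.restrict (Icc (0 : ℝ) 1)) σ i
                fun x => v i (WithLp.toLp 2 x)) := by
  obtain ⟨C, hC⟩ := exists_extension_fourierL2 (ι := ι) m hσ hσ1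
  set G : ℝ≥0∞ := if σ = 0 then 1 else gagConst σ with hG
  have hGt : G ≠ ⊤ := by
    rw [hG]
    split_ifs with h
    · exact ENNReal.one_ne_top
    · exact gagConst_ne_top (lt_of_le_of_ne hσ (Ne.symm h)) hσ1
  set P : ℝ≥0∞ := ‖(2 * Real.pi : ℝ)‖ₑ ^ (2 * m) with hP
  have hPt : P ≠ ⊤ := by finiteness
  set n := Fintype.card ι
  -- `n * C` comes from summing the weighted bounds over the coordinates, `P` from the powers of
  -- `2π` in the symbol, and `G` from converting a Fourier weight into a directional seminorm.
  refine ⟨C + (G * P * (n * C)).toNNReal, fun u hum hu v hvm hv hvt => ?_⟩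
  rw [ENNReal.coe_add, ENNReal.coe_toNNReal (by finiteness)]
  obtain ⟨w, hw, hwc, hwu, hwI, hwi⟩ := hC u hum hu v hvm hv
  set I := ∫⁻ x in openCube ι, ‖u x‖ₑ ^ 2 with hI
  have hIt : I ≠ ⊤ := by
    have := hu.2
    rw [eLpNorm_lt_top_iff_lintegral_rpow_enorm_lt_top two_ne_zero ENNReal.ofNat_ne_top] at this
    simpa [hI] using this.ne
  set D := fun i => dirVal (volume.restrict (Icc (0 : ℝ) 1)) σ i (fun x => v i (WithLp.toLp 2 x))
    with hD
  have hwF : AEMeasurable (fun ξ => ‖fourierL2 hw ξ‖ₑ ^ 2) volume :=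
    (memLp_fourierL2 _).aestronglyMeasurable.aemeasurable.enorm.pow_const 2
  have hsum : ∫⁻ ξ, (∑ i, ‖ξ i‖ₑ ^ (2 * (m + σ))) * ‖fourierL2 hw ξ‖ₑ ^ 2
      ≤ n * C * (I + ∑ i, D i) := by
    simp only [Finset.sum_mul]
    rw [lintegral_finsetSum' _ fun i _ => AEMeasurable.fun_mul (by fun_prop) hwF]
    calc _ ≤ ∑ _i : ι, C * (I + ∑ i, D i) := by
          refine Finset.sum_le_sum fun i _ => (hwi i).trans ?_
          gcongr
          exact Finset.single_le_sum (f := D) (fun _ _ => zero_le) (Finset.mem_univ i)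
      _ = _ := by rw [Finset.sum_const, nsmul_eq_mul, Finset.card_univ, mul_assoc]
  refine ⟨w, hw, hwc, hwu, hwI.trans (mul_le_mul_left le_self_add _), fun β hβ => ?_⟩
  -- The weight of order `2m` is bounded by `1` plus that of order `2(m + σ)`; both are integrable
  -- against `|ŵ|²`, since the directional seminorms of the `v i` are finite.
  have hsym : MemLp (fun ξ => symbol β ξ * fourierL2 hw ξ) 2 volume := by
    refine ⟨(continuous_symbol β).aestronglyMeasurable.mul
      (memLp_fourierL2 _).aestronglyMeasurable, ?_⟩
    rw [eLpNorm_lt_top_iff_lintegral_rpow_enorm_lt_top two_ne_zero ENNReal.ofNat_ne_top]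
    have key : ∫⁻ ξ, ‖symbol β ξ * fourierL2 hw ξ‖ₑ ^ 2
        ≤ P * ((n * ∫⁻ ξ, ‖fourierL2 hw ξ‖ₑ ^ 2) + n * C * (I + ∑ i, D i)) := by
      calc _ ≤ ∫⁻ ξ, P * (n * ‖fourierL2 hw ξ‖ₑ ^ 2
            + (∑ i, ‖ξ i‖ₑ ^ (2 * (m + σ))) * ‖fourierL2 hw ξ‖ₑ ^ 2) := by
            refine lintegral_mono fun ξ => ?_
            have h := enorm_rpow_mul_symbol_sq_le hβ le_rfl (Classical.arbitrary ι) ξ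
            rw [mul_zero, ENNReal.rpow_zero, one_mul] at h
            rw [enorm_mul, mul_pow, ← add_mul, ← mul_assoc]
            refine mul_le_mul_left (h.trans (mul_le_mul_right ?_ _)) _
            calc _ ≤ ∑ i, (1 + ‖ξ i‖ₑ ^ (2 * (m + σ))) := Finset.sum_le_sum fun i _ =>
                  enorm_rpow_le_one_add _ (by positivity) (by linarith)
              _ = _ := by simp [Finset.sum_add_distrib, n]
        _ = P * ((n * ∫⁻ ξ, ‖fourierL2 hw ξ‖ₑ ^ 2)
            + ∫⁻ ξ, (∑ i, ‖ξ i‖ₑ ^ (2 * (m + σ))) * ‖fourierL2 hw ξ‖ₑ ^ 2) := by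
            rw [lintegral_const_mul' _ _ hPt, lintegral_add_left' (hwF.const_mul _),
              lintegral_const_mul' _ _ (by simp)]
        _ ≤ _ := by gcongr
    have hlt : ∫⁻ ξ, ‖symbol β ξ * fourierL2 hw ξ‖ₑ ^ 2 < ⊤ := by
      refine key.trans_lt ?_
      rw [lintegral_fourierL2_sq]
      have h1 : ∫⁻ x, ‖w x‖ₑ ^ 2 ≠ ⊤ := (hwI.trans_lt (by finiteness)).ne
      have h2 : ∑ i, D i ≠ ⊤ := ENNReal.sum_ne_top.2 fun i _ => hvt i
      finiteness
    simpa using hlt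
  obtain ⟨g, hg, hgm, hgw, hgF⟩ := exists_weakDeriv_of_fourierL2 hw β hsym
  refine ⟨g, hgm.measurable, hgw, fun k => ?_⟩
  rw [dirVal_eq_lintegral_fourierL2 hσ k hg hgm.measurable]
  calc _ ≤ G * ∫⁻ ξ, P * ((∑ i, ‖ξ i‖ₑ ^ (2 * (m + σ))) * ‖fourierL2 hw ξ‖ₑ ^ 2) := by
        refine mul_le_mul_right (lintegral_mono_ae ?_) _
        filter_upwards [hgF] with ξ hξ
        rw [hξ, enorm_mul, mul_pow, ← mul_assoc, ← mul_assoc]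
        exact mul_le_mul_left (enorm_rpow_mul_symbol_sq_le hβ hσ k ξ) _
    _ ≤ G * (P * (n * C * (I + ∑ i, D i))) := by
        rw [lintegral_const_mul' _ _ hPt]
        gcongr
    _ = G * P * (n * C) * (I + ∑ i, D i) := by ring
    _ ≤ _ := mul_le_mul_left le_add_self _

end Derivatives

/-! ### Restriction and uniqueness of weak derivatives -/

section WeakDerivative

variable {ι : Type} [Fintype ι] [DecidableEq ι] {U : Set (EuclideanSpace ℝ ι)} {α : ι → ℕ}
  {u u' v v' : EuclideanSpace ℝ ι → ℂ}

theorem tsupport_multiD_subset (α : ι → ℕ) (φ : EuclideanSpace ℝ ι → ℝ) :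
    tsupport (multiD α φ) ⊆ tsupport φ := by
  unfold multiD
  induction (Finset.univ : Finset ι).toList with
  | nil => exact subset_rfl
  | cons i l ih =>
    rw [List.foldr_cons]
    exact (tsupport_iterate_partialD_subset _ i _).trans ih

theorem setIntegral_smul_eq {f : EuclideanSpace ℝ ι → ℝ} (hf : tsupport f ⊆ U)
    (v : EuclideanSpace ℝ ι → ℂ) : ∫ x in U, f x • v x = ∫ x, f x • v x :=
  setIntegral_eq_integral_of_forall_compl_eq_zero fun x hx => by
    rw [image_eq_zero_of_notMem_tsupport fun h => hx (hf h), zero_smul]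

theorem IsWeakDeriv.mono {V : Set (EuclideanSpace ℝ ι)} (h : IsWeakDeriv V α u v) (hU : U ⊆ V) :
    IsWeakDeriv U α u v :=
  ⟨h.locallyIntegrable_left.mono_set hU, h.locallyIntegrable_right.mono_set hU,
    fun φ h1 h2 h3 => by
      have := h.integral_eq φ h1 h2 (h3.trans hU)
      rwa [setIntegral_smul_eq ((tsupport_multiD_subset α φ).trans (h3.trans hU)),
        setIntegral_smul_eq (h3.trans hU),
        ← setIntegral_smul_eq ((tsupport_multiD_subset α φ).trans h3),
        ← setIntegral_smul_eq h3] at this⟩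

theorem IsWeakDeriv.congr_left (h : IsWeakDeriv U α u v) (hu : u =ᵐ[volume.restrict U] u') :
    IsWeakDeriv U α u' v :=
  ⟨h.locallyIntegrable_left.congr hu, h.locallyIntegrable_right, fun φ h1 h2 h3 => by
    rw [← h.integral_eq φ h1 h2 h3]
    exact integral_congr_ae (hu.mono fun x hx => by simp only [hx])⟩

theorem IsWeakDeriv.congr_right (h : IsWeakDeriv U α u v) (hv : v =ᵐ[volume.restrict U] v') :
    IsWeakDeriv U α u v' :=
  ⟨h.locallyIntegrable_left, h.locallyIntegrable_right.congr hv, fun φ h1 h2 h3 => by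
    rw [h.integral_eq φ h1 h2 h3]
    exact congrArg _ (integral_congr_ae (hv.mono fun x hx => by simp only [hx]))⟩

/-- Weak derivatives are unique up to null sets. -/
theorem IsWeakDeriv.ae_eq (hU : IsOpen U) (h : IsWeakDeriv U α u v) (h' : IsWeakDeriv U α u v') :
    v =ᵐ[volume.restrict U] v' := by
  have key := hU.ae_eq_zero_of_integral_contDiff_smul_eq_zero (μ := volume)
    (h.locallyIntegrable_right.sub h'.locallyIntegrable_right) fun φ h1 h2 h3 => by
      have e := (h.integral_eq φ h1 h2 h3).symm.trans (h'.integral_eq φ h1 h2 h3)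
      have e' := smul_right_injective ℂ (by simp : ((-1 : ℝ) ^ ∑ i, α i) ≠ 0) e
      rw [setIntegral_smul_eq h3, setIntegral_smul_eq h3] at e'
      simp only [Pi.sub_apply, smul_sub]
      rw [integral_sub (integrable_smul_of_locallyIntegrableOn h1.continuous h2 h3
        h.locallyIntegrable_right) (integrable_smul_of_locallyIntegrableOn h1.continuous h2 h3
        h'.locallyIntegrable_right), e', sub_self]
  rw [Filter.EventuallyEq, ae_restrict_iff' hU.measurableSet]
  filter_upwards [key] with x hx hxU
  exact sub_eq_zero.1 (hx hxU)

theorem IsWeakDeriv.exists_measurable (h : IsWeakDeriv U α u v) :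
    ∃ v', Measurable v' ∧ v =ᵐ[volume.restrict U] v' ∧ IsWeakDeriv U α u v' := by
  have hm := h.locallyIntegrable_right.aestronglyMeasurable
  exact ⟨hm.mk v, hm.stronglyMeasurable_mk.measurable, hm.ae_eq_mk, h.congr_right hm.ae_eq_mk⟩

end WeakDerivative

/-! ### Block seminorms of weak derivatives -/

section Block

variable {ι κ : Type} [Fintype ι] [Fintype κ] [DecidableEq ι] [DecidableEq κ]

/-- Replacing a block of coordinates by an independent sample keeps the law; the overwritten
coordinates of `x` integrate to total mass one. Hence Gagliardo integrals do not change if `v` is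
altered on a null set. -/
theorem measurePreserving_extend {e : κ → ι} (he : e.Injective) (μ : Measure ℝ)
    [IsProbabilityMeasure μ] :
    MeasurePreserving (fun p : (ι → ℝ) × (κ → ℝ) => Function.extend e p.2 p.1)
      ((Measure.pi fun _ : ι => μ).prod (Measure.pi fun _ : κ => μ))
      (Measure.pi fun _ : ι => μ) := by
  classical
  refine ⟨measurable_extend e, (Measure.pi_eq fun s hs => ?_).symm⟩
  rw [Measure.map_apply (measurable_extend e) (MeasurableSet.univ_pi hs)]
  have h1 : (fun p : (ι → ℝ) × (κ → ℝ) => Function.extend e p.2 p.1) ⁻¹' univ.pi s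
      = (univ.pi fun i => if i ∈ Finset.univ.image e then univ else s i)
        ×ˢ (univ.pi fun k => s (e k)) := by
    ext p
    simp only [mem_preimage, mem_pi, mem_univ, true_imp_iff, mem_prod]
    constructor
    · refine fun h => ⟨fun i => ?_, fun k => by simpa [he.extend_apply] using h (e k)⟩
      split_ifs with hi
      · trivial
      · have := h i
        rwa [Function.extend_apply' _ _ _ fun ⟨k, hk⟩ => hi (by simp [← hk])] at this
    · rintro ⟨h, h'⟩ i
      by_cases hi : ∃ k, e k = i
      · obtain ⟨k, rfl⟩ := hi
        simpa [he.extend_apply] using h' k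
      · have := h i
        rw [if_neg (by simpa using hi)] at this
        rwa [Function.extend_apply' _ _ _ hi]
  rw [h1, Measure.prod_prod, Measure.pi_pi, Measure.pi_pi]
  have h2 : ∏ k, μ (s (e k)) = ∏ i, if i ∈ Finset.univ.image e then μ (s i) else 1 := by
    rw [Finset.prod_ite_mem, Finset.univ_inter, Finset.prod_image he.injOn]
  rw [h2, ← Finset.prod_mul_distrib]
  refine Finset.prod_congr rfl fun i _ => ?_
  split_ifs <;> simp

/-- The seminorm of order `σ` in the block of coordinates selected by `e`, which for `σ = 0` is the
norm in `L²`. -/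
noncomputable def blockVal (e : κ → ι) (μ : Measure ℝ) (σ : ℝ) (v : (ι → ℝ) → ℂ) : ℝ≥0∞ :=
  if σ = 0 then ∫⁻ x, ‖v x‖ₑ ^ 2 ∂(Measure.pi fun _ => μ) else blockGag e μ σ v

theorem blockVal_congr {e : κ → ι} (he : e.Injective) {μ : Measure ℝ} [IsProbabilityMeasure μ]
    {σ : ℝ} {v v' : (ι → ℝ) → ℂ} (h : v =ᵐ[Measure.pi fun _ => μ] v') :
    blockVal e μ σ v = blockVal e μ σ v' := by
  unfold blockVal
  split_ifs
  · exact lintegral_congr_ae (h.mono fun x hx => by simp only [hx])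
  · have h1 := Measure.ae_ae_of_ae_prod
      ((measurePreserving_extend he μ).quasiMeasurePreserving.ae_eq_comp h)
    refine lintegral_congr_ae ?_
    filter_upwards [h, h1] with x hx hx1
    refine lintegral_congr_ae ?_
    filter_upwards [hx1] with y hy
    simp only [Function.comp_apply] at hy
    rw [hx, hy]

theorem exists_dirVal_le_blockVal {e : κ → ι} (he : e.Injective) {σ : ℝ} (hσ : 0 ≤ σ) :
    ∃ C : ℝ≥0, ∀ (k : κ) (v : (ι → ℝ) → ℂ), Measurable v →
      dirVal (volume.restrict (Icc 0 1)) σ (e k) v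
        ≤ C * blockVal e (volume.restrict (Icc 0 1)) σ v := by
  rcases hσ.eq_or_lt with rfl | h
  · exact ⟨1, fun k v _ => by simp [dirVal, blockVal]⟩
  · simpa only [dirVal, blockVal, h.ne', if_false] using exists_dirGag_le_blockGag he h

theorem exists_blockVal_le_sum_dirVal [Nonempty κ] {e : κ → ι} (he : e.Injective) {σ : ℝ}
    (hσ : 0 ≤ σ) :
    ∃ C : ℝ≥0, ∀ (μ : Measure ℝ) [SigmaFinite μ], μ ≤ volume → ∀ v : (ι → ℝ) → ℂ, Measurable v →
      blockVal e μ σ v ≤ C * ∑ k, dirVal μ σ (e k) v := by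
  rcases hσ.eq_or_lt with rfl | h
  · refine ⟨1, fun μ _ _ v _ => ?_⟩
    simp only [dirVal, blockVal, if_true, ENNReal.coe_one, one_mul]
    exact Finset.single_le_sum (f := fun _ : κ => ∫⁻ x, ‖v x‖ₑ ^ 2 ∂(Measure.pi fun _ => μ))
      (fun _ _ => zero_le) (Finset.mem_univ (Classical.arbitrary κ))
  · simpa only [dirVal, blockVal, h.ne', if_false] using exists_blockGag_le_sum_dirGag he h

theorem dirVal_le_volume {μ : Measure ℝ} [SigmaFinite μ] {I : Set ℝ} (σ : ℝ) (i : ι)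
    (v : (ι → ℝ) → ℂ) :
    dirVal (volume.restrict I) σ i v ≤ dirVal volume σ i v := by
  have h : (Measure.pi fun _ : ι => volume.restrict I) ≤ Measure.pi fun _ : ι => volume := by
    rw [← Measure.restrict_pi_pi]
    exact Measure.restrict_le_self
  unfold dirVal dirGag
  split_ifs
  · exact lintegral_mono' h le_rfl
  · exact lintegral_mono' h fun x => lintegral_mono' Measure.restrict_le_self le_rfl

/-- The seminorm `blockVal` of the weak derivative of order `α` on `U`. -/
noncomputable def weakVal (e : κ → ι) (μ : Measure ℝ) (U : Set (EuclideanSpace ℝ ι)) (σ : ℝ)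
    (α : ι → ℕ) (u : EuclideanSpace ℝ ι → ℂ) : ℝ≥0∞ :=
  ⨅ (v : EuclideanSpace ℝ ι → ℂ) (_ : IsWeakDeriv U α u v),
    blockVal e μ σ fun x => v (WithLp.toLp 2 x)

theorem ae_toLp_of_ae_openCube {p : EuclideanSpace ℝ ι → Prop}
    (h : ∀ᵐ x ∂volume.restrict (openCube ι), p x) :
    ∀ᵐ x ∂(Measure.pi fun _ : ι => volume.restrict (Icc (0 : ℝ) 1)), p (WithLp.toLp 2 x) := by
  have hm : Measure.map (WithLp.toLp 2) (Measure.pi fun _ : ι => volume.restrict (Icc (0 : ℝ) 1))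
      = volume.restrict (openCube ι) := by
    refine Measure.ext_of_lintegral _ fun F hF => ?_
    rw [lintegral_openCube]
    exact lintegral_map (f := F) (g := WithLp.toLp 2) hF
      (MeasurableEquiv.toLp 2 (ι → ℝ)).measurable
  rw [← hm] at h
  exact ae_of_ae_map (MeasurableEquiv.toLp 2 (ι → ℝ)).measurable.aemeasurable h

instance : IsProbabilityMeasure (volume.restrict (Icc (0 : ℝ) 1)) := ⟨by simp⟩

/-- Weak derivatives agree almost everywhere, so the infimum runs over functions with one common
value of the seminorm. -/
theorem weakVal_eq {e : κ → ι} (he : e.Injective) {σ : ℝ} {α : ι → ℕ}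
    {u v : EuclideanSpace ℝ ι → ℂ} (hv : IsWeakDeriv (openCube ι) α u v) :
    weakVal e (volume.restrict (Icc 0 1)) (openCube ι) σ α u
      = blockVal e (volume.restrict (Icc 0 1)) σ fun x => v (WithLp.toLp 2 x) := by
  refine le_antisymm (iInf₂_le v hv) (le_iInf₂ fun v' hv' => le_of_eq ?_)
  exact blockVal_congr he (ae_toLp_of_ae_openCube (hv.ae_eq isOpen_openCube hv'))

theorem exists_measurable_of_weakVal_ne_top {e : κ → ι} {σ : ℝ} {α : ι → ℕ}
    {u : EuclideanSpace ℝ ι → ℂ}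
    (h : weakVal e (volume.restrict (Icc 0 1)) (openCube ι) σ α u ≠ ⊤) :
    ∃ v, Measurable v ∧ IsWeakDeriv (openCube ι) α u v := by
  have h1 := h.lt_top
  simp only [weakVal, iInf_lt_iff] at h1
  obtain ⟨v, hv, -⟩ := h1
  obtain ⟨v', h1, -, h2⟩ := hv.exists_measurable
  exact ⟨v', h1, h2⟩

/-- On the unit cube the seminorm in a block of variables is controlled by the full seminorm. -/
theorem exists_weakVal_le [Nonempty κ] {e : κ → ι} (he : e.Injective) {σ : ℝ} (hσ : 0 ≤ σ) :
    ∃ C : ℝ≥0, ∀ (α : ι → ℕ) (u : EuclideanSpace ℝ ι → ℂ),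
      weakVal e (volume.restrict (Icc 0 1)) (openCube ι) σ α u
        ≤ C * weakVal id (volume.restrict (Icc 0 1)) (openCube ι) σ α u := by
  obtain ⟨C, hC⟩ := exists_blockVal_le_sum_dirVal he hσ
  obtain ⟨C', hC'⟩ := exists_dirVal_le_blockVal (ι := ι) Function.injective_id hσ
  -- The comparison passes through the single coordinates of the block `e`, each of which belongs to
  -- the block of all coordinates. The summand `1` keeps the constant nonzero when the right side is
  -- infinite.
  refine ⟨C * (Fintype.card κ * C') + 1, fun α u => ?_⟩
  by_cases h : weakVal id (volume.restrict (Icc 0 1)) (openCube ι) σ α u = ⊤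
  · rw [h, ENNReal.mul_top (by simp)]
    exact le_top
  obtain ⟨v, hvm, hv⟩ := exists_measurable_of_weakVal_ne_top h
  have hvm' : Measurable fun x : ι → ℝ => v (WithLp.toLp 2 x) :=
    hvm.comp (MeasurableEquiv.toLp 2 (ι → ℝ)).measurable
  rw [weakVal_eq he hv, weakVal_eq Function.injective_id hv]
  refine (hC _ Measure.restrict_le_self _ hvm').trans ?_
  calc _ ≤ C * ∑ _k : κ, C' * blockVal id (volume.restrict (Icc 0 1)) σ
        (fun x => v (WithLp.toLp 2 x)) := by
        gcongr with k
        exact hC' (e k) _ hvm'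
    _ = ((C * (Fintype.card κ * C') : ℝ≥0) : ℝ≥0∞) * blockVal id (volume.restrict (Icc 0 1)) σ
        (fun x => v (WithLp.toLp 2 x)) := by
        rw [Finset.sum_const, nsmul_eq_mul, Finset.card_univ]
        push_cast
        ring
    _ ≤ _ := by
        gcongr
        exact le_self_add

end Block

/-! ### Extension in terms of the particle blocks -/

section Product

variable {ν κ : Type} [Fintype ν] [Fintype κ] [DecidableEq ν] [DecidableEq κ]

theorem measurable_comp_toLp {ι : Type} [Fintype ι] {v : EuclideanSpace ℝ ι → ℂ}
    (hv : Measurable v) : Measurable fun x : ι → ℝ => v (WithLp.toLp 2 x) :=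
  hv.comp (MeasurableEquiv.toLp 2 (ι → ℝ)).measurable

/-- Extension from the unit cube, in terms of the seminorms in the blocks of a product. -/
theorem exists_extension_weakVal [Nonempty ν] [Nonempty κ] (m : ℕ) {σ : ℝ} (hσ : 0 ≤ σ)
    (hσ1 : σ < 1) :
    ∃ C : ℝ≥0, ∀ u : EuclideanSpace ℝ (ν × κ) → ℂ,
      MemLp u 2 (volume.restrict (openCube (ν × κ))) →
      (∀ j k, weakVal (Prod.mk j) (volume.restrict (Icc 0 1)) (openCube (ν × κ)) σ
        (Pi.single (j, k) m) u ≠ ⊤) →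
      ∀ T, T = (∫⁻ x in openCube (ν × κ), ‖u x‖ₑ ^ 2) + ∑ j, ∑ k,
        weakVal (Prod.mk j) (volume.restrict (Icc 0 1)) (openCube (ν × κ)) σ
          (Pi.single (j, k) m) u →
      ∃ w : EuclideanSpace ℝ (ν × κ) → ℂ, MemLp w 2 volume ∧ HasCompactSupport w ∧
        w =ᵐ[volume.restrict (openCube (ν × κ))] u ∧
        ∫⁻ x, ‖w x‖ₑ ^ 2 ≤ C * T ∧
        (∀ j β, ∑ i, β i = m → weakVal (Prod.mk j) volume univ σ β w ≤ C * T) ∧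
        (∀ β, ∑ i, β i = m →
          weakVal id (volume.restrict (Icc 0 1)) (openCube (ν × κ)) σ β u ≤ C * T) := by
  have hinj : ∀ j : ν, Function.Injective (Prod.mk j : κ → ν × κ) := fun j =>
    Prod.mk_right_injective j
  obtain ⟨C, hC⟩ := exists_extension_weakDeriv (ι := ν × κ) m hσ hσ1
  choose D hD using fun j : ν => exists_dirVal_le_blockVal (hinj j) hσ
  choose B hB using fun j : ν => exists_blockVal_le_sum_dirVal (hinj j) hσ
  obtain ⟨B', hB'⟩ := exists_blockVal_le_sum_dirVal (ι := ν × κ) Function.injective_id hσ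
  set S : ℝ≥0 := ∑ j, D j with hS
  set R : ℝ≥0 := C * (1 + S) with hR
  refine ⟨R + ∑ j, B j * (Fintype.card κ * R) + B' * (Fintype.card (ν × κ) * R),
    fun u hu hfin T hT => ?_⟩
  choose v' hvm' hv' using fun j k => exists_measurable_of_weakVal_ne_top (hfin j k)
  set v : ν × κ → EuclideanSpace ℝ (ν × κ) → ℂ := fun i => v' i.1 i.2 with hv
  set μ : Measure ℝ := volume.restrict (Icc (0 : ℝ) 1) with hμ
  -- The coordinate `(j, k)` belongs to the block of the `j`-th particle, so the hypothesis on the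
  -- block bounds the directional seminorm.
  have hval : ∀ j k, dirVal μ σ (j, k) (fun x => v' j k (WithLp.toLp 2 x))
      ≤ D j * weakVal (Prod.mk j) μ (openCube (ν × κ)) σ (Pi.single (j, k) m) u := fun j k => by
    rw [weakVal_eq (hinj j) (hv' j k)]
    exact hD j k _ (measurable_comp_toLp (hvm' j k))
  have hu' := hu.1.ae_eq_mk
  set u' := hu.1.mk u with hu'def
  obtain ⟨w, hwL, hwc, hwu, hw2, hwβ⟩ := hC u' hu.1.stronglyMeasurable_mk.measurable
    (hu.ae_eq hu') v (fun i => hvm' i.1 i.2) (fun i => (hv' i.1 i.2).congr_left hu')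
    (fun i => ((hval i.1 i.2).trans_lt (ENNReal.mul_lt_top ENNReal.coe_lt_top
      (hfin i.1 i.2).lt_top)).ne)
  have hwu' : w =ᵐ[volume.restrict (openCube (ν × κ))] u := by
    filter_upwards [hu', ae_restrict_mem isOpen_openCube.measurableSet] with x hx hx'
    rw [hwu x hx', hx]
  have hI : ∫⁻ x in openCube (ν × κ), ‖u' x‖ₑ ^ 2 = ∫⁻ x in openCube (ν × κ), ‖u x‖ₑ ^ 2 :=
    lintegral_congr_ae (hu'.mono fun x hx => by simp only [hx])
  rw [hI] at hw2 hwβ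
  have hT' : (∫⁻ x in openCube (ν × κ), ‖u x‖ₑ ^ 2)
      + ∑ i, dirVal μ σ i (fun x => v i (WithLp.toLp 2 x)) ≤ (1 + S) * T := by
    rw [Fintype.sum_prod_type, hT, mul_add]
    refine add_le_add (le_mul_of_one_le_left' (by simp)) ?_
    rw [Finset.mul_sum]
    refine Finset.sum_le_sum fun j _ => ?_
    rw [Finset.mul_sum]
    refine Finset.sum_le_sum fun k _ => (hval j k).trans ?_
    gcongr
    rw [hS]
    refine le_trans ?_ le_add_self
    exact ENNReal.coe_le_coe.2
      (Finset.single_le_sum (f := D) (fun _ _ => zero_le) (Finset.mem_univ j))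
  have hR' : ∀ β, ∑ i, β i = m → ∃ g : EuclideanSpace ℝ (ν × κ) → ℂ, Measurable g ∧
      IsWeakDeriv univ β w g ∧
        ∀ k, dirVal volume σ k (fun x => g (WithLp.toLp 2 x)) ≤ R * T := fun β hβ => by
    obtain ⟨g, h1, h2, h3⟩ := hwβ β hβ
    refine ⟨g, h1, h2, fun k => (h3 k).trans ?_⟩
    rw [hR, ENNReal.coe_mul, mul_assoc]
    gcongr
    simpa using hT'
  refine ⟨w, hwL, hwc, hwu', hw2.trans ?_, fun j β hβ => ?_, fun β hβ => ?_⟩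
  · have h1 : (C : ℝ≥0∞) * ∫⁻ x in openCube (ν × κ), ‖u x‖ₑ ^ 2 ≤ C * ((1 + S) * T) := by
      gcongr
      exact le_self_add.trans hT'
    refine h1.trans ?_
    rw [← mul_assoc]
    refine mul_le_mul_left ?_ _
    rw [hR]
    push_cast
    rw [add_assoc]
    exact le_self_add
  -- On the whole space the directional seminorms are reassembled into the block of the `j`-th
  -- particle.
  · obtain ⟨g, h1, h2, h3⟩ := hR' β hβ
    calc _ ≤ blockVal (Prod.mk j) volume σ fun x => g (WithLp.toLp 2 x) := iInf₂_le g h2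
      _ ≤ B j * ∑ k, dirVal volume σ (j, k) fun x => g (WithLp.toLp 2 x) :=
          hB j _ le_rfl _ (measurable_comp_toLp h1)
      _ ≤ B j * ∑ _k : κ, R * T := by
          gcongr with k
          exact h3 (j, k)
      _ = ((B j * (Fintype.card κ * R) : ℝ≥0) : ℝ≥0∞) * T := by
          rw [Finset.sum_const, nsmul_eq_mul, Finset.card_univ]
          push_cast
          ring
      _ ≤ _ := by
          refine mul_le_mul_left (ENNReal.coe_le_coe.2 ?_) _
          refine (Finset.single_le_sum (f := fun j => B j * (Fintype.card κ * R))
            (fun _ _ => zero_le) (Finset.mem_univ j)).trans ?_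
          exact le_add_self.trans le_self_add
  -- Restricted to the cube, `g` is a weak derivative of `u` itself, and the directional seminorms
  -- are reassembled into the single block of all coordinates.
  · obtain ⟨g, h1, h2, h3⟩ := hR' β hβ
    have h4 : IsWeakDeriv (openCube (ν × κ)) β u g := (h2.mono (subset_univ _)).congr_left hwu'
    calc _ ≤ blockVal id μ σ fun x => g (WithLp.toLp 2 x) := iInf₂_le g h4
      _ ≤ B' * ∑ k, dirVal μ σ k fun x => g (WithLp.toLp 2 x) :=
          hB' _ Measure.restrict_le_self _ (measurable_comp_toLp h1)
      _ ≤ B' * ∑ _k : ν × κ, R * T := by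
          gcongr with k
          exact (dirVal_le_volume (μ := volume) σ k _).trans (h3 k)
      _ = ((B' * (Fintype.card (ν × κ) * R) : ℝ≥0) : ℝ≥0∞) * T := by
          rw [Finset.sum_const, nsmul_eq_mul, Finset.card_univ]
          push_cast
          ring
      _ ≤ _ := mul_le_mul_left (ENNReal.coe_le_coe.2 le_add_self) _

end Product

/-! ### Sobolev and many-body seminorms as block seminorms -/

section Seminorms

/-- The normalization of the seminorm of order `σ`. -/
noncomputable def sobolevConst (n : ℕ) (σ : ℝ) : ℝ≥0∞ :=
  if σ = 0 then 1 else ENNReal.ofReal (fracConst n σ)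

theorem sobolevConst_ne_top (n : ℕ) (σ : ℝ) : sobolevConst n σ ≠ ⊤ := by
  unfold sobolevConst
  split_ifs <;> simp

/-- For `0 < σ < 1` the point `-σ` is not a pole of the Gamma function, so the normalization is
positive and can be divided out. -/
theorem sobolevConst_ne_zero (n : ℕ) {σ : ℝ} (hσ : 0 ≤ σ) (hσ1 : σ < 1) :
    sobolevConst n σ ≠ 0 := by
  unfold sobolevConst
  split_ifs with h
  · exact one_ne_zero
  · have h0 : 0 < σ := lt_of_le_of_ne hσ (Ne.symm h)
    have h1 : Real.Gamma (-σ) ≠ 0 := Real.Gamma_ne_zero fun k hk => by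
      have hk' : (k : ℝ) = σ := by linarith
      have h2 : k < 1 := by exact_mod_cast hk' ▸ hσ1
      have h3 : 0 < k := by exact_mod_cast hk'.symm ▸ h0
      omega
    have h2 : 0 < Real.Gamma ((n + 2 * σ) / 2) := Real.Gamma_pos_of_pos (by positivity)
    have h3 : 0 < |Real.Gamma (-σ)| := abs_pos.2 h1
    have : 0 < fracConst n σ := by
      unfold fracConst
      positivity
    simpa using this

/-- The full seminorm is the case of the block of all coordinates, `e = id`. -/
theorem homSobolevSq_eq {ι : Type} [Fintype ι] [DecidableEq ι] {Ω : Set (EuclideanSpace ℝ ι)}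
    {μ : Measure ℝ} (hΩ : ∀ F : EuclideanSpace ℝ ι → ℝ≥0∞, ∫⁻ x in Ω, F x
      = ∫⁻ x : ι → ℝ, F (WithLp.toLp 2 x) ∂(Measure.pi fun _ => μ))
    (s : ℝ) (u : EuclideanSpace ℝ ι → ℂ) :
    homSobolevSq s Ω u = sobolevConst (Fintype.card ι) (s - ⌊s⌋₊) *
      ∑ α ∈ Finset.piAntidiag (Finset.univ : Finset ι) ⌊s⌋₊,
        (Nat.multinomial Finset.univ α : ℝ≥0∞) * weakVal id μ (interior Ω) (s - ⌊s⌋₊) α u := by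
  have hid : ∀ x y : ι → ℝ, Function.extend id y x = y := fun x y => funext fun i =>
    Function.injective_id.extend_apply y x i
  unfold homSobolevSq sobolevConst weakVal blockVal blockGag
  by_cases h : s = ⌊s⌋₊
  · have h' : s - ⌊s⌋₊ = 0 := sub_eq_zero.2 h
    rw [if_pos h]
    simp only [h', if_true, one_mul, hΩ]
  · have h' : s - ⌊s⌋₊ ≠ 0 := sub_ne_zero.2 h
    rw [if_neg h]
    simp only [h', if_false, hΩ, hid, id]

/-- The variable `x_j` is the block `Prod.mk j`, and `replaceParticle` is the replacement of this
block. -/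
theorem manyBodySq_eq {d N : ℕ} {Ω : Set (EuclideanSpace ℝ (Fin d))} {μ : Measure ℝ}
    (hΩ : ∀ F : EuclideanSpace ℝ (Fin d) → ℝ≥0∞, ∫⁻ x in Ω, F x
      = ∫⁻ x : Fin d → ℝ, F (WithLp.toLp 2 x) ∂(Measure.pi fun _ => μ))
    (hΩN : ∀ F : EuclideanSpace ℝ (Fin N × Fin d) → ℝ≥0∞, ∫⁻ x in powSet N Ω, F x
      = ∫⁻ x : Fin N × Fin d → ℝ, F (WithLp.toLp 2 x) ∂(Measure.pi fun _ => μ))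
    (s : ℝ) (u : EuclideanSpace ℝ (Fin N × Fin d) → ℂ) :
    manyBodySq s Ω u = ∑ j : Fin N, sobolevConst d (s - ⌊s⌋₊) *
      ∑ α ∈ Finset.piAntidiag (Finset.univ : Finset (Fin d)) ⌊s⌋₊,
        (Nat.multinomial Finset.univ α : ℝ≥0∞) *
          weakVal (Prod.mk j) μ (interior (powSet N Ω)) (s - ⌊s⌋₊) (particleIndex j α) u := by
  have hrep : ∀ (j : Fin N) (x : Fin N × Fin d → ℝ) (y : Fin d → ℝ),
      replaceParticle j (WithLp.toLp 2 x) (WithLp.toLp 2 y)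
        = WithLp.toLp 2 (Function.extend (Prod.mk j) y x) := fun j x y => by
    refine congrArg (WithLp.toLp 2) (funext fun p => ?_)
    obtain ⟨l, k⟩ := p
    by_cases hl : l = j
    · subst hl
      simp [(Prod.mk_right_injective l).extend_apply]
    · rw [Function.extend_apply' _ _ _ fun ⟨a, ha⟩ => hl (congrArg Prod.fst ha).symm]
      simp [hl]
  unfold manyBodySq sobolevConst weakVal blockVal blockGag
  by_cases h : s = ⌊s⌋₊
  · have h' : s - ⌊s⌋₊ = 0 := sub_eq_zero.2 h
    rw [if_pos h]
    simp only [h', if_true, one_mul, hΩN]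
  · have h' : s - ⌊s⌋₊ ≠ 0 := sub_ne_zero.2 h
    rw [if_neg h]
    simp only [h', if_false, hΩ, hΩN, hrep, particle, Fintype.card_fin]

theorem lintegral_closedCube {ι : Type} [Fintype ι] (F : EuclideanSpace ℝ ι → ℝ≥0∞) :
    ∫⁻ x in {x : EuclideanSpace ℝ ι | ∀ i, x i ∈ Icc (0 : ℝ) 1}, F x
      = ∫⁻ x : ι → ℝ, F (WithLp.toLp 2 x)
        ∂(Measure.pi fun _ => volume.restrict (Icc (0 : ℝ) 1)) := by
  have hm : MeasurableSet {x : EuclideanSpace ℝ ι | ∀ i, x i ∈ Icc (0 : ℝ) 1} := by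
    rw [ofPred_forall]
    exact MeasurableSet.iInter fun i => measurableSet_Icc.preimage (by fun_prop)
  classical
  rw [← Measure.restrict_pi_pi, ← lintegral_indicator hm,
    ← lintegral_indicator (MeasurableSet.univ_pi fun _ => measurableSet_Icc), ← lintegral_euclidean]
  refine lintegral_congr fun x => ?_
  by_cases hx : x ∈ univ.pi fun _ : ι => Icc (0 : ℝ) 1
  · rw [Set.indicator_of_mem hx, Set.indicator_of_mem (by exact fun i => hx i (mem_univ i))]
  · rw [Set.indicator_of_notMem hx, Set.indicator_of_notMem (by exact fun h => hx fun i _ => h i)]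

theorem interior_closedCube {ι : Type} [Fintype ι] :
    interior {x : EuclideanSpace ℝ ι | ∀ i, x i ∈ Icc (0 : ℝ) 1} = openCube ι := by
  have h := (PiLp.homeomorph 2 fun _ : ι => ℝ).preimage_interior (univ.pi fun _ : ι => Icc (0 : ℝ) 1)
  rw [interior_pi_set finite_univ] at h
  simp only [interior_Icc] at h
  convert h.symm using 1
  · congr 1
    ext x
    simp [PiLp.homeomorph, Pi.le_def, forall_and]
  · ext x
    simp [openCube, PiLp.homeomorph]

theorem powSet_unitCube (d N : ℕ) :
    powSet N (unitCube d) = {x | ∀ p, x p ∈ Icc (0 : ℝ) 1} := by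
  ext x
  exact ⟨fun h p => h p.1 p.2, fun h j k => h (j, k)⟩

theorem interior_powSet_unitCube (d N : ℕ) :
    interior (powSet N (unitCube d)) = openCube (Fin N × Fin d) := by
  rw [powSet_unitCube, interior_closedCube]

theorem lintegral_unitCube (d : ℕ) (F : EuclideanSpace ℝ (Fin d) → ℝ≥0∞) :
    ∫⁻ x in unitCube d, F x = ∫⁻ x : Fin d → ℝ, F (WithLp.toLp 2 x)
      ∂(Measure.pi fun _ => volume.restrict (Icc (0 : ℝ) 1)) :=
  lintegral_closedCube F

theorem lintegral_powSet_unitCube (d N : ℕ) (F : EuclideanSpace ℝ (Fin N × Fin d) → ℝ≥0∞) :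
    ∫⁻ x in powSet N (unitCube d), F x = ∫⁻ x : Fin N × Fin d → ℝ, F (WithLp.toLp 2 x)
      ∂(Measure.pi fun _ => volume.restrict (Icc (0 : ℝ) 1)) := by
  rw [powSet_unitCube, lintegral_closedCube]

theorem restrict_powSet_unitCube (d N : ℕ) :
    (volume : Measure (EuclideanSpace ℝ (Fin N × Fin d))).restrict (powSet N (unitCube d))
      = volume.restrict (openCube (Fin N × Fin d)) := by
  refine Measure.ext_of_lintegral _ fun F _ => ?_
  rw [lintegral_powSet_unitCube, lintegral_openCube]

end Seminorms

/-! ### Comparison of the two seminorms on the cube -/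

section Comparison

theorem le_inv_mul_mul_sum {α : Type*} {A : Finset α} {c : ℝ≥0∞} (hc : c ≠ 0) (hc' : c ≠ ⊤)
    {M F : α → ℝ≥0∞} {a : α} (ha : a ∈ A) (hM : 1 ≤ M a) :
    F a ≤ c⁻¹ * (c * ∑ b ∈ A, M b * F b) := by
  rw [← mul_assoc, ENNReal.inv_mul_cancel hc hc', one_mul]
  exact (le_mul_of_one_le_left' hM).trans
    (Finset.single_le_sum (f := fun b => M b * F b) (fun _ _ => zero_le) ha)

theorem one_le_multinomial {ι : Type} [Fintype ι] (α : ι → ℕ) :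
    (1 : ℝ≥0∞) ≤ (Nat.multinomial Finset.univ α : ℝ≥0∞) := by
  exact_mod_cast Nat.multinomial_pos Finset.univ α

theorem sum_particleIndex {d N : ℕ} (j : Fin N) (α : Fin d → ℕ) :
    ∑ p, particleIndex j α p = ∑ k, α k := by
  simp [Fintype.sum_prod_type, particleIndex, Finset.sum_ite_irrel]

theorem particleIndex_single {d N : ℕ} (j : Fin N) (k : Fin d) (m : ℕ) :
    particleIndex j (Pi.single k m) = Pi.single (j, k) m := by
  funext p
  obtain ⟨l, i⟩ := p
  by_cases hl : l = j <;> by_cases hi : i = k <;> simp [particleIndex, hl, hi]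

theorem lintegral_univ_euclidean {ι : Type} [Fintype ι] (F : EuclideanSpace ℝ ι → ℝ≥0∞) :
    ∫⁻ x in univ, F x = ∫⁻ x : ι → ℝ, F (WithLp.toLp 2 x) ∂(Measure.pi fun _ => volume) := by
  classical
  rw [Measure.restrict_univ, lintegral_euclidean]

variable (d N : ℕ) {s : ℝ}

/-- This is the lower bound in (i), which needs no extension: each derivative in one particle is a
derivative of the same order on the product, and its block seminorm is bounded by the full one. -/
theorem exists_manyBodySq_le_homSobolevSq (hd : 1 ≤ d) (hs : 0 < s) :
    ∃ K : ℝ≥0, ∀ u : EuclideanSpace ℝ (Fin N × Fin d) → ℂ,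
      manyBodySq s (unitCube d) u ≤ K * homSobolevSq s (powSet N (unitCube d)) u := by
  have hσ : 0 ≤ s - ⌊s⌋₊ := sub_nonneg.2 (Nat.floor_le hs.le)
  have hσ1 : s - ⌊s⌋₊ < 1 := by linarith [Nat.lt_floor_add_one s]
  have : Nonempty (Fin d) := ⟨⟨0, hd⟩⟩
  choose C hC using fun j : Fin N =>
    exists_weakVal_le (e := (Prod.mk j : Fin d → Fin N × Fin d)) (Prod.mk_right_injective j) hσ
  set c := sobolevConst (Fintype.card (Fin N × Fin d)) (s - ⌊s⌋₊) with hc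
  have hc0 : c ≠ 0 := sobolevConst_ne_zero _ hσ hσ1
  have hct : c ≠ ⊤ := sobolevConst_ne_top _ _
  set K : ℝ≥0∞ := ∑ j : Fin N, sobolevConst d (s - ⌊s⌋₊) *
    ∑ α ∈ Finset.piAntidiag (Finset.univ : Finset (Fin d)) ⌊s⌋₊,
      (Nat.multinomial Finset.univ α : ℝ≥0∞) * (C j * c⁻¹) with hK
  have hKt : K ≠ ⊤ := ENNReal.sum_ne_top.2 fun j _ =>
    ENNReal.mul_ne_top (sobolevConst_ne_top _ _) (ENNReal.sum_ne_top.2 fun α _ =>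
      ENNReal.mul_ne_top (by simp) (ENNReal.mul_ne_top (by simp) (ENNReal.inv_ne_top.2 hc0)))
  refine ⟨K.toNNReal, fun u => ?_⟩
  rw [ENNReal.coe_toNNReal hKt, manyBodySq_eq (lintegral_unitCube d) (lintegral_powSet_unitCube d N),
    homSobolevSq_eq (lintegral_powSet_unitCube d N), interior_powSet_unitCube, ← hc, hK]
  rw [Finset.sum_mul]
  refine Finset.sum_le_sum fun j _ => ?_
  rw [mul_assoc, Finset.sum_mul]
  refine mul_le_mul_right (Finset.sum_le_sum fun α hα => ?_) _
  have hβ : particleIndex j α ∈ Finset.piAntidiag (Finset.univ : Finset (Fin N × Fin d)) ⌊s⌋₊ := by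
    rw [Finset.mem_piAntidiag] at hα ⊢
    exact ⟨(sum_particleIndex j α).trans hα.1, fun _ _ => Finset.mem_univ _⟩
  rw [mul_assoc, mul_assoc]
  exact mul_le_mul_right ((hC j _ u).trans (mul_le_mul_right
    (le_inv_mul_mul_sum (F := fun β => weakVal id (volume.restrict (Icc 0 1))
      (openCube (Fin N × Fin d)) (s - ⌊s⌋₊) β u)
      (M := fun β => (Nat.multinomial Finset.univ β : ℝ≥0∞)) hc0 hct hβ
      (one_le_multinomial _)) _)) _

/-- Extension from the cube `Q^N`, together with the bound for the full Sobolev seminorm. -/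
theorem exists_extension_manyBodySq (hd : 1 ≤ d) (hN : 1 ≤ N) (hs : 0 < s) :
    ∃ K : ℝ≥0, ∀ u : EuclideanSpace ℝ (Fin N × Fin d) → ℂ,
      MemLp u 2 (volume.restrict (powSet N (unitCube d))) →
      manyBodySq s (unitCube d) u ≠ ⊤ →
      ∀ T, T = (∫⁻ x in powSet N (unitCube d), ‖u x‖ₑ ^ 2) + manyBodySq s (unitCube d) u →
      homSobolevSq s (powSet N (unitCube d)) u ≤ K * T ∧
      ∃ w : EuclideanSpace ℝ (Fin N × Fin d) → ℂ, MemLp w 2 volume ∧ HasCompactSupport w ∧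
        w =ᵐ[volume.restrict (powSet N (unitCube d))] u ∧ ∫⁻ x, ‖w x‖ₑ ^ 2 ≤ K * T ∧
        manyBodySq s univ w ≤ K * T := by
  have hσ : 0 ≤ s - ⌊s⌋₊ := sub_nonneg.2 (Nat.floor_le hs.le)
  have hσ1 : s - ⌊s⌋₊ < 1 := by linarith [Nat.lt_floor_add_one s]
  have : Nonempty (Fin d) := ⟨⟨0, hd⟩⟩
  have : Nonempty (Fin N) := ⟨⟨0, hN⟩⟩
  obtain ⟨C, hC⟩ := exists_extension_weakVal (ν := Fin N) (κ := Fin d) ⌊s⌋₊ hσ hσ1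
  set c := sobolevConst d (s - ⌊s⌋₊) with hc
  have hc0 : c ≠ 0 := sobolevConst_ne_zero _ hσ hσ1
  have hct : c ≠ ⊤ := sobolevConst_ne_top _ _
  -- The factor `N * (d * c⁻¹)` counts the coordinates and undoes the normalization of the seminorm
  -- when pure derivatives are extracted from it.
  set L : ℝ≥0∞ := C * (1 + N * (d * c⁻¹)) with hL
  have hLt : L ≠ ⊤ := ENNReal.mul_ne_top (by simp) (ENNReal.add_ne_top.2 ⟨by simp,
    ENNReal.mul_ne_top (by simp) (ENNReal.mul_ne_top (by simp) (ENNReal.inv_ne_top.2 hc0))⟩)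
  set K₁ : ℝ≥0∞ := ∑ _j : Fin N, c *
    ∑ α ∈ Finset.piAntidiag (Finset.univ : Finset (Fin d)) ⌊s⌋₊,
      (Nat.multinomial Finset.univ α : ℝ≥0∞) * L with hK₁
  set K₂ : ℝ≥0∞ := sobolevConst (Fintype.card (Fin N × Fin d)) (s - ⌊s⌋₊) *
    ∑ β ∈ Finset.piAntidiag (Finset.univ : Finset (Fin N × Fin d)) ⌊s⌋₊,
      (Nat.multinomial Finset.univ β : ℝ≥0∞) * L with hK₂
  have hK₁t : K₁ ≠ ⊤ := ENNReal.sum_ne_top.2 fun j _ =>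
    ENNReal.mul_ne_top hct (ENNReal.sum_ne_top.2 fun α _ => ENNReal.mul_ne_top (by simp) hLt)
  have hK₂t : K₂ ≠ ⊤ := ENNReal.mul_ne_top (sobolevConst_ne_top _ _)
    (ENNReal.sum_ne_top.2 fun α _ => ENNReal.mul_ne_top (by simp) hLt)
  refine ⟨(L + K₁ + K₂).toNNReal, fun u hu hM T hT => ?_⟩
  rw [ENNReal.coe_toNNReal (by finiteness)]
  set M := manyBodySq s (unitCube d) u with hMdef
  have hMe : M = ∑ j : Fin N, c *
      ∑ α ∈ Finset.piAntidiag (Finset.univ : Finset (Fin d)) ⌊s⌋₊,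
        (Nat.multinomial Finset.univ α : ℝ≥0∞) *
          weakVal (Prod.mk j) (volume.restrict (Icc 0 1)) (openCube (Fin N × Fin d)) (s - ⌊s⌋₊)
            (particleIndex j α) u := by
    rw [hMdef, manyBodySq_eq (lintegral_unitCube d) (lintegral_powSet_unitCube d N),
      interior_powSet_unitCube]
  -- The pure derivative in the coordinate `(j, k)` is one term of the many-body sum, with
  -- multinomial weight at least `1`. Only these pure terms are used for the extension.
  have hle : ∀ (j : Fin N) (k : Fin d), weakVal (Prod.mk j) (volume.restrict (Icc 0 1))
      (openCube (Fin N × Fin d)) (s - ⌊s⌋₊) (Pi.single (j, k) ⌊s⌋₊) u ≤ c⁻¹ * M := fun j k => by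
    rw [← particleIndex_single]
    have hk : Pi.single k ⌊s⌋₊ ∈ Finset.piAntidiag (Finset.univ : Finset (Fin d)) ⌊s⌋₊ := by
      rw [Finset.mem_piAntidiag]
      exact ⟨by simp, fun _ _ => Finset.mem_univ _⟩
    refine (le_inv_mul_mul_sum (F := fun α => weakVal (Prod.mk j) (volume.restrict (Icc 0 1))
      (openCube (Fin N × Fin d)) (s - ⌊s⌋₊) (particleIndex j α) u)
      (M := fun α => (Nat.multinomial Finset.univ α : ℝ≥0∞)) hc0 hct hk
      (one_le_multinomial _)).trans (mul_le_mul_right ?_ _)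
    rw [hMe]
    exact Finset.single_le_sum (f := fun j : Fin N => c *
      ∑ α ∈ Finset.piAntidiag (Finset.univ : Finset (Fin d)) ⌊s⌋₊,
        (Nat.multinomial Finset.univ α : ℝ≥0∞) *
          weakVal (Prod.mk j) (volume.restrict (Icc 0 1)) (openCube (Fin N × Fin d)) (s - ⌊s⌋₊)
            (particleIndex j α) u) (fun _ _ => zero_le) (Finset.mem_univ j)
  rw [restrict_powSet_unitCube] at hu hT ⊢
  obtain ⟨w, hw, hwc, hwu, hw2, hw3, hw4⟩ := hC u hu (fun j k => ((hle j k).trans_lt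
    (ENNReal.mul_lt_top (ENNReal.inv_lt_top.2 (pos_iff_ne_zero.2 hc0)) hM.lt_top)).ne) _ rfl
  have hLT : C * ((∫⁻ x in openCube (Fin N × Fin d), ‖u x‖ₑ ^ 2) + ∑ j : Fin N, ∑ k : Fin d,
      weakVal (Prod.mk j) (volume.restrict (Icc 0 1)) (openCube (Fin N × Fin d)) (s - ⌊s⌋₊)
        (Pi.single (j, k) ⌊s⌋₊) u) ≤ L * T := by
    rw [hL, mul_assoc]
    refine mul_le_mul_right ?_ _
    rw [hT, add_mul, one_mul]
    calc _ ≤ (∫⁻ x in openCube (Fin N × Fin d), ‖u x‖ₑ ^ 2)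
          + ∑ _j : Fin N, ∑ _k : Fin d, c⁻¹ * M := by
          gcongr with j _ k _
          exact hle j k
      _ = (∫⁻ x in openCube (Fin N × Fin d), ‖u x‖ₑ ^ 2) + N * (d * c⁻¹) * M := by
          simp only [Finset.sum_const, Finset.card_univ, Fintype.card_fin, nsmul_eq_mul]
          ring
      _ ≤ _ := by
          gcongr
          · exact le_self_add
          · exact le_add_self
  refine ⟨?_, w, hw, hwc, hwu, ?_, ?_⟩
  · rw [homSobolevSq_eq (lintegral_powSet_unitCube d N), interior_powSet_unitCube]
    calc _ ≤ K₂ * T := by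
          rw [hK₂, mul_assoc, Finset.sum_mul]
          refine mul_le_mul_right (Finset.sum_le_sum fun β hβ => ?_) _
          rw [mul_assoc]
          refine mul_le_mul_right ?_ _
          exact (hw4 β (Finset.mem_piAntidiag.1 hβ).1).trans hLT
      _ ≤ _ := mul_le_mul_left le_add_self _
  · refine (hw2.trans hLT).trans (mul_le_mul_left ?_ _)
    rw [add_assoc]
    exact le_self_add
  · have hU : powSet N (univ : Set (EuclideanSpace ℝ (Fin d))) = univ :=
      eq_univ_of_forall fun _ _ => mem_univ _
    rw [manyBodySq_eq (μ := volume) (fun F => lintegral_univ_euclidean F)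
      (fun F => by rw [hU]; exact lintegral_univ_euclidean F), hU, interior_univ]
    calc _ ≤ K₁ * T := by
          rw [hK₁, Finset.sum_mul]
          refine Finset.sum_le_sum fun j _ => ?_
          rw [mul_assoc, Finset.sum_mul]
          refine mul_le_mul_right (Finset.sum_le_sum fun α hα => ?_) _
          rw [mul_assoc]
          refine mul_le_mul_right ?_ _
          exact (hw3 j _ ((sum_particleIndex j α).trans (Finset.mem_piAntidiag.1 hα).1)).trans hLT
      _ ≤ _ := by
          refine mul_le_mul_left ?_ _
          rw [add_assoc, add_left_comm]
          exact le_self_add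

end Comparison

/-! ### Passage from squares to norms -/

section Norms

theorem eLpNorm_two_sq {α : Type*} [MeasurableSpace α] {μ : Measure α} (u : α → ℂ) :
    eLpNorm u 2 μ ^ 2 = ∫⁻ x, ‖u x‖ₑ ^ 2 ∂μ := by
  rw [eLpNorm_eq_lintegral_rpow_enorm_toReal two_ne_zero ENNReal.ofNat_ne_top]
  simp only [ENNReal.toReal_ofNat, ENNReal.rpow_two]
  rw [← ENNReal.rpow_two, ← ENNReal.rpow_mul]
  norm_num

theorem rpow_half_sq (x : ℝ≥0∞) : (x ^ (1 / 2 : ℝ)) ^ 2 = x := by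
  rw [← ENNReal.rpow_two, ← ENNReal.rpow_mul]
  norm_num

theorem sq_rpow_half (x : ℝ≥0∞) : (x ^ 2) ^ (1 / 2 : ℝ) = x := by
  rw [← ENNReal.rpow_two, ← ENNReal.rpow_mul]
  norm_num

theorem add_le_two_mul_rpow_half {a b X : ℝ≥0∞} (ha : a ^ 2 ≤ X) (hb : b ^ 2 ≤ X) :
    a + b ≤ 2 * X ^ (1 / 2 : ℝ) := by
  rw [two_mul]
  exact add_le_add (sq_rpow_half a ▸ ENNReal.rpow_le_rpow ha (by norm_num))
    (sq_rpow_half b ▸ ENNReal.rpow_le_rpow hb (by norm_num))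

theorem rpow_half_le_add {a b X : ℝ≥0∞} (h : X ≤ a ^ 2 + b ^ 2) : X ^ (1 / 2 : ℝ) ≤ a + b := by
  rw [← sq_rpow_half (a + b)]
  refine ENNReal.rpow_le_rpow (h.trans ?_) (by norm_num)
  rw [add_sq]
  exact add_le_add_left le_self_add _

end Norms

/-! ### The theorem -/

theorem lemmaA1 (d N : ℕ) (hd : 1 ≤ d) (hN : 1 ≤ N) (s : ℝ) (hs : 0 < s) :
    (∃ c C : ℝ≥0, 0 < c ∧ 0 < C ∧
      ∀ u : EuclideanSpace ℝ (Fin N × Fin d) → ℂ,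
        MemLp u 2 (volume.restrict (powSet N (unitCube d))) →
        c * (eLpNorm u 2 (volume.restrict (powSet N (unitCube d)))
            + manyBodySeminorm s (unitCube d) u)
          ≤ sobolevNorm s (powSet N (unitCube d)) u ∧
        sobolevNorm s (powSet N (unitCube d)) u
          ≤ C * (eLpNorm u 2 (volume.restrict (powSet N (unitCube d)))
              + manyBodySeminorm s (unitCube d) u)) ∧
    (∃ C : ℝ≥0, 0 < C ∧
      ∀ u : EuclideanSpace ℝ (Fin N × Fin d) → ℂ,
        MemLp u 2 (volume.restrict (powSet N (unitCube d))) →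
        manyBodySeminorm s (unitCube d) u < ⊤ →
        ∃ w : EuclideanSpace ℝ (Fin N × Fin d) → ℂ,
          MemLp w 2 volume ∧ HasCompactSupport w ∧
          w =ᵐ[volume.restrict (powSet N (unitCube d))] u ∧
          eLpNorm w 2 volume + manyBodySeminorm s univ w
            ≤ C * (eLpNorm u 2 (volume.restrict (powSet N (unitCube d)))
                + manyBodySeminorm s (unitCube d) u)) := by
  obtain ⟨K, hK⟩ := exists_manyBodySq_le_homSobolevSq d N hd hs
  obtain ⟨L, hL⟩ := exists_extension_manyBodySq d N hd hN hs
  have hfin : ∀ u : EuclideanSpace ℝ (Fin N × Fin d) → ℂ,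
      manyBodySeminorm s (unitCube d) u < ⊤ → manyBodySq s (unitCube d) u ≠ ⊤ := fun u h h' => by
    rw [manyBodySeminorm, h', ENNReal.top_rpow_of_pos (by norm_num)] at h
    exact h.ne rfl
  -- The summand `1` covers the `L²` norm and keeps the constants positive; the factor `2` appears
  -- where a sum of two norms is bounded by the square root of a common bound of their squares.
  refine ⟨⟨(2 * (1 + K))⁻¹, 1 + L, by positivity, by positivity, fun u hu => ⟨?_, ?_⟩⟩,
    2 * (1 + L), by positivity, fun u hu hM => ?_⟩
  · rw [ENNReal.coe_inv (by positivity), mul_comm, ← div_eq_mul_inv]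
    refine ENNReal.div_le_of_le_mul' ?_
    have h1 : (eLpNorm u 2 (volume.restrict (powSet N (unitCube d)))) ^ 2
        ≤ ((1 + K) * sobolevNorm s (powSet N (unitCube d)) u) ^ 2 := by
      rw [mul_pow, sobolevNorm, rpow_half_sq]
      refine le_self_add.trans (le_mul_of_one_le_left' ?_)
      exact one_le_pow₀ le_self_add
    have h2 : manyBodySeminorm s (unitCube d) u ^ 2
        ≤ ((1 + K) * sobolevNorm s (powSet N (unitCube d)) u) ^ 2 := by
      rw [mul_pow, sobolevNorm, rpow_half_sq, manyBodySeminorm, rpow_half_sq]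
      refine (hK u).trans (mul_le_mul' ?_ le_add_self)
      calc (K : ℝ≥0∞) ≤ 1 + K := le_add_self
        _ ≤ _ := le_self_pow₀ le_self_add two_ne_zero
    refine (add_le_two_mul_rpow_half h1 h2).trans (le_of_eq ?_)
    rw [sq_rpow_half]
    push_cast
    ring
  · by_cases hM : manyBodySeminorm s (unitCube d) u < ⊤
    · obtain ⟨h1, -⟩ := hL u hu (hfin u hM) _ rfl
      rw [sobolevNorm, mul_add]
      refine rpow_half_le_add ?_
      rw [mul_pow, mul_pow, ← mul_add, manyBodySeminorm, rpow_half_sq, eLpNorm_two_sq]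
      calc _ ≤ (1 + (L : ℝ≥0∞)) * ((∫⁻ x in powSet N (unitCube d), ‖u x‖ₑ ^ 2)
            + manyBodySq s (unitCube d) u) := by
            rw [add_mul, one_mul]
            exact add_le_add le_self_add h1
        _ ≤ _ := by
            push_cast
            exact mul_le_mul_left (le_self_pow₀ le_self_add two_ne_zero) _
    -- For an infinite many-body seminorm the right side is infinite, since the constant is nonzero.
    · rw [not_lt_top_iff.1 hM, add_top, ENNReal.mul_top (by simp)]
      exact le_top
  · obtain ⟨-, w, hw, hwc, hwu, hw1, hw2⟩ := hL u hu (hfin u hM) _ rfl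
    refine ⟨w, hw, hwc, hwu, ?_⟩
    set T := (∫⁻ x in powSet N (unitCube d), ‖u x‖ₑ ^ 2) + manyBodySq s (unitCube d) u with hT
    have hLT : (L : ℝ≥0∞) * T ≤ ((1 + L) * T ^ (1 / 2 : ℝ)) ^ 2 := by
      rw [mul_pow, rpow_half_sq]
      refine mul_le_mul_left ?_ _
      calc (L : ℝ≥0∞) ≤ 1 + L := le_add_self
        _ ≤ _ := le_self_pow₀ le_self_add two_ne_zero
    have h1 : eLpNorm w 2 volume ^ 2 ≤ ((1 + L) * T ^ (1 / 2 : ℝ)) ^ 2 := by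
      rw [eLpNorm_two_sq]; exact hw1.trans hLT
    have h2 : manyBodySeminorm s univ w ^ 2 ≤ ((1 + L) * T ^ (1 / 2 : ℝ)) ^ 2 := by
      rw [manyBodySeminorm, rpow_half_sq]; exact hw2.trans hLT
    refine (add_le_two_mul_rpow_half h1 h2).trans ?_
    rw [sq_rpow_half, ← mul_assoc]
    push_cast
    gcongr
    refine rpow_half_le_add (le_of_eq ?_)
    rw [hT, eLpNorm_two_sq, manyBodySeminorm, rpow_half_sq]
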